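/- **Setting.** Let $d,\ell,m\ge 1$ be integers, $T,\sigma,M,L>0$, $p>1$. Let $\mathcal W_p(\mathbb R^d)$ be the set of Borel probability measures on $\mathbb R^d$ with finite $p$-th moment, and let $\mathcal W_1(\mathbb R^d)$ carry the distance $\mathcal W_1(\mu,\nu)=\inf_\gamma\int|x-y|\,d\gamma$, the infimum being over couplings $\gamma$ of $\mu,\nu$. Let $H_1,H_2,K_1,K_2:\mathbb R^d\to\mathbb R^d$ be globally Lipschitz and write $H*\mu(x)=\int H(x-y)\,d\mu(y)$. Let $\mathcal U\subset\mathbb R^{d\times\ell}$ be nonempty and compact, let $\mathcal G$ be the set of functions $g:\mathcal W_1(\mathbb R^d)\to\mathbb R^\ell$ that are $L$-Lipschitz and bounded by $M$, and put $E=L^1([0,T];\mathcal U)\times\mathcal G$. Let $\mathcal L:[0,T]\times(\mathbb R^d)^m\times\mathcal W_1(\mathbb R^d)\to\mathbb R$ be uniformly continuous and let $\Psi:(\mathbb R^{d\times\ell})^m\times(\mathbb R^\ell)^m\to\mathbb R$ be continuous and convex in its first variable. Fix $\mu_0\in\mathcal W_p(\mathbb R^d)$ and $\mathbf Y_0=(Y^1_0,\dots,Y^m_0)\in(\mathbb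 R^d)^m$. For $N\ge1$ and $(\mathbf h,\mathbf g)\in E^m$, let $X^1,\dots,X^N$, $\mathbf Y=(Y^1,\dots,Y^m)$ be the strong solution on $[0,T]$ of $$dX^n=\Big(\tfrac1N\sum_{l=1}^N H_1(X^n-X^l)+\tfrac1m\sum_{j=1}^m K_1(Y^j-X^n)\Big)dt+\sqrt{2\sigma}\,dW^n,\qquad X^n(0)=X^n_0,$$ $$\tfrac{d}{dt}Y^i=\tfrac1N\sum_{l=1}^N K_2(Y^i-X^l)+\tfrac1m\sum_{j=1}^m H_2(Y^j-Y^i)+h^i(t)\,g^i(\mu^N_t),\qquad Y^i(0)=Y^i_0,$$ where $\mu^N_t=\frac1N\sum_{n}\delta_{X^n(t)}$, the $X^n_0$ are i.i.d. with law $\mu_0$, and the $W^n$ are independent $d$-dimensional Brownian motions, independent of the $X^n_0$. Put $$\mathcal F_N(\mathbf h,\mathbf g)=\mathbb E\Big[\int_0^T\mathcal L(t,\mathbf Y(t),\mu^N_t)\,dt+\int_0^T\Psi(\mathbf h(t),\mathbf g(\mu^N_t))\,dt\Big].$$ Let $\overline X$, $\overline{\mathbf Y}=(\overline Y^1,\dots,\overline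 Y^m)$ (the latter deterministic) be the strong solution of $$d\overline X=\Big(H_1*\overline\mu_t(\overline X)+\tfrac1m\sum_{j=1}^m K_1(\overline Y^j-\overline X)\Big)dt+\sqrt{2\sigma}\,dW,\qquad \overline\mu_t=\mathrm{Law}(\overline X(t)),$$ $$\tfrac{d}{dt}\overline Y^i=K_2*\overline\mu_t(\overline Y^i)+\tfrac1m\sum_{j=1}^m H_2(\overline Y^j-\overline Y^i)+h^i(t)\,g^i(\overline\mu_t),\qquad \overline Y^i(0)=Y^i_0,$$ where $\overline X(0)$ has law $\mu_0$ and is independent of the $d$-dimensional Brownian motion $W$, and put $$\mathcal F(\mathbf h,\mathbf g)=\int_0^T\mathcal L(t,\overline{\mathbf Y}(t),\overline\mu_t)\,dt+\int_0^T\Psi(\mathbf h(t),\mathbf g(\overline\mu_t))\,dt.$$ **Proposition (convergence of minima).** The functionals $\mathcal F_N$ ($N\ge1$) and $\mathcal F$ are well defined (both systems have strong solutions, all integrals exist, and the values do not depend on the choice of the solution) and bounded from below on the nonempty set $E^m$, and $$\lim_{N\to\infty}\ \inf_{E^m}\mathcal F_N=\inf_{E^m}\mathcal F .$$ If moreover $\mathcal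 U$ is convex, then all these infima are attained, so that $$\lim_{N\to\infty}\ \min_{(\mathbf h,\mathbf g)\in E^m}\mathcal F_N(\mathbf h,\mathbf g)=\min_{(\mathbf h,\mathbf g)\in E^m}\mathcal F(\mathbf h,\mathbf g).$$ -/

import Mathlib

open Set Filter Topology MeasureTheory ProbabilityTheory
open scoped NNReal ENNReal

noncomputable section

namespace MeanField

/-- The state space `ℝᵈ` with its Euclidean norm. -/
abbrev Vec (d : ℕ) := EuclideanSpace ℝ (Fin d)

/-- `μ` is a Borel probability measure on `ℝᵈ` with finite `p`-th moment, `μ ∈ 𝒲_p(ℝᵈ)`. -/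
structure MemWasserstein {d : ℕ} (p : ℝ) (μ : Measure (Vec d)) : Prop where
  isProbability : IsProbabilityMeasure μ
  moment_lt_top : ∫⁻ x, ‖x‖ₑ ^ p ∂μ < ∞

/-- The space `𝒲₁(ℝᵈ)`. -/
def WassersteinOne (d : ℕ) := {μ : Measure (Vec d) // MemWasserstein 1 μ}

/-- Couplings of two measures on `ℝᵈ`. -/
def couplings {d : ℕ} (μ ν : Measure (Vec d)) : Set (Measure (Vec d × Vec d)) :=
  {γ | γ.map Prod.fst = μ ∧ γ.map Prod.snd = ν}

/-- The Wasserstein distance `𝒲₁(μ, ν) = inf_γ ∫ |x - y| dγ(x, y)` on `𝒲₁(ℝᵈ)`. -/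
def wDist {d : ℕ} (μ ν : WassersteinOne d) : ℝ :=
  (⨅ γ ∈ couplings μ.1 ν.1, ∫⁻ z, edist z.1 z.2 ∂γ).toReal

/-- The empirical measure `N⁻¹ ∑ₙ δ_{xₙ}` of `N ≥ 1` points. -/
def empirical {d N : ℕ} [NeZero N] (x : Fin N → Vec d) : WassersteinOne d :=
  ⟨(N : ℝ≥0∞)⁻¹ • ∑ n, Measure.dirac (x n), by
    have hN : (N : ℝ≥0∞) ≠ 0 := by exact_mod_cast NeZero.ne N
    refine ⟨⟨?_⟩, ?_⟩
    · simp [ENNReal.inv_mul_cancel hN (ENNReal.natCast_ne_top N)]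
    · simp only [lintegral_smul_measure, lintegral_finsetSum_measure, ENNReal.rpow_one,
        lintegral_dirac, smul_eq_mul]
      exact ENNReal.mul_lt_top (ENNReal.inv_lt_top.2 (pos_iff_ne_zero.2 hN))
        (ENNReal.sum_lt_top.2 fun n _ => enorm_lt_top)⟩

/-- The convolution `(H ∗ μ)(x) = ∫ H(x - y) dμ(y)`. -/
def conv {d : ℕ} (H : Vec d → Vec d) (μ : WassersteinOne d) (x : Vec d) : Vec d :=
  ∫ y, H (x - y) ∂μ.1

/-- A (standard, `d`-dimensional) Brownian motion: the components are independent real Brownian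
motions. -/
structure IsBrownianVec {Ω : Type*} [MeasurableSpace Ω] {d : ℕ}
    (W : ℝ≥0 → Ω → Vec d) (P : Measure Ω) : Prop where
  measurable : ∀ t, Measurable (W t)
  brownian : ∀ i, IsBrownianReal (fun t ω => W t ω i) P
  indep : iIndepFun (fun (i : Fin d) (ω : Ω) (t : ℝ≥0) => W t ω i) P

/-- The data of the control problem with `m` leaders in `ℝᵈ`: horizon, diffusion constant,
interaction kernels, initial positions of the leaders, the set `U` of values of the open-loop
controls `hʲ`, the bound `M` and the Lipschitz constant `L` of the feedback controls `gʲ`,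
the Lagrangian and the control cost. -/
structure Data (d ℓ m : ℕ) where
  T : ℝ
  σ : ℝ
  H₁ : Vec d → Vec d
  H₂ : Vec d → Vec d
  K₁ : Vec d → Vec d
  K₂ : Vec d → Vec d
  Y₀ : Fin m → Vec d
  U : Set (Matrix (Fin d) (Fin ℓ) ℝ)
  M : ℝ
  L : ℝ
  lagrangian : ℝ → (Fin m → Vec d) → WassersteinOne d → ℝ
  controlCost : (Fin m → Matrix (Fin d) (Fin ℓ) ℝ) → (Fin m → Vec ℓ) → ℝ

/-- A pair `(𝐡, 𝐠)` of open-loop and feedback controls. -/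
structure Control (d ℓ m : ℕ) where
  h : Fin m → ℝ → Matrix (Fin d) (Fin ℓ) ℝ
  g : Fin m → WassersteinOne d → Vec ℓ

/-- The control `uʲ(t, μ) = hʲ(t) gʲ(μ)`. -/
def Control.u {d ℓ m : ℕ} (a : Control d ℓ m) (j : Fin m) (t : ℝ) (μ : WassersteinOne d) : Vec d :=
  Matrix.toEuclideanLin (a.h j t) (a.g j μ)

variable {d ℓ m : ℕ}

/-- `x(t) = x₀ + ∫₀ᵗ b(s) ds + w(t)` for all `t ∈ [0, T]`, with `b` integrable. -/
def SolvesIntegralEq (T : ℝ) (x : ℝ → Vec d) (x₀ : Vec d) (b w : ℝ → Vec d) : Prop :=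
  IntegrableOn b (Icc 0 T) ∧ ∀ t ∈ Icc 0 T, x t = x₀ + (∫ s in (0 : ℝ)..t, b s) + w t

namespace Data

/-- The set `Eᵐ`: every `hʲ` is a measurable function from `[0, T]` to `U` (for bounded `U` it is
then in `L¹`), every `gʲ` is `M`-bounded and `L`-Lipschitz on `𝒲₁(ℝᵈ)`. -/
def admissible (D : Data d ℓ m) : Set (Control d ℓ m) :=
  {a | (∀ j, AEStronglyMeasurable (a.h j) (volume.restrict (Icc 0 D.T)) ∧
        ∀ᵐ t ∂(volume.restrict (Icc 0 D.T)), a.h j t ∈ D.U) ∧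
      ∀ j, (∀ μ, ‖a.g j μ‖ ≤ D.M) ∧ ∀ μ ν, ‖a.g j μ - a.g j ν‖ ≤ D.L * wDist μ ν}

/-- The cost along a trajectory `(Y, μ)`:
`∫₀ᵀ 𝓛(t, Y(t), μ(t)) dt + ∫₀ᵀ Ψ(𝐡(t), 𝐠(μ(t))) dt`. -/
def pathCost (D : Data d ℓ m) (a : Control d ℓ m)
    (Y : ℝ → Fin m → Vec d) (μ : ℝ → WassersteinOne d) : ℝ :=
  (∫ t in (0 : ℝ)..D.T, D.lagrangian t (Y t) (μ t)) +
    ∫ t in (0 : ℝ)..D.T, D.controlCost (fun j => a.h j t) (fun j => a.g j (μ t))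

/-- Both time integrals in the cost exist. -/
def PathCostIntegrable (D : Data d ℓ m) (a : Control d ℓ m)
    (Y : ℝ → Fin m → Vec d) (μ : ℝ → WassersteinOne d) : Prop :=
  IntegrableOn (fun t => D.lagrangian t (Y t) (μ t)) (Icc 0 D.T) ∧
    IntegrableOn (fun t => D.controlCost (fun j => a.h j t) (fun j => a.g j (μ t))) (Icc 0 D.T)

/-- `(X¹, …, Xᴺ, Y¹, …, Yᵐ)` is a strong solution of the controlled system of `N` followers and
`m` leaders with initial data `X₀ⁿ`, `Y₀ⁱ` and Brownian motions `Wⁿ`: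
`dXⁿ = (N⁻¹ ∑ₗ H₁(Xⁿ - Xˡ) + m⁻¹ ∑ⱼ K₁(Yʲ - Xⁿ)) dt + √(2σ) dWⁿ`,
`dYⁱ/dt = N⁻¹ ∑ₗ K₂(Yⁱ - Xˡ) + m⁻¹ ∑ⱼ H₂(Yʲ - Yⁱ) + hⁱ(t) gⁱ(N⁻¹ ∑ₗ δ_{Xˡ(t)})`. -/
structure IsDiscreteSolution {Ω : Type*} [MeasurableSpace Ω] (D : Data d ℓ m) (P : Measure Ω)
    {N : ℕ} [NeZero N] (X₀ : Fin N → Ω → Vec d) (W : Fin N → ℝ≥0 → Ω → Vec d) (a : Control d ℓ m)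
    (X : Fin N → ℝ → Ω → Vec d) (Y : Fin m → ℝ → Ω → Vec d) : Prop where
  measurable_X : ∀ n, ∀ t ∈ Icc 0 D.T, Measurable (X n t)
  measurable_Y : ∀ i, ∀ t ∈ Icc 0 D.T, Measurable (Y i t)
  continuous_X : ∀ n ω, ContinuousOn (fun t => X n t ω) (Icc 0 D.T)
  continuous_Y : ∀ i ω, ContinuousOn (fun t => Y i t ω) (Icc 0 D.T)
  eq_X : ∀ n, ∀ᵐ ω ∂P, SolvesIntegralEq D.T (fun t => X n t ω) (X₀ n ω)
    (fun s => (N : ℝ)⁻¹ • ∑ l, D.H₁ (X n s ω - X l s ω) +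
      (m : ℝ)⁻¹ • ∑ j, D.K₁ (Y j s ω - X n s ω))
    (fun t => √(2 * D.σ) • W n t.toNNReal ω)
  eq_Y : ∀ i, ∀ᵐ ω ∂P, SolvesIntegralEq D.T (fun t => Y i t ω) (D.Y₀ i)
    (fun s => (N : ℝ)⁻¹ • ∑ l, D.K₂ (Y i s ω - X l s ω) +
      (m : ℝ)⁻¹ • ∑ j, D.H₂ (Y j s ω - Y i s ω) + a.u i s (empirical fun l => X l s ω))
    (fun _ => 0)

/-- The random cost of a trajectory of the system of `N` followers. -/
def discreteCost {Ω : Type*} (D : Data d ℓ m) {N : ℕ} [NeZero N] (a : Control d ℓ m)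
    (X : Fin N → ℝ → Ω → Vec d) (Y : Fin m → ℝ → Ω → Vec d) (ω : Ω) : ℝ :=
  D.pathCost a (fun t i => Y i t ω) (fun t => empirical fun n => X n t ω)

/-- The functional `𝓕_N(𝐡, 𝐠)`: the expected cost of the solution of the system of `N` followers. -/
def discreteFunctional {Ω : Type*} [MeasurableSpace Ω] (D : Data d ℓ m) (P : Measure Ω)
    {N : ℕ} [NeZero N] (X₀ : Fin N → Ω → Vec d) (W : Fin N → ℝ≥0 → Ω → Vec d)
    (a : Control d ℓ m) : ℝ :=
  Classical.epsilon fun c : ℝ => ∃ X Y, D.IsDiscreteSolution P X₀ W a X Y ∧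
    c = ∫ ω, D.discreteCost a X Y ω ∂P

/-- `𝓕_N` is well defined at `a`: the system has a solution, and along every solution all the
integrals exist and the expected cost is `𝓕_N(a)`. -/
def DiscreteWellPosed {Ω : Type*} [MeasurableSpace Ω] (D : Data d ℓ m) (P : Measure Ω)
    {N : ℕ} [NeZero N] (X₀ : Fin N → Ω → Vec d) (W : Fin N → ℝ≥0 → Ω → Vec d)
    (a : Control d ℓ m) : Prop :=
  (∃ X Y, D.IsDiscreteSolution P X₀ W a X Y) ∧
    ∀ X Y, D.IsDiscreteSolution P X₀ W a X Y →
      (∀ᵐ ω ∂P, D.PathCostIntegrable a (fun t i => Y i t ω) (fun t => empirical fun n => X n t ω)) ∧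
      Integrable (D.discreteCost a X Y) P ∧
      D.discreteFunctional P X₀ W a = ∫ ω, D.discreteCost a X Y ω ∂P

/-- `(X, Y¹, …, Yᵐ)`, with `μ(t) = Law(X(t)) ∈ 𝒲₁(ℝᵈ)`, is a strong solution of the mean-field
system with initial data `X₀`, `Y₀ⁱ` and Brownian motion `W`:
`dX = (H₁ ∗ μ(t) (X) + m⁻¹ ∑ⱼ K₁(Yʲ - X)) dt + √(2σ) dW`,
`dYⁱ/dt = K₂ ∗ μ(t) (Yⁱ) + m⁻¹ ∑ⱼ H₂(Yʲ - Yⁱ) + hⁱ(t) gⁱ(μ(t))`. -/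
structure IsMeanFieldSolution {Ω : Type*} [MeasurableSpace Ω] (D : Data d ℓ m) (P : Measure Ω)
    (X₀ : Ω → Vec d) (W : ℝ≥0 → Ω → Vec d) (a : Control d ℓ m)
    (X : ℝ → Ω → Vec d) (μ : ℝ → WassersteinOne d) (Y : Fin m → ℝ → Vec d) : Prop where
  measurable_X : ∀ t ∈ Icc 0 D.T, Measurable (X t)
  continuous_X : ∀ ω, ContinuousOn (fun t => X t ω) (Icc 0 D.T)
  law_X : ∀ t ∈ Icc 0 D.T, P.map (X t) = (μ t).1
  continuous_Y : ∀ i, ContinuousOn (Y i) (Icc 0 D.T)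
  eq_X : ∀ᵐ ω ∂P, SolvesIntegralEq D.T (fun t => X t ω) (X₀ ω)
    (fun s => conv D.H₁ (μ s) (X s ω) + (m : ℝ)⁻¹ • ∑ j, D.K₁ (Y j s - X s ω))
    (fun t => √(2 * D.σ) • W t.toNNReal ω)
  eq_Y : ∀ i, SolvesIntegralEq D.T (Y i) (D.Y₀ i)
    (fun s => conv D.K₂ (μ s) (Y i s) + (m : ℝ)⁻¹ • ∑ j, D.H₂ (Y j s - Y i s) + a.u i s (μ s))
    (fun _ => 0)

/-- The functional `𝓕(𝐡, 𝐠)`: the cost of the solution of the mean-field system. -/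
def meanFieldFunctional {Ω : Type*} [MeasurableSpace Ω] (D : Data d ℓ m) (P : Measure Ω)
    (X₀ : Ω → Vec d) (W : ℝ≥0 → Ω → Vec d) (a : Control d ℓ m) : ℝ :=
  Classical.epsilon fun c : ℝ => ∃ X μ Y, D.IsMeanFieldSolution P X₀ W a X μ Y ∧
    c = D.pathCost a (fun t i => Y i t) μ

/-- `𝓕` is well defined at `a`: the mean-field system has a solution, and along every solution the
time integrals exist and the cost is `𝓕(a)`. -/
def MeanFieldWellPosed {Ω : Type*} [MeasurableSpace Ω] (D : Data d ℓ m) (P : Measure Ω)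
    (X₀ : Ω → Vec d) (W : ℝ≥0 → Ω → Vec d) (a : Control d ℓ m) : Prop :=
  (∃ X μ Y, D.IsMeanFieldSolution P X₀ W a X μ Y) ∧
    ∀ X μ Y, D.IsMeanFieldSolution P X₀ W a X μ Y →
      D.PathCostIntegrable a (fun t i => Y i t) μ ∧
      D.meanFieldFunctional P X₀ W a = D.pathCost a (fun t i => Y i t) μ

/-- Uniform continuity of the Lagrangian on `[0, T] × (ℝᵈ)ᵐ × 𝒲₁(ℝᵈ)`. -/
def LagrangianUniformContinuous (D : Data d ℓ m) : Prop :=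
  ∀ ε > 0, ∃ δ > 0, ∀ t ∈ Icc 0 D.T, ∀ s ∈ Icc 0 D.T, ∀ (y z : Fin m → Vec d)
    (μ ν : WassersteinOne d), |t - s| < δ → dist y z < δ → wDist μ ν < δ →
      |D.lagrangian t y μ - D.lagrangian s z ν| < ε

end Data

end MeanField

end

open MeanField

/-! The heart of the proof is a stability estimate for systems with a common noise. The noise is
additive, so two followers with the same initial value and the same Brownian path differ by the
solution of an ordinary integral equation, and Grönwall's inequality applies for each `ω`
separately. A flow consists of the law, or the empirical measure, of the followers together with the
leaders. `Data.Regular.flowDist_le` bounds the distance of two flows by the difference of the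
primitives of the two controls, taken along one of the flows, and an external error in the measure
component. Convolution with an empirical measure is exactly the particle interaction, so the same
estimate compares two mean-field systems, two particle systems, or a particle system with the
mean-field system. The external error vanishes in the first two cases. In the third it is the
distance between the mean-field law and the empirical measure of `N` independent mean-field
followers driven by the noises of the particles (`Data.IsMeanFieldSolution.exists_copies`).
Existence of solutions comes from fixed points of Volterra maps, uniqueness from stability with
equal controls.

The convergence of the infima needs no compactness: the functionals converge uniformly on the
admissible set (`Data.Regular.exists_forall_abs_sub_le`). Two facts give this uniformity. First, the
cost changes by at most `ε + C ∫ flowDist` with `C` independent of the control, because a uniformly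
continuous Lagrangian grows at most linearly along segments and mixtures, and the control cost is
uniformly continuous on compact sets. Secondly, the law of large numbers
`integral_wDist_empirical_le` depends on the law only through the tail of its first moment, and
these tails are uniformly small: followers under different controls but with the same noise differ
by a deterministic constant (`Data.IsMeanFieldSolution.excess_le`).

Minimisers come from the direct method. If `U` is compact and convex, every sequence of admissible
controls has a subsequence along which the primitives of `h` converge and `g` converges on a
prescribed separable set of measures (`Data.Regular.exists_controlTendsto`). Jensen's inequality for
moving averages makes convex integral functionals lower semicontinuous under convergence of
primitives (`eventually_integral_le_of_tendsto_primitive`). Applied to linear functionals and their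
negatives, this gives convergence of the control terms, hence by stability of the trajectories;
applied to the control cost, it gives lower semicontinuity of the functional. For the particle
system this happens `ω` by `ω` along one subsequence and passes to expectations by dominated
convergence. -/

namespace MeanField

/-! ### The Wasserstein distance: couplings, gluing, triangle inequality. -/

section Wasserstein

variable {d : ℕ}

instance WassersteinOne.isProbabilityMeasure (μ : WassersteinOne d) : IsProbabilityMeasure μ.1 :=
  μ.2.isProbability

lemma WassersteinOne.lintegral_enorm_lt_top (μ : WassersteinOne d) : ∫⁻ x, ‖x‖ₑ ∂μ.1 < ∞ := by
  simpa using μ.2.moment_lt_top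

lemma WassersteinOne.integrable_id (μ : WassersteinOne d) : Integrable (fun x => x) μ.1 :=
  ⟨aestronglyMeasurable_id, μ.lintegral_enorm_lt_top⟩

/-- The element of `𝒲₁(ℝᵈ)` given by the law of an integrable random vector. -/
noncomputable def lawOf {Ω : Type*} [MeasurableSpace Ω] (P : Measure Ω) [IsProbabilityMeasure P]
    (X : Ω → Vec d) (hX : Integrable X P) : WassersteinOne d :=
  ⟨P.map X, ⟨Measure.isProbabilityMeasure_map hX.aemeasurable, by
    rw [lintegral_map' (by fun_prop) hX.aemeasurable]
    simpa [HasFiniteIntegral] using hX.2⟩⟩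

/-- The transport cost with values in `[0, ∞]`. -/
noncomputable def transportCost (μ ν : Measure (Vec d)) : ℝ≥0∞ :=
  ⨅ γ ∈ couplings μ ν, ∫⁻ z, edist z.1 z.2 ∂γ

lemma wDist_eq (μ ν : WassersteinOne d) : wDist μ ν = (transportCost μ.1 ν.1).toReal := rfl

lemma isProbabilityMeasure_of_mem_couplings {μ ν : WassersteinOne d} {γ : Measure (Vec d × Vec d)}
    (hγ : γ ∈ couplings μ.1 ν.1) : IsProbabilityMeasure γ := by
  refine ⟨?_⟩
  have h : (γ.map Prod.fst) univ = 1 := by rw [hγ.1]; simp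
  rwa [Measure.map_apply measurable_fst MeasurableSet.univ] at h

lemma transportCost_le {μ ν : Measure (Vec d)} {γ : Measure (Vec d × Vec d)}
    (hγ : γ ∈ couplings μ ν) : transportCost μ ν ≤ ∫⁻ z, edist z.1 z.2 ∂γ :=
  iInf₂_le γ hγ

lemma lintegral_edist_lt_top_of_mem_couplings {μ ν : WassersteinOne d}
    {γ : Measure (Vec d × Vec d)} (hγ : γ ∈ couplings μ.1 ν.1) :
    ∫⁻ z, edist z.1 z.2 ∂γ < ∞ := by
  calc ∫⁻ z, edist z.1 z.2 ∂γ ≤ ∫⁻ z, (‖z.1‖ₑ + ‖z.2‖ₑ) ∂γ := by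
        gcongr with z
        rw [edist_eq_enorm_sub]
        exact enorm_sub_le
    _ = (∫⁻ z, ‖z.1‖ₑ ∂γ) + ∫⁻ z, ‖z.2‖ₑ ∂γ := lintegral_add_left (by fun_prop) _
    _ = (∫⁻ x, ‖x‖ₑ ∂μ.1) + ∫⁻ x, ‖x‖ₑ ∂ν.1 := by
        rw [← hγ.1, ← hγ.2, lintegral_map (by fun_prop) measurable_fst,
          lintegral_map (by fun_prop) measurable_snd]
    _ < ∞ := ENNReal.add_lt_top.2 ⟨μ.lintegral_enorm_lt_top, ν.lintegral_enorm_lt_top⟩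

lemma prod_mem_couplings (μ ν : WassersteinOne d) : μ.1.prod ν.1 ∈ couplings μ.1 ν.1 := by
  constructor <;> simp

/-- The product coupling has finite cost because both marginals have a finite first moment; hence
`toReal` in `wDist` loses nothing. -/
lemma transportCost_ne_top (μ ν : WassersteinOne d) : transportCost μ.1 ν.1 ≠ ∞ :=
  ((transportCost_le (prod_mem_couplings μ ν)).trans_lt
    (lintegral_edist_lt_top_of_mem_couplings (prod_mem_couplings μ ν))).ne

lemma wDist_nonneg (μ ν : WassersteinOne d) : 0 ≤ wDist μ ν := ENNReal.toReal_nonneg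

lemma wDist_le_of_transportCost_le {μ ν : WassersteinOne d} {c : ℝ} (hc : 0 ≤ c)
    (h : transportCost μ.1 ν.1 ≤ ENNReal.ofReal c) : wDist μ ν ≤ c := by
  rw [wDist_eq]
  exact ENNReal.toReal_le_of_le_ofReal hc h

lemma integrable_dist_of_mem_couplings {μ ν : WassersteinOne d}
    {γ : Measure (Vec d × Vec d)} (hγ : γ ∈ couplings μ.1 ν.1) :
    Integrable (fun z : Vec d × Vec d => ‖z.1 - z.2‖) γ := by
  refine ⟨by fun_prop, ?_⟩
  have := lintegral_edist_lt_top_of_mem_couplings hγ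
  simpa [HasFiniteIntegral, edist_eq_enorm_sub] using this

lemma wDist_le_of_mem_couplings {μ ν : WassersteinOne d}
    {γ : Measure (Vec d × Vec d)} (hγ : γ ∈ couplings μ.1 ν.1) :
    wDist μ ν ≤ ∫ z, ‖z.1 - z.2‖ ∂γ := by
  refine wDist_le_of_transportCost_le (integral_nonneg fun _ => norm_nonneg _) ?_
  refine (transportCost_le hγ).trans_eq ?_
  rw [ofReal_integral_eq_lintegral_ofReal (integrable_dist_of_mem_couplings hγ)
    (ae_of_all _ fun _ => norm_nonneg _)]
  simp [edist_eq_enorm_sub, ofReal_norm]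

lemma exists_mem_couplings_lt {μ ν : WassersteinOne d} {c : ℝ} (h : wDist μ ν < c) :
    ∃ γ ∈ couplings μ.1 ν.1, ∫ z, ‖z.1 - z.2‖ ∂γ < c := by
  have h1 : transportCost μ.1 ν.1 < ENNReal.ofReal c := by
    rw [ENNReal.lt_ofReal_iff_toReal_lt (transportCost_ne_top μ ν)]
    exact h
  obtain ⟨γ, hγ, hlt⟩ := by simpa only [transportCost, iInf_lt_iff] using h1
  refine ⟨γ, hγ, ?_⟩
  rw [integral_eq_lintegral_of_nonneg_ae (ae_of_all _ fun _ => norm_nonneg _) (by fun_prop)]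
  simp only [ofReal_norm, ← edist_eq_enorm_sub]
  exact (ENNReal.lt_ofReal_iff_toReal_lt
    (lintegral_edist_lt_top_of_mem_couplings hγ).ne).1 hlt

/-- The joint law of `X` and `Y` is a coupling. Followers driven by a common noise are compared in
this way. -/
lemma wDist_le_integral {Ω : Type*} [MeasurableSpace Ω] {P : Measure Ω}
    {X Y : Ω → Vec d} {μ ν : WassersteinOne d} (hX : AEMeasurable X P) (hY : AEMeasurable Y P)
    (hμ : P.map X = μ.1) (hν : P.map Y = ν.1) : wDist μ ν ≤ ∫ ω, ‖X ω - Y ω‖ ∂P := by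
  have hγ : P.map (fun ω => (X ω, Y ω)) ∈ couplings μ.1 ν.1 := by
    constructor
    · rw [AEMeasurable.map_map_of_aemeasurable (by fun_prop) (hX.prodMk hY)]; exact hμ
    · rw [AEMeasurable.map_map_of_aemeasurable (by fun_prop) (hX.prodMk hY)]; exact hν
  refine (wDist_le_of_mem_couplings hγ).trans_eq ?_
  rw [integral_map (hX.prodMk hY) (by fun_prop)]

lemma wDist_self (μ : WassersteinOne d) : wDist μ μ = 0 := by
  refine le_antisymm ?_ (wDist_nonneg _ _)
  have := wDist_le_integral (P := μ.1) (X := id) (Y := id) (μ := μ) (ν := μ)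
    aemeasurable_id aemeasurable_id (by simp) (by simp)
  simpa using this

lemma wDist_le_swap (μ ν : WassersteinOne d) : wDist μ ν ≤ wDist ν μ := by
  refine le_of_forall_gt fun c hc => ?_
  obtain ⟨γ, hγ, hlt⟩ := exists_mem_couplings_lt hc
  refine lt_of_le_of_lt (wDist_le_integral (P := γ) (X := Prod.snd) (Y := Prod.fst)
    (by fun_prop) (by fun_prop) hγ.2 hγ.1) ?_
  simpa only [norm_sub_rev] using hlt

lemma wDist_comm (μ ν : WassersteinOne d) : wDist μ ν = wDist ν μ :=
  le_antisymm (wDist_le_swap _ _) (wDist_le_swap _ _)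

/-- The gluing lemma for couplings. -/
lemma exists_gluing {μ ν ρ : WassersteinOne d} {γ η : Measure (Vec d × Vec d)}
    (hγ : γ ∈ couplings μ.1 ν.1) (hη : η ∈ couplings ν.1 ρ.1) :
    ∃ π : Measure (Vec d × Vec d × Vec d), π.map (fun z => (z.2.1, z.1)) = γ ∧
      π.map (fun z => (z.1, z.2.2)) = η := by
  have := isProbabilityMeasure_of_mem_couplings hγ
  have := isProbabilityMeasure_of_mem_couplings hη
  -- Both couplings are disintegrated over the common marginal `ν`; given the middle point, the
  -- outer points are drawn independently. The middle point is the first coordinate of the glued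
  -- measure.
  set γ' := γ.map Prod.swap with hγ'
  have : IsProbabilityMeasure γ' := Measure.isProbabilityMeasure_map (by fun_prop)
  have h1 : ν.1 ⊗ₘ γ'.condKernel = γ' := by
    have h := γ'.disintegrate γ'.condKernel
    have h2 : γ'.fst = ν.1 := by
      rw [Measure.fst, hγ', Measure.map_map measurable_fst measurable_swap]
      exact hγ.2
    rwa [h2] at h
  have h2 : ν.1 ⊗ₘ η.condKernel = η := by
    have h := η.disintegrate η.condKernel
    have h2 : η.fst = ν.1 := hη.1
    rwa [h2] at h
  refine ⟨ν.1 ⊗ₘ (γ'.condKernel ×ₖ η.condKernel), ?_, ?_⟩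
  · have h3 : (ν.1 ⊗ₘ (γ'.condKernel ×ₖ η.condKernel)).map (Prod.map id Prod.fst) = γ' := by
      rw [← Measure.compProd_map measurable_fst, ← Kernel.fst_eq, Kernel.fst_prod, h1]
    have h4 : γ'.map Prod.swap = γ := by
      rw [hγ', Measure.map_map measurable_swap measurable_swap]
      simp
    refine Eq.trans ?_ ((congrArg (Measure.map Prod.swap) h3).trans h4)
    rw [Measure.map_map measurable_swap (by fun_prop)]
    rfl
  · have h3 : (ν.1 ⊗ₘ (γ'.condKernel ×ₖ η.condKernel)).map (Prod.map id Prod.snd) = η := by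
      rw [← Measure.compProd_map measurable_snd, ← Kernel.snd_eq, Kernel.snd_prod, h2]
    exact h3

/-- Near-optimal couplings are glued along `ν`; the existence of optimal couplings is not needed. -/
lemma wDist_triangle (μ ν ρ : WassersteinOne d) : wDist μ ρ ≤ wDist μ ν + wDist ν ρ := by
  refine le_of_forall_pos_le_add fun ε hε => ?_
  obtain ⟨γ, hγ, hγl⟩ := exists_mem_couplings_lt (lt_add_of_pos_right (wDist μ ν) (half_pos hε))
  obtain ⟨η, hη, hηl⟩ := exists_mem_couplings_lt (lt_add_of_pos_right (wDist ν ρ) (half_pos hε))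
  obtain ⟨π, hπγ, hπη⟩ := exists_gluing hγ hη
  have hm1 : Measurable fun z : Vec d × Vec d × Vec d => (z.2.1, z.1) := by fun_prop
  have hm2 : Measurable fun z : Vec d × Vec d × Vec d => (z.1, z.2.2) := by fun_prop
  have i1 : Integrable (fun z : Vec d × Vec d × Vec d => ‖z.2.1 - z.1‖) π := by
    have := integrable_dist_of_mem_couplings hγ
    rw [← hπγ, integrable_map_measure (by fun_prop) hm1.aemeasurable] at this
    exact this
  have i2 : Integrable (fun z : Vec d × Vec d × Vec d => ‖z.1 - z.2.2‖) π := by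
    have := integrable_dist_of_mem_couplings hη
    rw [← hπη, integrable_map_measure (by fun_prop) hm2.aemeasurable] at this
    exact this
  rw [← hπγ, integral_map hm1.aemeasurable (by fun_prop)] at hγl
  rw [← hπη, integral_map hm2.aemeasurable (by fun_prop)] at hηl
  calc wDist μ ρ ≤ ∫ z, ‖z.2.1 - z.2.2‖ ∂π := by
        refine wDist_le_integral (by fun_prop) (by fun_prop) ?_ ?_
        · rw [← hγ.1, ← hπγ, Measure.map_map measurable_fst hm1]; rfl
        · rw [← hη.2, ← hπη, Measure.map_map measurable_snd hm2]; rfl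
    _ ≤ ∫ z, (‖z.2.1 - z.1‖ + ‖z.1 - z.2.2‖) ∂π := by
        refine integral_mono_of_nonneg (ae_of_all _ fun _ => norm_nonneg _) (i1.add i2)
          (ae_of_all _ fun z => ?_)
        exact norm_sub_le_norm_sub_add_norm_sub _ _ _
    _ = (∫ z, ‖z.2.1 - z.1‖ ∂π) + ∫ z, ‖z.1 - z.2.2‖ ∂π := integral_add i1 i2
    _ ≤ wDist μ ν + wDist ν ρ + ε := by linarith

/-- Later arguments use only the topology and the triangle inequality, so a pseudometric suffices
and separation of points is not proved. -/
noncomputable instance : PseudoMetricSpace (WassersteinOne d) where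
  dist := wDist
  dist_self := wDist_self
  dist_comm := wDist_comm
  dist_triangle := wDist_triangle

lemma dist_eq_wDist (μ ν : WassersteinOne d) : dist μ ν = wDist μ ν := rfl

end Wasserstein

end MeanField

namespace MeanField

/-! ### Integrals of Lipschitz functions, empirical measures, mixtures. -/

section Wasserstein

variable {d : ℕ}

/-- The first moment. -/
noncomputable def moment (μ : WassersteinOne d) : ℝ := ∫ x, ‖x‖ ∂μ.1

lemma integrable_of_lipschitzWith {E : Type*} [NormedAddCommGroup E]
    [NormedSpace ℝ E] {f : Vec d → E} {C : ℝ≥0}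
    (hf : LipschitzWith C f) (μ : WassersteinOne d) : Integrable f μ.1 := by
  have h1 : Integrable (fun x : Vec d => ‖f 0‖ + C * ‖x‖) μ.1 :=
    (integrable_const _).add (μ.integrable_id.norm.const_mul _)
  refine h1.mono' hf.continuous.aestronglyMeasurable (ae_of_all _ fun x => ?_)
  have h2 := hf.dist_le_mul x 0
  rw [dist_zero_right, dist_eq_norm] at h2
  have h3 : ‖f x‖ ≤ ‖f x - f 0‖ + ‖f 0‖ := by simpa using norm_add_le (f x - f 0) (f 0)
  linarith

/-- The easy half of Kantorovich duality, for vector-valued functions: `f z.1 - f z.2` is integrated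
against a near-optimal coupling. -/
lemma norm_integral_sub_integral_le {E : Type*} [NormedAddCommGroup E]
    [NormedSpace ℝ E] {f : Vec d → E} {C : ℝ≥0} (hf : LipschitzWith C f)
    (μ ν : WassersteinOne d) : ‖∫ x, f x ∂μ.1 - ∫ x, f x ∂ν.1‖ ≤ C * wDist μ ν := by
  by_cases hE : CompleteSpace E
  swap
  -- In an incomplete space both Bochner integrals are zero by convention.
  · simpa [integral, hE] using mul_nonneg C.2 (wDist_nonneg μ ν)
  have hC : (0 : ℝ) < C + 1 := by positivity
  refine le_of_forall_pos_le_add fun ε hε => ?_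
  obtain ⟨γ, hγ, hlt⟩ := exists_mem_couplings_lt
    (lt_add_of_pos_right (wDist μ ν) (div_pos hε hC))
  have i1 : Integrable (fun z : Vec d × Vec d => f z.1) γ := by
    have := integrable_of_lipschitzWith hf μ
    rw [← hγ.1, integrable_map_measure hf.continuous.aestronglyMeasurable (by fun_prop)] at this
    exact this
  have i2 : Integrable (fun z : Vec d × Vec d => f z.2) γ := by
    have := integrable_of_lipschitzWith hf ν
    rw [← hγ.2, integrable_map_measure hf.continuous.aestronglyMeasurable (by fun_prop)] at this
    exact this
  rw [← hγ.1, ← hγ.2, integral_map (by fun_prop) hf.continuous.aestronglyMeasurable,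
    integral_map (by fun_prop) hf.continuous.aestronglyMeasurable, ← integral_sub i1 i2]
  calc ‖∫ z, (f z.1 - f z.2) ∂γ‖ ≤ ∫ z, C * ‖z.1 - z.2‖ ∂γ := by
        refine norm_integral_le_of_norm_le ((integrable_dist_of_mem_couplings hγ).const_mul _)
          (ae_of_all _ fun z => ?_)
        simpa [dist_eq_norm] using hf.dist_le_mul z.1 z.2
    _ = C * ∫ z, ‖z.1 - z.2‖ ∂γ := integral_const_mul _ _
    _ ≤ C * (wDist μ ν + ε / (C + 1)) := by gcongr
    _ ≤ C * wDist μ ν + ε := by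
        have : (C : ℝ) * (ε / (C + 1)) ≤ ε := by
          rw [mul_div_assoc', div_le_iff₀ hC]
          nlinarith
        linarith

lemma abs_moment_sub_le (μ ν : WassersteinOne d) : |moment μ - moment ν| ≤ wDist μ ν := by
  simpa [moment] using norm_integral_sub_integral_le (f := fun x : Vec d => ‖x‖) lipschitzWith_one_norm μ ν

lemma continuous_moment : Continuous (moment : WassersteinOne d → ℝ) := by
  have h2 : LipschitzWith 1 (moment : WassersteinOne d → ℝ) :=
    LipschitzWith.of_dist_le_mul fun μ ν => by
      simpa [Real.dist_eq, dist_eq_wDist] using abs_moment_sub_le μ ν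
  exact h2.continuous

lemma wDist_le_moment_add (μ ν : WassersteinOne d) : wDist μ ν ≤ moment μ + moment ν := by
  have h := prod_mem_couplings μ ν
  have i1 : Integrable (fun z : Vec d × Vec d => ‖z.1‖) (μ.1.prod ν.1) :=
    μ.integrable_id.norm.comp_fst ν.1
  have i2 : Integrable (fun z : Vec d × Vec d => ‖z.2‖) (μ.1.prod ν.1) :=
    ν.integrable_id.norm.comp_snd μ.1
  refine (wDist_le_of_mem_couplings h).trans ?_
  calc ∫ z, ‖z.1 - z.2‖ ∂(μ.1.prod ν.1) ≤ ∫ z, (‖z.1‖ + ‖z.2‖) ∂(μ.1.prod ν.1) :=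
        integral_mono_of_nonneg (ae_of_all _ fun _ => norm_nonneg _) (i1.add i2)
          (ae_of_all _ fun z => norm_sub_le _ _)
    _ = _ := by
        rw [integral_add i1 i2]
        congr 1
        · simpa [moment] using integral_fun_fst (μ := μ.1) (ν := ν.1) (f := fun x : Vec d => ‖x‖)
        · simpa [moment] using integral_fun_snd (μ := μ.1) (ν := ν.1) (f := fun x : Vec d => ‖x‖)

/-- The uniform probability measure on `Fin N`. -/
noncomputable def uniformFin (N : ℕ) : Measure (Fin N) := (N : ℝ≥0∞)⁻¹ • Measure.count

lemma integral_uniformFin {N : ℕ} (f : Fin N → ℝ) :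
    ∫ n, f n ∂uniformFin N = (N : ℝ)⁻¹ * ∑ n, f n := by
  rw [uniformFin, integral_smul_measure, integral_count]
  simp

section Empirical

variable {N : ℕ} [NeZero N]

lemma empirical_val (x : Fin N → Vec d) :
    (empirical x).1 = (N : ℝ≥0∞)⁻¹ • ∑ n, Measure.dirac (x n) := rfl

lemma integral_empirical {E : Type*} [NormedAddCommGroup E] [NormedSpace ℝ E]
    [CompleteSpace E] (f : Vec d → E) (x : Fin N → Vec d) :
    ∫ y, f y ∂(empirical x).1 = (N : ℝ)⁻¹ • ∑ n, f (x n) := by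
  rw [empirical_val, integral_smul_measure, integral_finsetSum_measure]
  · simp [integral_dirac]
  · intro i _
    exact integrable_dirac (by simp)

/-- An empirical measure is the law of the point at a uniformly chosen index. Two empirical measures
of the same size are therefore coupled by choosing the same index. -/
lemma map_uniformFin (x : Fin N → Vec d) : (uniformFin N).map x = (empirical x).1 := by
  rw [uniformFin, Measure.map_smul, empirical_val, Measure.count, Measure.sum_fintype]
  simp_rw [Measure.map_finset_sum' (measurable_of_finite x).aemeasurable, Measure.map_dirac]

lemma wDist_empirical_le (x y : Fin N → Vec d) :
    wDist (empirical x) (empirical y) ≤ (N : ℝ)⁻¹ * ∑ n, ‖x n - y n‖ := by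
  rw [← integral_uniformFin]
  exact wDist_le_integral (measurable_of_finite x).aemeasurable
    (measurable_of_finite y).aemeasurable (map_uniformFin x) (map_uniformFin y)

lemma inv_mul_sum_le {a : Fin N → ℝ} {c : ℝ} (h : ∀ n, a n ≤ c) : (N : ℝ)⁻¹ * ∑ n, a n ≤ c := by
  have hN : (0 : ℝ) < N := by exact_mod_cast Nat.pos_of_neZero N
  rw [inv_mul_le_iff₀ hN]
  calc ∑ n, a n ≤ ∑ _n : Fin N, c := Finset.sum_le_sum fun n _ => h n
    _ = N * c := by simp

lemma wDist_empirical_le_of_forall {x y : Fin N → Vec d} {c : ℝ} (h : ∀ n, ‖x n - y n‖ ≤ c) :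
    wDist (empirical x) (empirical y) ≤ c :=
  (wDist_empirical_le x y).trans (inv_mul_sum_le h)

lemma lipschitzWith_empirical : LipschitzWith 1 (empirical : (Fin N → Vec d) → WassersteinOne d) := by
  refine LipschitzWith.of_dist_le_mul fun x y => ?_
  rw [NNReal.coe_one, one_mul, dist_eq_wDist]
  exact wDist_empirical_le_of_forall fun n => by
    rw [← dist_eq_norm]; exact dist_le_pi_dist x y n

/-- This identity lets the particle system and the mean-field system share the same drifts. -/
lemma conv_empirical (H : Vec d → Vec d) (x : Fin N → Vec d) (z : Vec d) :
    conv H (empirical x) z = (N : ℝ)⁻¹ • ∑ l, H (z - x l) :=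
  integral_empirical _ x

end Empirical

lemma norm_conv_sub_conv_le {H : Vec d → Vec d} {C : ℝ≥0} (hH : LipschitzWith C H)
    (μ ν : WassersteinOne d) (x y : Vec d) :
    ‖conv H μ x - conv H ν y‖ ≤ C * (wDist μ ν + ‖x - y‖) := by
  have hl : ∀ z : Vec d, LipschitzWith C fun w => H (z - w) := fun z => by
    refine LipschitzWith.of_dist_le_mul fun u v => ?_
    simpa only [dist_sub_left] using hH.dist_le_mul (z - u) (z - v)
  have h1 : ‖conv H μ x - conv H ν x‖ ≤ C * wDist μ ν := norm_integral_sub_integral_le (hl x) μ ν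
  have h2 : ‖conv H ν x - conv H ν y‖ ≤ C * ‖x - y‖ := by
    unfold conv
    rw [← integral_sub (integrable_of_lipschitzWith (hl x) ν)
      (integrable_of_lipschitzWith (hl y) ν)]
    refine (norm_integral_le_of_norm_le_const (C := C * ‖x - y‖) (ae_of_all _ fun w => ?_)).trans ?_
    · simpa [dist_eq_norm] using hH.dist_le_mul (x - w) (y - w)
    · simp
  calc ‖conv H μ x - conv H ν y‖ ≤ ‖conv H μ x - conv H ν x‖ + ‖conv H ν x - conv H ν y‖ :=
        norm_sub_le_norm_sub_add_norm_sub _ _ _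
    _ ≤ _ := by linarith

/-- The convex combination `(1 - s) μ + s ν`. -/
noncomputable def mixture (μ ν : WassersteinOne d) (s : unitInterval) : WassersteinOne d :=
  ⟨(ENNReal.ofReal (1 - s) • μ.1 + ENNReal.ofReal s • ν.1), by
    refine ⟨⟨?_⟩, ?_⟩
    · simp only [Measure.coe_add, Measure.coe_smul, Pi.add_apply, Pi.smul_apply, measure_univ,
        smul_eq_mul, mul_one]
      rw [← ENNReal.ofReal_add (by linarith [s.2.2]) s.2.1]
      simp
    · simp only [lintegral_add_measure, lintegral_smul_measure, smul_eq_mul]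
      exact ENNReal.add_lt_top.2 ⟨ENNReal.mul_lt_top ENNReal.ofReal_lt_top μ.2.moment_lt_top,
        ENNReal.mul_lt_top ENNReal.ofReal_lt_top ν.2.moment_lt_top⟩⟩

lemma mixture_zero (μ ν : WassersteinOne d) : mixture μ ν 0 = μ := by
  apply Subtype.ext; simp [mixture]

lemma mixture_one (μ ν : WassersteinOne d) : mixture μ ν 1 = ν := by
  apply Subtype.ext; simp [mixture]

/-- The mass `(1 - r) μ + s ν` is common to both mixtures and stays on the diagonal; only the
remaining mass `r - s` is moved, by a near-optimal coupling of `μ` and `ν`. Mixtures thus form a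
Lipschitz path in `𝒲₁`, along which the Lagrangian is controlled in small steps. -/
lemma wDist_mixture_le (μ ν : WassersteinOne d) {s r : unitInterval} (hsr : s ≤ r) :
    wDist (mixture μ ν s) (mixture μ ν r) ≤ (r - s) * wDist μ ν := by
  refine le_of_forall_pos_le_add fun ε hε => ?_
  obtain ⟨γ, hγ, hlt⟩ := exists_mem_couplings_lt (lt_add_of_pos_right (wDist μ ν) hε)
  have hsr' : (0 : ℝ) ≤ r - s := sub_nonneg.2 hsr
  have hr1 : (r : ℝ) ≤ 1 := r.2.2
  have hs0 : (0 : ℝ) ≤ s := s.2.1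
  have hdiag : Measurable fun x : Vec d => (x, x) := by fun_prop
  have hη : ENNReal.ofReal (1 - r) • μ.1.map (fun x => (x, x)) +
      ENNReal.ofReal s • ν.1.map (fun x => (x, x)) + ENNReal.ofReal (r - s) • γ ∈
      couplings (mixture μ ν s).1 (mixture μ ν r).1 := by
    constructor
    · rw [Measure.map_add _ _ measurable_fst, Measure.map_add _ _ measurable_fst,
        Measure.map_smul, Measure.map_smul, Measure.map_smul, hγ.1,
        Measure.map_map measurable_fst hdiag, Measure.map_map measurable_fst hdiag]
      have h1 : (1 : ℝ) - s = (1 - r) + (r - s) := by ring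
      simp only [mixture, h1]
      rw [ENNReal.ofReal_add (by linarith) hsr', add_smul]
      simp only [Function.comp_def, Measure.map_id']
      abel
    · rw [Measure.map_add _ _ measurable_snd, Measure.map_add _ _ measurable_snd,
        Measure.map_smul, Measure.map_smul, Measure.map_smul, hγ.2,
        Measure.map_map measurable_snd hdiag, Measure.map_map measurable_snd hdiag]
      have h1 : (r : ℝ) = s + (r - s) := by ring
      simp only [mixture]
      nth_rw 4 [h1]
      rw [ENNReal.ofReal_add hs0 hsr', add_smul]
      simp only [Function.comp_def, Measure.map_id']
      abel
  refine wDist_le_of_transportCost_le (by have := wDist_nonneg μ ν; positivity) ?_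
  refine (transportCost_le hη).trans ?_
  have hmeas : Measurable fun z : Vec d × Vec d => edist z.1 z.2 := by fun_prop
  rw [lintegral_add_measure, lintegral_add_measure, lintegral_smul_measure, lintegral_smul_measure,
    lintegral_smul_measure, lintegral_map hmeas hdiag, lintegral_map hmeas hdiag]
  have hγ' : ∫⁻ z, edist z.1 z.2 ∂γ = ENNReal.ofReal (∫ z, ‖z.1 - z.2‖ ∂γ) := by
    rw [ofReal_integral_eq_lintegral_ofReal (integrable_dist_of_mem_couplings hγ)
      (ae_of_all _ fun _ => norm_nonneg _)]
    simp [edist_eq_enorm_sub, ofReal_norm]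
  simp only [edist_self, lintegral_zero, hγ', smul_eq_mul, mul_zero, zero_add]
  rw [← ENNReal.ofReal_mul hsr']
  refine ENNReal.ofReal_le_ofReal ?_
  have : (r : ℝ) - s ≤ 1 := by linarith
  nlinarith

end Wasserstein

end MeanField

namespace MeanField

/-! ### Linear growth of uniformly continuous Lagrangians. -/

section Growth

/-- Here `f` is a function along a path of length `D`. Cut into `n = ⌊D / δ⌋ + 1` equal pieces, the
path has pieces shorter than `δ`, each of which costs at most `ε`, and `n ≤ D / δ + 1`. -/
lemma abs_sub_le_of_uniform_steps {f : ℝ → ℝ} {ε δ D : ℝ} (hε : 0 < ε) (hδ : 0 < δ) (hD : 0 ≤ D)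
    (h : ∀ s ∈ Icc (0 : ℝ) 1, ∀ r ∈ Icc (0 : ℝ) 1, s ≤ r → (r - s) * D < δ → |f s - f r| < ε) :
    |f 0 - f 1| ≤ ε + ε / δ * D := by
  obtain ⟨n, hn⟩ : ∃ n : ℕ, n = ⌊D / δ⌋₊ + 1 := ⟨_, rfl⟩
  have hn0 : (0 : ℝ) < n := by rw [hn]; positivity
  have hnD : D / n < δ := by
    rw [div_lt_iff₀ hn0, ← div_lt_iff₀' hδ, hn]
    push_cast
    exact Nat.lt_floor_add_one _
  have hk : ∀ k : ℕ, k ≤ n → |f 0 - f (k / n)| ≤ k * ε := by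
    intro k
    induction k with
    | zero => simp
    | succ k ih =>
      intro hkn
      have h1 := ih (by omega)
      have hkn' : ((k : ℝ) + 1) ≤ n := by exact_mod_cast hkn
      have h2 : |f (k / n) - f ((k + 1 : ℕ) / n)| < ε := by
        refine h _ ⟨by positivity, ?_⟩ _ ⟨by positivity, ?_⟩ ?_ ?_
        · rw [div_le_one hn0]; linarith
        · rw [div_le_one hn0]; push_cast; linarith
        · gcongr; simp
        · push_cast
          have : ((k + 1 : ℝ) / n - k / n) * D = D / n := by field_simp; ring
          rwa [this]
      have h3 := abs_sub_le (f 0) (f (k / n)) (f ((k + 1 : ℕ) / n))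
      push_cast at h2 h3 ⊢
      linarith
  have h1 := hk n le_rfl
  rw [div_self hn0.ne'] at h1
  refine h1.trans ?_
  have h2 : (n : ℝ) ≤ D / δ + 1 := by
    rw [hn]; push_cast
    linarith [Nat.floor_le (div_nonneg hD hδ.le)]
  calc (n : ℝ) * ε ≤ (D / δ + 1) * ε := by gcongr
    _ = ε + ε / δ * D := by ring

/-- Any two points are joined by a Lipschitz path: a segment in time and position, a mixture in the
measure. Chaining along it turns the control of small displacements into a bound at all distances,
which can be integrated over unbounded trajectories. -/
lemma Data.LagrangianUniformContinuous.linear_growth {d ℓ m : ℕ} {D : Data d ℓ m}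
    (hLag : D.LagrangianUniformContinuous) {ε : ℝ} (hε : 0 < ε) :
    ∃ C, 0 ≤ C ∧ ∀ t ∈ Icc 0 D.T, ∀ s ∈ Icc 0 D.T, ∀ (y z : Fin m → Vec d)
      (μ ν : WassersteinOne d), |D.lagrangian t y μ - D.lagrangian s z ν| ≤
        ε + C * (|t - s| + dist y z + wDist μ ν) := by
  obtain ⟨δ, hδ, h⟩ := hLag ε hε
  refine ⟨ε / δ, by positivity, fun t ht s hs y z μ ν => ?_⟩
  set E := |t - s| + dist y z + wDist μ ν with hE
  have hE1 : |t - s| ≤ E := by linarith [dist_nonneg (x := y) (y := z), wDist_nonneg μ ν]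
  have hE2 : dist y z ≤ E := by linarith [abs_nonneg (t - s), wDist_nonneg μ ν]
  have hE3 : wDist μ ν ≤ E := by linarith [abs_nonneg (t - s), dist_nonneg (x := y) (y := z)]
  have hE0 : 0 ≤ E := (abs_nonneg _).trans hE1
  let g : ℝ → ℝ := fun r => D.lagrangian (AffineMap.lineMap t s r) (AffineMap.lineMap y z r)
    (mixture μ ν (projIcc 0 1 zero_le_one r))
  have hg := abs_sub_le_of_uniform_steps (f := g) hε hδ hE0 ?_
  · have p0 : projIcc (0 : ℝ) 1 zero_le_one 0 = 0 := projIcc_left _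
    have p1 : projIcc (0 : ℝ) 1 zero_le_one 1 = 1 := projIcc_right _
    simpa only [g, AffineMap.lineMap_apply_zero, AffineMap.lineMap_apply_one, p0, p1,
      mixture_zero, mixture_one] using hg
  · intro a ha b hb hab hlt
    have key : ∀ x, x ≤ E → (b - a) * x < δ := fun x hx =>
      (mul_le_mul_of_nonneg_left hx (sub_nonneg.2 hab)).trans_lt hlt
    have hmem : ∀ r ∈ Icc (0 : ℝ) 1, AffineMap.lineMap t s r ∈ Icc 0 D.T := fun r hr =>
      (convex_Icc 0 D.T).lineMap_mem ht hs hr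
    refine h _ (hmem a ha) _ (hmem b hb) _ _ _ _ ?_ ?_ ?_
    · rw [← Real.dist_eq, dist_lineMap_lineMap, Real.dist_eq, Real.dist_eq, abs_sub_comm a b,
        abs_of_nonneg (sub_nonneg.2 hab)]
      exact key _ hE1
    · rw [dist_lineMap_lineMap, Real.dist_eq, abs_sub_comm a b, abs_of_nonneg (sub_nonneg.2 hab)]
      exact key _ hE2
    · rw [projIcc_of_mem zero_le_one ha, projIcc_of_mem zero_le_one hb]
      exact (wDist_mixture_le μ ν (s := ⟨a, ha⟩) (r := ⟨b, hb⟩) hab).trans_lt (key _ hE3)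

end Growth

/-! ### A law of large numbers in `𝒲₁`. -/

section LawOfLargeNumbers

variable {d : ℕ}

/-- Each point goes to the nearest of finitely many centres whose `ε`-balls cover the ball of radius
`R`. For a point outside this ball, a centre close to its radial projection is at distance at most
`ε` plus the excess `‖x‖ - R`. -/
lemma exists_simpleFunc_approx (R : ℝ) {ε : ℝ} (hε : 0 < ε) :
    ∃ φ : SimpleFunc (Vec d) (Vec d), ∀ x, ‖x - φ x‖ ≤ ε + max (‖x‖ - R) 0 := by
  wlog hR : 0 ≤ R
  · obtain ⟨φ, hφ⟩ := this (d := d) 0 hε le_rfl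
    refine ⟨φ, fun x => (hφ x).trans ?_⟩
    gcongr
    linarith
  have hcomp : IsCompact (Metric.closedBall (0 : Vec d) R) := isCompact_closedBall _ _
  let e := TopologicalSpace.denseSeq (Vec d)
  obtain ⟨t, ht⟩ := hcomp.elim_finite_subcover (fun k => Metric.ball (e k) ε)
    (fun k => Metric.isOpen_ball) (fun x _ => by
      obtain ⟨k, hk⟩ := (TopologicalSpace.denseRange_denseSeq (Vec d)).exists_dist_lt x hε
      exact mem_iUnion.2 ⟨k, hk⟩)
  refine ⟨SimpleFunc.nearestPt e (t.sup id), fun x => ?_⟩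
  have key : ∀ z ∈ Metric.closedBall (0 : Vec d) R,
      ‖x - SimpleFunc.nearestPt e (t.sup id) x‖ ≤ ε + ‖x - z‖ := by
    intro z hz
    obtain ⟨k, hk, hzk⟩ := by simpa using ht hz
    have h1 := SimpleFunc.edist_nearestPt_le e x (k := k) (N := t.sup id)
      (Finset.le_sup (f := id) hk)
    rw [edist_dist, edist_dist, ENNReal.ofReal_le_ofReal_iff dist_nonneg, dist_comm,
      dist_eq_norm] at h1
    refine h1.trans ?_
    have h2 := dist_triangle (e k) z x
    rw [dist_comm z x, dist_eq_norm x z, dist_comm (e k) z] at h2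
    linarith
  rcases le_or_gt ‖x‖ R with hx | hx
  · have := key x (by simpa using hx)
    simp only [sub_self, norm_zero, add_zero] at this
    exact this.trans (by simp)
  · have hx0 : 0 < ‖x‖ := hR.trans_lt hx
    have := key ((R / ‖x‖) • x) (by simp [norm_smul, abs_of_nonneg hR, hx0.ne'])
    have h2 : x - (R / ‖x‖) • x = (1 - R / ‖x‖) • x := by rw [sub_smul, one_smul]
    have h3 : 0 ≤ 1 - R / ‖x‖ := by rw [sub_nonneg, div_le_one hx0]; exact hx.le
    rw [h2, norm_smul, Real.norm_eq_abs, abs_of_nonneg h3, sub_mul, one_mul,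
      div_mul_cancel₀ _ hx0.ne'] at this
    exact this.trans (by gcongr; exact le_max_left _ _)

/-- The common part `m` stays in place. The remainders have equal mass and are coupled by their
normalised product, whose cost is bounded by passing through the origin. -/
lemma transportCost_add_le {μ ν : WassersteinOne d} {m α β : Measure (Vec d)}
    [IsFiniteMeasure m] [IsFiniteMeasure α] [IsFiniteMeasure β]
    (hμ : μ.1 = m + α) (hν : ν.1 = m + β) :
    transportCost μ.1 ν.1 ≤ (∫⁻ x, ‖x‖ₑ ∂α) + ∫⁻ x, ‖x‖ₑ ∂β := by
  have hmass : α univ = β univ := by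
    have h1 : μ.1 univ = ν.1 univ := by simp
    rw [hμ, hν, Measure.add_apply, Measure.add_apply] at h1
    exact (ENNReal.add_right_inj (measure_ne_top m univ)).1 h1
  rcases eq_or_ne (α univ) 0 with h0 | h0
  · have hα : α = 0 := Measure.measure_univ_eq_zero.1 h0
    have hβ : β = 0 := Measure.measure_univ_eq_zero.1 (hmass ▸ h0)
    have h1 : μ = ν := Subtype.ext (by rw [hμ, hν, hα, hβ])
    have h2 := wDist_self μ
    rw [wDist_eq, ENNReal.toReal_eq_zero_iff] at h2
    rw [← h1, h2.resolve_right (transportCost_ne_top μ μ)]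
    exact bot_le
  have hdiag : Measurable fun x : Vec d => (x, x) := by fun_prop
  have hγ : m.map (fun x => (x, x)) + (α univ)⁻¹ • α.prod β ∈ couplings μ.1 ν.1 := by
    constructor
    · rw [Measure.map_add _ _ measurable_fst, Measure.map_smul,
        Measure.map_map measurable_fst hdiag, Measure.map_fst_prod, hμ, ← hmass, smul_smul,
        ENNReal.inv_mul_cancel h0 (measure_ne_top _ _), one_smul]
      simp [Function.comp_def]
    · rw [Measure.map_add _ _ measurable_snd, Measure.map_smul,
        Measure.map_map measurable_snd hdiag, Measure.map_snd_prod, hν, smul_smul,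
        ENNReal.inv_mul_cancel h0 (measure_ne_top _ _), one_smul]
      simp [Function.comp_def]
  refine (transportCost_le hγ).trans ?_
  have hmeas : Measurable fun z : Vec d × Vec d => edist z.1 z.2 := by fun_prop
  rw [lintegral_add_measure, lintegral_smul_measure, lintegral_map hmeas hdiag]
  simp only [edist_self, lintegral_zero, zero_add, smul_eq_mul]
  calc (α univ)⁻¹ * ∫⁻ z, edist z.1 z.2 ∂(α.prod β)
      ≤ (α univ)⁻¹ * ∫⁻ z, (‖z.1‖ₑ + ‖z.2‖ₑ) ∂(α.prod β) := by
        gcongr with z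
        rw [edist_eq_enorm_sub]
        exact enorm_sub_le
    _ = (α univ)⁻¹ * ((β univ) * (∫⁻ x, ‖x‖ₑ ∂α) + (α univ) * ∫⁻ x, ‖x‖ₑ ∂β) := by
        rw [lintegral_add_left (by fun_prop)]
        congr 2
        · rw [← lintegral_map (f := fun x : Vec d => ‖x‖ₑ) (by fun_prop) measurable_fst,
            Measure.map_fst_prod, lintegral_smul_measure, smul_eq_mul]
        · rw [← lintegral_map (f := fun x : Vec d => ‖x‖ₑ) (by fun_prop) measurable_snd,
            Measure.map_snd_prod, lintegral_smul_measure, smul_eq_mul]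
    _ = _ := by
        rw [← hmass, ← mul_add, ← mul_assoc, ENNReal.inv_mul_cancel h0 (measure_ne_top _ _),
          one_mul]

lemma map_simpleFunc_eq_sum {μ : Measure (Vec d)} (φ : SimpleFunc (Vec d) (Vec d)) :
    μ.map φ = ∑ s ∈ φ.range, μ (φ ⁻¹' {s}) • Measure.dirac s := by
  classical
  ext A hA
  rw [Measure.map_apply φ.measurable hA]
  simp only [Measure.coe_finsetSum, Finset.sum_apply, Measure.smul_apply, smul_eq_mul]
  have h1 : φ ⁻¹' A = ⋃ s ∈ φ.range.filter (· ∈ A), φ ⁻¹' {s} := by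
    ext x; simp
  rw [h1, measure_biUnion_finset]
  · rw [Finset.sum_filter]
    refine Finset.sum_congr rfl fun s _ => ?_
    rw [Measure.dirac_apply' _ hA]
    by_cases hs : s ∈ A <;> simp [hs]
  · intro s _ r _ hsr
    exact Disjoint.preimage _ (by simpa using hsr)
  · intro s _
    exact φ.measurableSet_fiber s

/-- A weighted total variation bound: on the finitely many values of `φ`, the minimum of the two
weights is common mass and only the excesses are transported. -/
lemma wDist_map_simpleFunc_le (φ : SimpleFunc (Vec d) (Vec d)) {μ ν : Measure (Vec d)}
    [IsProbabilityMeasure μ] [IsProbabilityMeasure ν] {μ' ν' : WassersteinOne d}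
    (hμ : μ.map φ = μ'.1) (hν : ν.map φ = ν'.1) :
    wDist μ' ν' ≤ ∑ s ∈ φ.range, |μ.real (φ ⁻¹' {s}) - ν.real (φ ⁻¹' {s})| * ‖s‖ := by
  set f : Vec d → ℝ≥0∞ := fun s => μ (φ ⁻¹' {s}) with hf
  set p : Vec d → ℝ≥0∞ := fun s => ν (φ ⁻¹' {s}) with hp
  have hft : ∀ s, f s ≠ ∞ := fun s => measure_ne_top _ _
  have hpt : ∀ s, p s ≠ ∞ := fun s => measure_ne_top _ _
  have hfin : ∀ w : Vec d → ℝ≥0∞, (∀ s, w s ≠ ∞) →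
      IsFiniteMeasure (∑ s ∈ φ.range, w s • Measure.dirac s) := by
    intro w hw
    refine ⟨?_⟩
    simp only [Measure.coe_finsetSum, Finset.sum_apply, Measure.smul_apply, smul_eq_mul]
    exact ENNReal.sum_lt_top.2 fun s _ => by simpa using (hw s).lt_top
  have i1 := hfin (fun s => min (f s) (p s)) fun s => ne_top_of_le_ne_top (hft s) (min_le_left _ _)
  have i2 := hfin (fun s => f s - p s) fun s => ENNReal.sub_ne_top (hft s)
  have i3 := hfin (fun s => p s - f s) fun s => ENNReal.sub_ne_top (hpt s)
  have hμ' : μ'.1 = (∑ s ∈ φ.range, min (f s) (p s) • Measure.dirac s) +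
      ∑ s ∈ φ.range, (f s - p s) • Measure.dirac s := by
    rw [← hμ, map_simpleFunc_eq_sum, ← Finset.sum_add_distrib]
    refine Finset.sum_congr rfl fun s _ => ?_
    rw [← add_smul, add_comm, tsub_add_min]
  have hν' : ν'.1 = (∑ s ∈ φ.range, min (f s) (p s) • Measure.dirac s) +
      ∑ s ∈ φ.range, (p s - f s) • Measure.dirac s := by
    rw [← hν, map_simpleFunc_eq_sum, ← Finset.sum_add_distrib]
    refine Finset.sum_congr rfl fun s _ => ?_
    rw [← add_smul, add_comm, min_comm, tsub_add_min]
  refine wDist_le_of_transportCost_le (Finset.sum_nonneg fun s _ => by positivity) ?_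
  refine (transportCost_add_le hμ' hν').trans_eq ?_
  simp only [lintegral_finsetSum_measure, lintegral_smul_measure, lintegral_dirac, smul_eq_mul]
  rw [← Finset.sum_add_distrib, ENNReal.ofReal_sum_of_nonneg fun s _ => by positivity]
  refine Finset.sum_congr rfl fun s _ => ?_
  rw [← add_mul, ENNReal.ofReal_mul (abs_nonneg _), ofReal_norm]
  congr 1
  have e1 : f s = ENNReal.ofReal (μ.real (φ ⁻¹' {s})) := (ofReal_measureReal).symm
  have e2 : p s = ENNReal.ofReal (ν.real (φ ⁻¹' {s})) := (ofReal_measureReal).symm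
  rw [e1, e2, ← ENNReal.ofReal_sub _ measureReal_nonneg, ← ENNReal.ofReal_sub _ measureReal_nonneg]
  rcases le_total (μ.real (φ ⁻¹' {s})) (ν.real (φ ⁻¹' {s})) with h | h
  · rw [ENNReal.ofReal_of_nonpos (sub_nonpos.2 h), zero_add, abs_sub_comm,
      abs_of_nonneg (sub_nonneg.2 h)]
  · rw [ENNReal.ofReal_of_nonpos (p := ν.real _ - _) (sub_nonpos.2 h), add_zero,
      abs_of_nonneg (sub_nonneg.2 h)]

/-- A weak law in `L¹`: integrate `|x| ≤ η + x² / η` and use that the variance of the sum is at most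
`N`, for which pairwise independence suffices. -/
lemma integral_abs_mean_sub_le {Ω : Type*} [MeasurableSpace Ω] {P : Measure Ω}
    [IsProbabilityMeasure P] {N : ℕ} [NeZero N] {Z : Fin N → Ω → ℝ} {p : ℝ}
    (hZ : ∀ n, Measurable (Z n)) (hZ1 : ∀ n ω, |Z n ω| ≤ 1) (hp : ∀ n, ∫ ω, Z n ω ∂P = p)
    (hi : Pairwise fun i j => IndepFun (Z i) (Z j) P) {η : ℝ} (hη : 0 < η) :
    ∫ ω, |(N : ℝ)⁻¹ * ∑ n, Z n ω - p| ∂P ≤ η + (N * η)⁻¹ := by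
  have hN : (0 : ℝ) < N := by exact_mod_cast Nat.pos_of_neZero N
  have hmem : ∀ n, MemLp (Z n) 2 P := fun n =>
    MemLp.of_bound (hZ n).aestronglyMeasurable 1 (ae_of_all _ fun ω => by simpa using hZ1 n ω)
  have hvar : Var[∑ n, Z n; P] ≤ N := by
    rw [IndepFun.variance_sum (fun n _ => hmem n) (fun i _ j _ hij => hi hij)]
    calc ∑ n, Var[Z n; P] ≤ ∑ _n : Fin N, (1 : ℝ) := by
          refine Finset.sum_le_sum fun n _ => ?_
          refine (variance_le_expectation_sq (hmem n).1).trans ?_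
          refine (integral_mono_of_nonneg (ae_of_all _ fun ω => by simpa using sq_nonneg (Z n ω))
            (integrable_const (1 : ℝ)) (ae_of_all _ fun ω => ?_)).trans (by simp)
          simpa using hZ1 n ω
      _ = N := by simp
  have hmemS : MemLp (∑ n, Z n) 2 P := memLp_finsetSum' _ fun n _ => hmem n
  have hmean : ∫ ω, (∑ n, Z n) ω ∂P = N * p := by
    simp only [Finset.sum_apply]
    rw [integral_finsetSum _ fun n _ => (hmem n).integrable (by norm_num)]
    simp [hp]
  have hsq : Integrable (fun ω => ((∑ n, Z n) ω - N * p) ^ 2) P :=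
    (hmemS.sub (memLp_const _)).integrable_sq
  rw [variance_eq_integral hmemS.1.aemeasurable, hmean] at hvar
  calc ∫ ω, |(N : ℝ)⁻¹ * ∑ n, Z n ω - p| ∂P
      ≤ ∫ ω, (η + (N ^ 2 * η)⁻¹ * ((∑ n, Z n) ω - N * p) ^ 2) ∂P := by
        refine integral_mono_of_nonneg (ae_of_all _ fun _ => abs_nonneg _)
          ((integrable_const _).add (hsq.const_mul _)) (ae_of_all _ fun ω => ?_)
        simp only [Finset.sum_apply]
        set x := (N : ℝ)⁻¹ * ∑ n, Z n ω - p with hx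
        have h1 : ∑ n, Z n ω - N * p = N * x := by rw [hx]; field_simp
        rw [h1]
        have h2 : ((N : ℝ) ^ 2 * η)⁻¹ * (N * x) ^ 2 = |x| ^ 2 / η := by
          rw [sq_abs]; field_simp
        rw [h2, ← sub_le_iff_le_add', le_div_iff₀ hη]
        nlinarith [sq_nonneg (|x| - η)]
    _ = η + (N ^ 2 * η)⁻¹ * ∫ ω, ((∑ n, Z n) ω - N * p) ^ 2 ∂P := by
        rw [integral_add (integrable_const _) (hsq.const_mul _), integral_const_mul]
        simp
    _ ≤ η + (N ^ 2 * η)⁻¹ * N := by gcongr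
    _ = η + (N * η)⁻¹ := by field_simp

lemma measurable_wDist_empirical {Ω : Type*} [MeasurableSpace Ω] {N : ℕ} [NeZero N]
    {ξ : Fin N → Ω → Vec d} (hξ : ∀ n, Measurable (ξ n)) (μ : WassersteinOne d) :
    Measurable fun ω => wDist (empirical fun n => ξ n ω) μ := by
  have h1 : Continuous fun x : Fin N → Vec d => wDist (empirical x) μ :=
    (lipschitzWith_empirical.continuous).dist continuous_const
  exact h1.measurable.comp (measurable_pi_lambda _ hξ)

lemma WassersteinOne.integrable_excess (μ : WassersteinOne d) (R : ℝ) :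
    Integrable (fun x : Vec d => max (‖x‖ - R) 0) μ.1 :=
  (μ.integrable_id.norm.sub (integrable_const R)).sup (integrable_const 0)

/-- A law of large numbers in `𝒲₁` that is uniform in the law. -/
lemma integral_wDist_empirical_le {Ω : Type*} [MeasurableSpace Ω] (P : Measure Ω)
    [IsProbabilityMeasure P] (R : ℝ) {ε : ℝ} (hε : 0 < ε) :
    ∃ N₀ : ℕ, ∀ (N : ℕ) [NeZero N], N₀ ≤ N → ∀ (ξ : Fin N → Ω → Vec d) (μ : WassersteinOne d),
      (∀ n, Measurable (ξ n)) → (∀ n, P.map (ξ n) = μ.1) →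
      (Pairwise fun i j => IndepFun (ξ i) (ξ j) P) →
      ∫ ω, wDist (empirical fun n => ξ n ω) μ ∂P ≤ 3 * ε + 2 * ∫ x, max (‖x‖ - R) 0 ∂μ.1 := by
  -- The objects `φ`, `B`, `η` and `N₀` depend on `R` and `ε` but not on the law, which enters only
  -- through the final tail term.
  obtain ⟨φ, hφ⟩ := exists_simpleFunc_approx (d := d) R hε
  set B : ℝ := ∑ s ∈ φ.range, ‖s‖ with hB
  have hB0 : 0 ≤ B := Finset.sum_nonneg fun _ _ => norm_nonneg _
  -- For `N ≥ 1 / η²` the frequency of each cell has mean error at most `2 * η`, and `2 * η * B ≤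
  -- ε`. The `+ 1` admits `B = 0`.
  set η : ℝ := ε / (2 * (B + 1)) with hη
  have hη0 : 0 < η := by positivity
  obtain ⟨N₀, hN₀⟩ := exists_nat_gt (1 / η ^ 2)
  refine ⟨N₀, fun N _ hN ξ μ hξ hlaw hind => ?_⟩
  have hNpos : (0 : ℝ) < N := by exact_mod_cast Nat.pos_of_neZero N
  have hNη : ((N : ℝ) * η)⁻¹ ≤ η := by
    have h1 : 1 / η ^ 2 ≤ N := hN₀.le.trans (by exact_mod_cast hN)
    rw [div_le_iff₀ (by positivity)] at h1
    rw [inv_le_iff_one_le_mul₀ (by positivity)]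
    nlinarith
  have iμ : Integrable (fun x : Vec d => ε + max (‖x‖ - R) 0) μ.1 :=
    (integrable_const _).add (μ.integrable_excess R)
  have iφμ : Integrable (fun x : Vec d => ‖x - φ x‖) μ.1 :=
    iμ.mono' (by fun_prop) (ae_of_all _ fun x => by simpa using hφ x)
  have hφμ : ∫ x, ‖x - φ x‖ ∂μ.1 ≤ ε + ∫ x, max (‖x‖ - R) 0 ∂μ.1 := by
    refine (integral_mono iφμ iμ hφ).trans_eq ?_
    rw [integral_add (integrable_const _) (μ.integrable_excess R)]
    simp
  have iφ : Integrable φ μ.1 := SimpleFunc.integrable_of_isFiniteMeasure φ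
  set ν := lawOf μ.1 φ iφ with hν
  have hμν : wDist ν μ ≤ ∫ x, ‖x - φ x‖ ∂μ.1 := by
    rw [wDist_comm]
    exact wDist_le_integral (P := μ.1) (X := id) (Y := φ) aemeasurable_id
      φ.measurable.aemeasurable (by simp) rfl
  have hfreq : ∀ ω s, (empirical fun n => ξ n ω).1.real (φ ⁻¹' {s}) =
      (N : ℝ)⁻¹ * ∑ n, (φ ⁻¹' {s}).indicator (fun _ => (1 : ℝ)) (ξ n ω) := by
    intro ω s
    rw [← smul_eq_mul, ← integral_empirical, integral_indicator_const _ (φ.measurableSet_fiber s)]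
    simp
  -- The chain runs from the empirical measure to its quantisation by `φ`, then to the quantised law
  -- `ν`, then to `μ`.
  have hpt : ∀ ω, wDist (empirical fun n => ξ n ω) μ ≤ (N : ℝ)⁻¹ * ∑ n, ‖ξ n ω - φ (ξ n ω)‖ +
      (∑ s ∈ φ.range, |(N : ℝ)⁻¹ * ∑ n, (φ ⁻¹' {s}).indicator (fun _ => (1 : ℝ)) (ξ n ω) -
        μ.1.real (φ ⁻¹' {s})| * ‖s‖) + ∫ x, ‖x - φ x‖ ∂μ.1 := by
    intro ω
    have h1 := wDist_triangle (empirical fun n => ξ n ω) (empirical fun n => φ (ξ n ω)) μ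
    have h2 := wDist_triangle (empirical fun n => φ (ξ n ω)) ν μ
    have h3 := wDist_empirical_le (fun n => ξ n ω) (fun n => φ (ξ n ω))
    have h4 := wDist_map_simpleFunc_le φ (μ := (empirical fun n => ξ n ω).1) (ν := μ.1)
      (μ' := empirical fun n => φ (ξ n ω)) (ν' := ν) (by
        rw [← map_uniformFin, ← map_uniformFin, Measure.map_map φ.measurable
          (measurable_of_finite _)]
        rfl) rfl
    simp only [hfreq] at h4
    linarith
  have i1 : ∀ n, Integrable (fun ω => ‖ξ n ω - φ (ξ n ω)‖) P := by
    intro n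
    have h := iφμ
    rw [← hlaw n, integrable_map_measure (by fun_prop) (hξ n).aemeasurable] at h
    exact h
  have e1 : ∀ n, ∫ ω, ‖ξ n ω - φ (ξ n ω)‖ ∂P = ∫ x, ‖x - φ x‖ ∂μ.1 := by
    intro n
    rw [← hlaw n, integral_map (hξ n).aemeasurable (by fun_prop)]
  have hmind : ∀ s, Measurable ((φ ⁻¹' {s}).indicator fun _ : Vec d => (1 : ℝ)) := fun s =>
    measurable_const.indicator (φ.measurableSet_fiber s)
  have i2 : ∀ s, Integrable (fun ω => |(N : ℝ)⁻¹ * ∑ n,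
      (φ ⁻¹' {s}).indicator (fun _ => (1 : ℝ)) (ξ n ω) - μ.1.real (φ ⁻¹' {s})|) P := by
    intro s
    refine Integrable.abs (Integrable.sub (Integrable.const_mul (integrable_finsetSum _
      fun n _ => ?_) _) (integrable_const _))
    refine Integrable.of_bound ((hmind s).comp (hξ n)).aestronglyMeasurable 1
      (ae_of_all _ fun ω => ?_)
    by_cases h : ξ n ω ∈ φ ⁻¹' {s} <;> simp [indicator, h]
  have e2 : ∀ s, ∫ ω, |(N : ℝ)⁻¹ * ∑ n,
      (φ ⁻¹' {s}).indicator (fun _ => (1 : ℝ)) (ξ n ω) - μ.1.real (φ ⁻¹' {s})| ∂P ≤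
      η + ((N : ℝ) * η)⁻¹ := by
    intro s
    refine integral_abs_mean_sub_le
      (Z := fun n ω => (φ ⁻¹' {s}).indicator (fun _ => (1 : ℝ)) (ξ n ω))
      (fun n => (hmind s).comp (hξ n)) (fun n ω => ?_) (fun n => ?_) (fun i j hij => ?_) hη0
    · by_cases h : ξ n ω ∈ φ ⁻¹' {s} <;> simp [indicator, h]
    · rw [← hlaw n, ← integral_map (f := (φ ⁻¹' {s}).indicator fun _ => (1 : ℝ))
        (hξ n).aemeasurable (hmind s).aestronglyMeasurable,
        integral_indicator_const _ (φ.measurableSet_fiber s)]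
      simp
    · exact (hind hij).comp (hmind s) (hmind s)
  have i1' := (integrable_finsetSum Finset.univ fun n _ => i1 n).const_mul (N : ℝ)⁻¹
  have i2' := integrable_finsetSum φ.range fun s _ => (i2 s).mul_const ‖s‖
  have i12 : Integrable (fun ω => (N : ℝ)⁻¹ * ∑ n, ‖ξ n ω - φ (ξ n ω)‖ +
      (∑ s ∈ φ.range, |(N : ℝ)⁻¹ * ∑ n, (φ ⁻¹' {s}).indicator (fun _ => (1 : ℝ)) (ξ n ω) -
        μ.1.real (φ ⁻¹' {s})| * ‖s‖)) P := i1'.add i2'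
  calc ∫ ω, wDist (empirical fun n => ξ n ω) μ ∂P
      ≤ ∫ ω, ((N : ℝ)⁻¹ * ∑ n, ‖ξ n ω - φ (ξ n ω)‖ +
      (∑ s ∈ φ.range, |(N : ℝ)⁻¹ * ∑ n, (φ ⁻¹' {s}).indicator (fun _ => (1 : ℝ)) (ξ n ω) -
        μ.1.real (φ ⁻¹' {s})| * ‖s‖) + ∫ x, ‖x - φ x‖ ∂μ.1) ∂P :=
        integral_mono_of_nonneg (ae_of_all _ fun _ => wDist_nonneg _ _)
          (i12.add (integrable_const _)) (ae_of_all _ hpt)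
    _ = (N : ℝ)⁻¹ * ∑ n : Fin N, (∫ ω, ‖ξ n ω - φ (ξ n ω)‖ ∂P) +
        (∑ s ∈ φ.range, (∫ ω, |(N : ℝ)⁻¹ * ∑ n,
          (φ ⁻¹' {s}).indicator (fun _ => (1 : ℝ)) (ξ n ω) - μ.1.real (φ ⁻¹' {s})| ∂P) * ‖s‖) +
        ∫ x, ‖x - φ x‖ ∂μ.1 := by
        rw [integral_add i12 (integrable_const _), integral_add i1' i2',
          integral_const_mul, integral_finsetSum _ fun n _ => i1 n,
          integral_finsetSum _ fun s _ => (i2 s).mul_const ‖s‖]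
        simp [integral_mul_const]
    _ ≤ (∫ x, ‖x - φ x‖ ∂μ.1) + (∑ s ∈ φ.range, (2 * η) * ‖s‖) + ∫ x, ‖x - φ x‖ ∂μ.1 := by
        gcongr with s hs
        · exact inv_mul_sum_le fun n => (e1 n).le
        · linarith [e2 s]
    _ ≤ _ := by
        rw [← Finset.mul_sum, ← hB]
        have : 2 * η * B ≤ ε := by
          rw [hη]
          have : 2 * (ε / (2 * (B + 1))) * B = ε * (B / (B + 1)) := by field_simp
          rw [this]
          have h2 : B / (B + 1) ≤ 1 := by rw [div_le_one (by positivity)]; linarith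
          nlinarith
        linarith

end LawOfLargeNumbers

end MeanField

namespace MeanField

/-! ### Grönwall's inequality and Volterra equations. -/

section Volterra

lemma intervalIntegrable_of_continuousOn_Icc {E : Type*} [NormedAddCommGroup E] {f : ℝ → E}
    {T t : ℝ} (hf : ContinuousOn f (Icc 0 T)) (ht : t ∈ Icc 0 T) :
    IntervalIntegrable f volume 0 t :=
  (hf.mono (Icc_subset_Icc_right ht.2)).intervalIntegrable_of_Icc ht.1

/-- The function `exp (-K t) ∫₀ᵗ u - ∫₀ᵗ G` is antitone: its derivative `exp (-K t) (u - K ∫₀ᵗ u) -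
G` is at most `(exp (-K t) - 1) G ≤ 0`. No sign of `u` is needed. -/
lemma integral_le_exp_mul_of_le {T K : ℝ} (hK : 0 ≤ K) {u G : ℝ → ℝ}
    (hu : ContinuousOn u (Icc 0 T)) (hG : ContinuousOn G (Icc 0 T)) (hG0 : ∀ t ∈ Icc 0 T, 0 ≤ G t)
    (h : ∀ t ∈ Icc 0 T, u t ≤ G t + K * ∫ s in (0 : ℝ)..t, u s) :
    ∀ t ∈ Icc 0 T, ∫ s in (0 : ℝ)..t, u s ≤ Real.exp (K * T) * ∫ s in (0 : ℝ)..t, G s := by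
  intro t ht
  have hT : 0 ≤ T := ht.1.trans ht.2
  have hprim : ∀ f : ℝ → ℝ, ContinuousOn f (Icc 0 T) →
      ContinuousOn (fun t => ∫ s in (0 : ℝ)..t, f s) (Icc 0 T) := fun f hf => by
    have := intervalIntegral.continuousOn_primitive_interval (μ := volume) (a := 0) (b := T)
      (f := f) (by rw [uIcc_of_le hT]; exact hf.integrableOn_Icc)
    rwa [uIcc_of_le hT] at this
  have hder : ∀ f : ℝ → ℝ, ContinuousOn f (Icc 0 T) → ∀ x ∈ interior (Icc 0 T),
      HasDerivAt (fun t => ∫ s in (0 : ℝ)..t, f s) (f x) x := fun f hf x hx => by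
    have hx' : Icc 0 T ∈ 𝓝 x := mem_interior_iff_mem_nhds.1 hx
    exact intervalIntegral.integral_hasDerivAt_right
      (intervalIntegrable_of_continuousOn_Icc hf (interior_subset hx))
      (hf.stronglyMeasurableAtFilter_nhdsWithin measurableSet_Icc x |>.filter_mono
        (by rw [nhdsWithin_eq_nhds.2 hx'])) (hf.continuousAt hx')
  let w : ℝ → ℝ := fun t => Real.exp (-(K * t)) * ∫ s in (0 : ℝ)..t, u s
  have hanti : AntitoneOn (fun t => w t - ∫ s in (0 : ℝ)..t, G s) (Icc 0 T) := by
    have hd : ∀ x ∈ interior (Icc 0 T), HasDerivAt (fun t => w t - ∫ s in (0 : ℝ)..t, G s)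
        ((Real.exp (-(K * x)) * (-(K * 1))) * (∫ s in (0 : ℝ)..x, u s) +
          Real.exp (-(K * x)) * u x - G x) x := fun x hx =>
      ((((hasDerivAt_id x).const_mul K).neg.exp).mul (hder u hu x hx)).sub (hder G hG x hx)
    refine antitoneOn_of_deriv_nonpos (convex_Icc 0 T) ?_ ?_ ?_
    · exact ((by fun_prop : Continuous fun t => Real.exp (-(K * t))).continuousOn.mul
        (hprim u hu)).sub (hprim G hG)
    · exact fun x hx => (hd x hx).differentiableAt.differentiableWithinAt
    · intro x hx
      rw [(hd x hx).deriv]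
      have hx' := interior_subset hx
      have h1 := h x hx'
      have h2 : Real.exp (-(K * x)) ≤ 1 := Real.exp_le_one_iff.2 (by nlinarith [hx'.1])
      have h3 := hG0 x hx'
      nlinarith [Real.exp_pos (-(K * x)),
        mul_le_mul_of_nonneg_left h1 (Real.exp_pos (-(K * x))).le]
  have h0 := hanti (left_mem_Icc.2 hT) ht ht.1
  simp only [w, intervalIntegral.integral_same, mul_zero, sub_zero, sub_nonpos] at h0
  have hGt : 0 ≤ ∫ s in (0 : ℝ)..t, G s :=
    intervalIntegral.integral_nonneg ht.1 fun s hs => hG0 s ⟨hs.1, hs.2.trans ht.2⟩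
  calc ∫ s in (0 : ℝ)..t, u s
      = Real.exp (K * t) * (Real.exp (-(K * t)) * ∫ s in (0 : ℝ)..t, u s) := by
        rw [← mul_assoc, ← Real.exp_add]; simp
    _ ≤ Real.exp (K * t) * ∫ s in (0 : ℝ)..t, G s := by gcongr
    _ ≤ Real.exp (K * T) * ∫ s in (0 : ℝ)..t, G s := by
        gcongr
        exact ht.2

/-- Grönwall's inequality in integral form, with a variable inhomogeneity. -/
lemma le_of_le_add_integral {T K : ℝ} (hK : 0 ≤ K) {u G : ℝ → ℝ}
    (hu : ContinuousOn u (Icc 0 T)) (hG : ContinuousOn G (Icc 0 T)) (hG0 : ∀ t ∈ Icc 0 T, 0 ≤ G t)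
    (h : ∀ t ∈ Icc 0 T, u t ≤ G t + K * ∫ s in (0 : ℝ)..t, u s) :
    ∀ t ∈ Icc 0 T, u t ≤ G t + K * Real.exp (K * T) * ∫ s in (0 : ℝ)..t, G s := by
  intro t ht
  refine (h t ht).trans ?_
  rw [mul_assoc]
  gcongr
  exact integral_le_exp_mul_of_le hK hu hG hG0 h t ht

lemma le_of_le_const_add_integral {T K c : ℝ} (hK : 0 ≤ K) (hc : 0 ≤ c) {u : ℝ → ℝ}
    (hu : ContinuousOn u (Icc 0 T))
    (h : ∀ t ∈ Icc 0 T, u t ≤ c + K * ∫ s in (0 : ℝ)..t, u s) :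
    ∀ t ∈ Icc 0 T, u t ≤ (1 + K * Real.exp (K * T) * T) * c := by
  intro t ht
  refine (le_of_le_add_integral hK hu continuousOn_const (fun _ _ => hc) h t ht).trans ?_
  rw [intervalIntegral.integral_const, smul_eq_mul, sub_zero]
  have h1 : t * c ≤ T * c := mul_le_mul_of_nonneg_right ht.2 hc
  have h2 : 0 ≤ K * Real.exp (K * T) := by positivity
  nlinarith [mul_le_mul_of_nonneg_left h1 h2]

variable {V : Type*}

/-- The `n`-th iterate has Lipschitz constant `(K T)ⁿ / n!` in the uniform distance, so some iterate
is a contraction however large `T` is. -/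
lemma exists_fixedPoint_of_volterra [MetricSpace V] [CompleteSpace V] [Nonempty V] {T : ℝ}
    (hT : 0 ≤ T) {K : ℝ} (hK : 0 ≤ K) (Φ : C(Icc 0 T, V) → C(Icc 0 T, V))
    (hΦ : ∀ x y t, dist (Φ x t) (Φ y t) ≤
      K * ∫ s in (0 : ℝ)..t, dist (IccExtend hT x s) (IccExtend hT y s)) :
    ∃ x, Φ x = x := by
  have hiter : ∀ (n : ℕ) (x y : C(Icc 0 T, V)) (t : Icc 0 T),
      dist (Φ^[n] x t) (Φ^[n] y t) ≤ (K * t) ^ n / n.factorial * dist x y := by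
    intro n x y
    induction n with
    | zero => intro t; simpa using ContinuousMap.dist_apply_le_dist t
    | succ n ih =>
      intro t
      rw [Function.iterate_succ_apply', Function.iterate_succ_apply']
      refine (hΦ _ _ t).trans ?_
      have h1 : ∫ s in (0 : ℝ)..t, dist (IccExtend hT (Φ^[n] x) s) (IccExtend hT (Φ^[n] y) s) ≤
          ∫ s in (0 : ℝ)..t, (K ^ n / n.factorial * dist x y) * s ^ n := by
        refine intervalIntegral.integral_mono_on t.2.1 ?_ ?_ fun s hs => ?_
        · exact (((Φ^[n] x).continuous.Icc_extend').dist
            ((Φ^[n] y).continuous.Icc_extend')).intervalIntegrable _ _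
        · exact (by fun_prop : Continuous fun s : ℝ =>
            (K ^ n / n.factorial * dist x y) * s ^ n).intervalIntegrable _ _
        · have hs' : s ∈ Icc 0 T := ⟨hs.1, hs.2.trans t.2.2⟩
          rw [IccExtend_of_mem _ _ hs', IccExtend_of_mem _ _ hs']
          refine (ih ⟨s, hs'⟩).trans_eq ?_
          rw [mul_pow]; ring
      refine (mul_le_mul_of_nonneg_left h1 hK).trans_eq ?_
      rw [intervalIntegral.integral_const_mul, integral_pow, Nat.factorial_succ]
      push_cast
      field_simp
      ring
  obtain ⟨n, hn⟩ : ∃ n : ℕ, (K * T) ^ n / n.factorial < 1 :=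
    ((FloorSemiring.tendsto_pow_div_factorial_atTop (K * T)).eventually_lt_const
      zero_lt_one).exists
  have hn0 : 0 ≤ (K * T) ^ n / n.factorial := by positivity
  have hcontr : ContractingWith ⟨(K * T) ^ n / n.factorial, hn0⟩ Φ^[n] := by
    refine ⟨by exact_mod_cast hn, LipschitzWith.of_dist_le_mul fun x y => ?_⟩
    rw [ContinuousMap.dist_le (by positivity)]
    intro t
    refine (hiter n x y t).trans ?_
    change _ ≤ (K * T) ^ n / n.factorial * dist x y
    have h0 : (0 : ℝ) ≤ t := t.2.1
    have h1 : (t : ℝ) ≤ T := t.2.2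
    gcongr
  have : Nonempty C(Icc 0 T, V) := ⟨ContinuousMap.const _ (Classical.arbitrary V)⟩
  exact ⟨_, hcontr.isFixedPt_fixedPoint_iterate⟩

variable [NormedAddCommGroup V] [NormedSpace ℝ V]

lemma norm_integral_sub_integral_le_of_lipschitz {T K t : ℝ} {b c : ℝ → V} {w : ℝ → ℝ}
    (ht : t ∈ Icc 0 T)
    (hb : IntegrableOn b (Icc 0 T)) (hc : IntegrableOn c (Icc 0 T)) (hw : ContinuousOn w (Icc 0 T))
    (h : ∀ᵐ s ∂(volume.restrict (Icc 0 T)), ‖b s - c s‖ ≤ K * w s) :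
    ‖(∫ s in (0 : ℝ)..t, b s) - ∫ s in (0 : ℝ)..t, c s‖ ≤ K * ∫ s in (0 : ℝ)..t, w s := by
  have hsub : Ioc 0 t ⊆ Icc 0 T := fun s hs => ⟨hs.1.le, hs.2.trans ht.2⟩
  rw [← intervalIntegral.integral_sub, ← intervalIntegral.integral_const_mul]
  · refine intervalIntegral.norm_integral_le_of_norm_le ht.1 ?_
      ((intervalIntegrable_of_continuousOn_Icc hw ht).const_mul K)
    rw [ae_restrict_iff' measurableSet_Icc] at h
    filter_upwards [h] with s hs hst using hs (hsub hst)
  · rw [intervalIntegrable_iff_integrableOn_Ioc_of_le ht.1]; exact hb.mono_set hsub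
  · rw [intervalIntegrable_iff_integrableOn_Ioc_of_le ht.1]; exact hc.mono_set hsub

/-- Integral equations `x = z + ∫ B(s, x(s)) ds` with `B` Lipschitz in `x` have a solution that
depends continuously on `z`. -/
lemma exists_continuous_solution [CompleteSpace V] {T : ℝ} (hT : 0 ≤ T) {K : ℝ} (hK : 0 ≤ K)
    {B : ℝ → V → V}
    (hint : ∀ x : ℝ → V, Continuous x → IntegrableOn (fun s => B s (x s)) (Icc 0 T))
    (hB : ∀ᵐ s ∂(volume.restrict (Icc 0 T)), ∀ x y, ‖B s x - B s y‖ ≤ K * ‖x - y‖) :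
    ∃ S : C(Icc 0 T, V) → C(Icc 0 T, V), Continuous S ∧ ∀ z (t : Icc 0 T),
      S z t = z t + ∫ s in (0 : ℝ)..t, B s (IccExtend hT (S z) s) := by
  have hcont : ∀ x : C(Icc 0 T, V), Continuous (IccExtend hT x) := fun x =>
    x.continuous.Icc_extend'
  have hprim : ∀ x : C(Icc 0 T, V), Continuous fun t : Icc 0 T =>
      ∫ s in (0 : ℝ)..t, B s (IccExtend hT x s) := fun x => by
    have := intervalIntegral.continuousOn_primitive_interval (μ := volume) (a := 0) (b := T)
      (f := fun s => B s (IccExtend hT x s)) (by rw [uIcc_of_le hT]; exact hint _ (hcont x))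
    rw [uIcc_of_le hT, continuousOn_iff_continuous_domRestrict] at this
    exact this
  have key : ∀ (x y : C(Icc 0 T, V)) (t : Icc 0 T),
      ‖(∫ s in (0 : ℝ)..t, B s (IccExtend hT x s)) - ∫ s in (0 : ℝ)..t, B s (IccExtend hT y s)‖ ≤
        K * ∫ s in (0 : ℝ)..t, dist (IccExtend hT x s) (IccExtend hT y s) := fun x y t => by
    refine norm_integral_sub_integral_le_of_lipschitz t.2 (hint _ (hcont x)) (hint _ (hcont y))
      ((hcont x).dist (hcont y)).continuousOn ?_
    filter_upwards [hB] with s hs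
    rw [dist_eq_norm]
    exact hs _ _
  have hex : ∀ z : C(Icc 0 T, V), ∃ x : C(Icc 0 T, V), ∀ t : Icc 0 T,
      x t = z t + ∫ s in (0 : ℝ)..t, B s (IccExtend hT x s) := by
    intro z
    obtain ⟨x, hx⟩ := exists_fixedPoint_of_volterra hT hK
      (fun x => z + ⟨_, hprim x⟩) (fun x y t => by
        rw [dist_eq_norm]
        simpa using key x y t)
    refine ⟨x, fun t => ?_⟩
    nth_rw 1 [← hx]
    rfl
  choose S hS using hex
  refine ⟨S, ?_, hS⟩
  -- Grönwall's inequality makes `S` Lipschitz in the driving path; this continuity later yields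
  -- measurability of solutions in `ω`.
  have hlip : ∀ z z', dist (S z) (S z') ≤ (1 + K * Real.exp (K * T) * T) * dist z z' := by
    intro z z'
    rw [ContinuousMap.dist_le (by positivity)]
    intro t
    have := le_of_le_const_add_integral (T := T) hK (dist_nonneg (x := z) (y := z'))
      (u := fun s => dist (IccExtend hT (S z) s) (IccExtend hT (S z') s))
      ((hcont _).dist (hcont _)).continuousOn (fun s hs => by
        rw [IccExtend_of_mem _ _ hs, IccExtend_of_mem _ _ hs, hS z ⟨s, hs⟩, hS z' ⟨s, hs⟩]
        refine (dist_add_add_le _ _ _ _).trans ?_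
        refine add_le_add (ContinuousMap.dist_apply_le_dist _) ?_
        rw [dist_eq_norm]
        exact key (S z) (S z') ⟨s, hs⟩) t t.2
    simpa using this
  exact (LipschitzWith.of_dist_le_mul (K := ⟨1 + K * Real.exp (K * T) * T, by positivity⟩)
    hlip).continuous

end Volterra

/-! ### Measurability of functionals of random paths. -/

section PathSpace

variable {V : Type*} [NormedAddCommGroup V] [SecondCountableTopology V] [CompleteSpace V]
  [MeasurableSpace V] [BorelSpace V]

/-- Evaluation of a path at a dense sequence of times. -/
noncomputable def evalDense (T : ℝ) [Nonempty (Icc 0 T)] (x : C(Icc 0 T, V)) : ℕ → V :=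
  fun k => x (TopologicalSpace.denseSeq (Icc 0 T) k)

/-- A continuous injection between Polish spaces is a measurable embedding (Lusin–Souslin), and a
continuous path is determined by its values on a dense set. Random paths can thus be handled through
countably many evaluations. -/
lemma measurableEmbedding_evalDense (T : ℝ) [Nonempty (Icc 0 T)] [MeasurableSpace C(Icc 0 T, V)]
    [BorelSpace C(Icc 0 T, V)] :
    MeasurableEmbedding (evalDense (V := V) T) := by
  refine Continuous.measurableEmbedding ?_ ?_
  · exact continuous_pi fun k => by unfold evalDense; fun_prop
  · intro x y hxy
    ext t
    exact congrFun (Continuous.ext_on (TopologicalSpace.denseRange_denseSeq (Icc 0 T))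
      x.continuous y.continuous (by
        rintro _ ⟨k, rfl⟩
        exact congrFun hxy k)) t

/-- A continuous functional of a path is a measurable function of its values at a dense sequence
of times. -/
lemma exists_measurable_evalDense {E : Type*} [TopologicalSpace E] [MeasurableSpace E]
    [BorelSpace E] [Nonempty E] (T : ℝ) [Nonempty (Icc 0 T)] {F : C(Icc 0 T, V) → E}
    (hF : Continuous F) :
    ∃ G : (ℕ → V) → E, Measurable G ∧ ∀ x, G (evalDense T x) = F x := by
  borelize C(Icc 0 T, V)
  obtain ⟨G, hG, hGF⟩ := (measurableEmbedding_evalDense (V := V) T).exists_measurable_extend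
    hF.measurable (fun _ => inferInstance)
  exact ⟨G, hG, fun x => congrFun hGF x⟩

end PathSpace

end MeanField

namespace MeanField

/-! ### Drifts and pathwise stability. -/

variable {d ℓ m : ℕ}

/-- The drift of a follower at `x`, given the law `μ` of the followers and the leaders `y`. -/
noncomputable def Data.driftX (D : Data d ℓ m) (μ : WassersteinOne d) (y : Fin m → Vec d)
    (x : Vec d) : Vec d :=
  conv D.H₁ μ x + (m : ℝ)⁻¹ • ∑ j, D.K₁ (y j - x)

/-- The uncontrolled part of the drift of the `i`-th leader. -/
noncomputable def Data.driftY (D : Data d ℓ m) (μ : WassersteinOne d) (y : Fin m → Vec d)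
    (i : Fin m) : Vec d :=
  conv D.K₂ μ (y i) + (m : ℝ)⁻¹ • ∑ j, D.H₂ (y j - y i)

/-- The regularity of the data, with explicit constants. -/
structure Data.Regular (D : Data d ℓ m) (κ : ℝ≥0) (Cu : ℝ) : Prop where
  T_nonneg : 0 ≤ D.T
  lip_H₁ : LipschitzWith κ D.H₁
  lip_H₂ : LipschitzWith κ D.H₂
  lip_K₁ : LipschitzWith κ D.K₁
  lip_K₂ : LipschitzWith κ D.K₂
  Cu_nonneg : 0 ≤ Cu
  norm_le_of_mem_U : ∀ A ∈ D.U, ∀ v, ‖Matrix.toEuclideanLin A v‖ ≤ Cu * ‖v‖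
  M_nonneg : 0 ≤ D.M
  L_nonneg : 0 ≤ D.L

lemma norm_mean_sub_mean_le {a b : Fin m → Vec d} {c : ℝ} (hc : 0 ≤ c)
    (h : ∀ j, ‖a j - b j‖ ≤ c) : ‖(m : ℝ)⁻¹ • ∑ j, a j - (m : ℝ)⁻¹ • ∑ j, b j‖ ≤ c := by
  rcases Nat.eq_zero_or_pos m with rfl | hm
  · simpa using hc
  have : NeZero m := ⟨hm.ne'⟩
  rw [← smul_sub, ← Finset.sum_sub_distrib, norm_smul, norm_inv, Real.norm_natCast]
  calc (m : ℝ)⁻¹ * ‖∑ j, (a j - b j)‖ ≤ (m : ℝ)⁻¹ * ∑ j, ‖a j - b j‖ := by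
        gcongr; exact norm_sum_le _ _
    _ ≤ c := inv_mul_sum_le h

section Drift

variable {D : Data d ℓ m} {κ : ℝ≥0} {Cu : ℝ}

lemma Data.Regular.norm_driftX_sub_le (hD : D.Regular κ Cu) (μ ν : WassersteinOne d)
    (y z : Fin m → Vec d) (x w : Vec d) :
    ‖D.driftX μ y x - D.driftX ν z w‖ ≤ 2 * κ * (wDist μ ν + ‖y - z‖ + ‖x - w‖) := by
  have h1 := norm_conv_sub_conv_le hD.lip_H₁ μ ν x w
  have h2 : ‖(m : ℝ)⁻¹ • ∑ j, D.K₁ (y j - x) - (m : ℝ)⁻¹ • ∑ j, D.K₁ (z j - w)‖ ≤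
      κ * (‖y - z‖ + ‖x - w‖) := by
    refine norm_mean_sub_mean_le (by positivity) fun j => ?_
    have h3 := hD.lip_K₁.dist_le_mul (y j - x) (z j - w)
    rw [dist_eq_norm, dist_eq_norm] at h3
    refine h3.trans ?_
    gcongr
    calc ‖y j - x - (z j - w)‖ = ‖(y - z) j - (x - w)‖ := by
          rw [Pi.sub_apply]; congr 1; abel
      _ ≤ ‖(y - z) j‖ + ‖x - w‖ := norm_sub_le _ _
      _ ≤ ‖y - z‖ + ‖x - w‖ := by gcongr; exact norm_le_pi_norm _ j
  have h3 := norm_add_le (conv D.H₁ μ x - conv D.H₁ ν w)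
    ((m : ℝ)⁻¹ • ∑ j, D.K₁ (y j - x) - (m : ℝ)⁻¹ • ∑ j, D.K₁ (z j - w))
  rw [sub_add_sub_comm] at h3
  refine h3.trans ?_
  have h4 : 0 ≤ (κ : ℝ) * (wDist μ ν) := mul_nonneg κ.2 (wDist_nonneg _ _)
  have h5 : 0 ≤ (κ : ℝ) * ‖y - z‖ := by positivity
  linarith

lemma Data.Regular.norm_driftY_sub_le (hD : D.Regular κ Cu) (μ ν : WassersteinOne d)
    (y z : Fin m → Vec d) (i : Fin m) :
    ‖D.driftY μ y i - D.driftY ν z i‖ ≤ 3 * κ * (wDist μ ν + ‖y - z‖) := by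
  have h0 : ∀ j, ‖y j - z j‖ ≤ ‖y - z‖ := fun j => norm_le_pi_norm (y - z) j
  have h1 := norm_conv_sub_conv_le hD.lip_K₂ μ ν (y i) (z i)
  have h2 : ‖(m : ℝ)⁻¹ • ∑ j, D.H₂ (y j - y i) - (m : ℝ)⁻¹ • ∑ j, D.H₂ (z j - z i)‖ ≤
      κ * (2 * ‖y - z‖) := by
    refine norm_mean_sub_mean_le (by positivity) fun j => ?_
    have h3 := hD.lip_H₂.dist_le_mul (y j - y i) (z j - z i)
    rw [dist_eq_norm, dist_eq_norm] at h3
    refine h3.trans ?_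
    gcongr
    calc ‖y j - y i - (z j - z i)‖ = ‖(y j - z j) - (y i - z i)‖ := by congr 1; abel
      _ ≤ ‖y j - z j‖ + ‖y i - z i‖ := norm_sub_le _ _
      _ ≤ 2 * ‖y - z‖ := by linarith [h0 i, h0 j]
  have h3 := norm_add_le (conv D.K₂ μ (y i) - conv D.K₂ ν (z i))
    ((m : ℝ)⁻¹ • ∑ j, D.H₂ (y j - y i) - (m : ℝ)⁻¹ • ∑ j, D.H₂ (z j - z i))
  rw [sub_add_sub_comm] at h3
  refine h3.trans ?_
  have h4 : 0 ≤ (κ : ℝ) * (wDist μ ν) := mul_nonneg κ.2 (wDist_nonneg _ _)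
  have h5 : (κ : ℝ) * ‖y i - z i‖ ≤ κ * ‖y - z‖ := by gcongr; exact h0 i
  linarith

lemma Data.Regular.continuous_driftX (hD : D.Regular κ Cu) :
    Continuous fun q : WassersteinOne d × (Fin m → Vec d) × Vec d => D.driftX q.1 q.2.1 q.2.2 := by
  refine LipschitzWith.continuous (K := 2 * κ * 3) (LipschitzWith.of_dist_le_mul fun q r => ?_)
  rw [dist_eq_norm]
  refine (hD.norm_driftX_sub_le _ _ _ _ _ _).trans ?_
  rw [← dist_eq_wDist, ← dist_eq_norm, ← dist_eq_norm]
  have h1 : dist q.1 r.1 ≤ dist q r := le_max_left _ _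
  have h2 : dist q.2.1 r.2.1 ≤ dist q r := (le_max_left _ _).trans (le_max_right _ _)
  have h3 : dist q.2.2 r.2.2 ≤ dist q r := (le_max_right _ _).trans (le_max_right _ _)
  push_cast
  rw [mul_assoc _ 3]
  gcongr
  linarith

lemma Data.Regular.continuous_driftY (hD : D.Regular κ Cu) (i : Fin m) :
    Continuous fun q : WassersteinOne d × (Fin m → Vec d) => D.driftY q.1 q.2 i := by
  refine LipschitzWith.continuous (K := 3 * κ * 2) (LipschitzWith.of_dist_le_mul fun q r => ?_)
  rw [dist_eq_norm]
  refine (hD.norm_driftY_sub_le _ _ _ _ _).trans ?_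
  rw [← dist_eq_wDist, ← dist_eq_norm]
  have h1 : dist q.1 r.1 ≤ dist q r := le_max_left _ _
  have h2 : dist q.2 r.2 ≤ dist q r := le_max_right _ _
  push_cast
  rw [mul_assoc _ 2]
  gcongr
  linarith

variable {a a' : Control d ℓ m}

/-- The exceptional set of times comes only from the condition `h i s ∈ U`, so one null set serves
all measures, in particular the random ones. -/
lemma Data.Regular.ae_norm_u_sub_le (hD : D.Regular κ Cu) (ha : a ∈ D.admissible) (i : Fin m) :
    ∀ᵐ s ∂(volume.restrict (Icc 0 D.T)), ∀ μ ν, ‖a.u i s μ - a.u i s ν‖ ≤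
      Cu * D.L * wDist μ ν := by
  filter_upwards [(ha.1 i).2] with s hs μ ν
  rw [Control.u, Control.u, ← map_sub, mul_assoc]
  exact (hD.norm_le_of_mem_U _ hs _).trans
    (mul_le_mul_of_nonneg_left ((ha.2 i).2 μ ν) hD.Cu_nonneg)

lemma Data.Regular.ae_norm_u_le (hD : D.Regular κ Cu) (ha : a ∈ D.admissible) (i : Fin m) :
    ∀ᵐ s ∂(volume.restrict (Icc 0 D.T)), ∀ μ, ‖a.u i s μ‖ ≤ Cu * D.M := by
  filter_upwards [(ha.1 i).2] with s hs μ
  exact (hD.norm_le_of_mem_U _ hs _).trans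
    (mul_le_mul_of_nonneg_left ((ha.2 i).1 μ) hD.Cu_nonneg)

lemma Data.Regular.continuous_g (hD : D.Regular κ Cu) (ha : a ∈ D.admissible) (i : Fin m) :
    Continuous (a.g i) := by
  refine LipschitzWith.continuous (K := ⟨D.L, hD.L_nonneg⟩)
    (LipschitzWith.of_dist_le_mul fun μ ν => ?_)
  rw [dist_eq_norm, dist_eq_wDist]
  exact (ha.2 i).2 μ ν

lemma continuous_toEuclideanLin_apply :
    Continuous fun q : Matrix (Fin d) (Fin ℓ) ℝ × Vec ℓ => Matrix.toEuclideanLin q.1 q.2 := by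
  simp only [Matrix.toLpLin_apply]
  fun_prop

lemma Data.Regular.integrableOn_u (hD : D.Regular κ Cu) (ha : a ∈ D.admissible) (i : Fin m)
    {μ : ℝ → WassersteinOne d} (hμ : ContinuousOn μ (Icc 0 D.T)) :
    IntegrableOn (fun s => a.u i s (μ s)) (Icc 0 D.T) := by
  refine Integrable.of_bound (C := Cu * D.M) ?_ ?_
  · have h1 : AEStronglyMeasurable (fun s => a.g i (μ s)) (volume.restrict (Icc 0 D.T)) :=
      ((hD.continuous_g ha i).comp_continuousOn hμ).aestronglyMeasurable measurableSet_Icc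
    have h2 := continuous_toEuclideanLin_apply.comp_aestronglyMeasurable ((ha.1 i).1.prodMk h1)
    exact h2
  · filter_upwards [hD.ae_norm_u_le ha i] with s hs using hs _

/-- A continuous flow of measures together with leaders driven by it. -/
structure Data.LeaderFlow (D : Data d ℓ m) (a : Control d ℓ m) (μ : ℝ → WassersteinOne d)
    (Y : Fin m → ℝ → Vec d) : Prop where
  continuous_μ : ContinuousOn μ (Icc 0 D.T)
  continuous_Y : ∀ i, ContinuousOn (Y i) (Icc 0 D.T)
  eq_Y : ∀ i, SolvesIntegralEq D.T (Y i) (D.Y₀ i)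
    (fun s => D.driftY (μ s) (fun j => Y j s) i + a.u i s (μ s)) (fun _ => 0)

lemma Data.LeaderFlow.continuousOn_Y {μ : ℝ → WassersteinOne d} {Y : Fin m → ℝ → Vec d}
    (h : D.LeaderFlow a μ Y) : ContinuousOn (fun s j => Y j s) (Icc 0 D.T) :=
  continuousOn_pi.2 h.continuous_Y

/-- The distance of two flows at a given time. -/
noncomputable def flowDist (μ μ' : ℝ → WassersteinOne d) (Y Y' : Fin m → ℝ → Vec d) (t : ℝ) : ℝ :=
  wDist (μ t) (μ' t) + ‖(fun j => Y j t) - fun j => Y' j t‖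

lemma flowDist_nonneg (μ μ' : ℝ → WassersteinOne d) (Y Y' : Fin m → ℝ → Vec d) (t : ℝ) :
    0 ≤ flowDist μ μ' Y Y' t := add_nonneg (wDist_nonneg _ _) (norm_nonneg _)

lemma wDist_le_flowDist (μ μ' : ℝ → WassersteinOne d) (Y Y' : Fin m → ℝ → Vec d) (t : ℝ) :
    wDist (μ t) (μ' t) ≤ flowDist μ μ' Y Y' t := le_add_of_nonneg_right (norm_nonneg _)

lemma continuousOn_flowDist {μ μ' : ℝ → WassersteinOne d} {Y Y' : Fin m → ℝ → Vec d} {s : Set ℝ}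
    (hμ : ContinuousOn μ s) (hμ' : ContinuousOn μ' s) (hY : ∀ i, ContinuousOn (Y i) s)
    (hY' : ∀ i, ContinuousOn (Y' i) s) : ContinuousOn (flowDist μ μ' Y Y') s :=
  (continuous_dist.comp_continuousOn (hμ.prodMk hμ')).add ((continuousOn_pi.2 hY).sub (continuousOn_pi.2 hY')).norm

lemma integral_mono_upper {T s t : ℝ} {w : ℝ → ℝ} (hw : ContinuousOn w (Icc 0 T))
    (hw0 : ∀ r, 0 ≤ w r) (hs : 0 ≤ s) (hst : s ≤ t) (ht : t ≤ T) :
    ∫ r in (0 : ℝ)..s, w r ≤ ∫ r in (0 : ℝ)..t, w r :=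
  intervalIntegral.integral_mono_interval le_rfl hs hst (ae_of_all _ hw0)
    (intervalIntegrable_of_continuousOn_Icc hw ⟨hs.trans hst, ht⟩)

/-- For each `t` the function `G` is replaced on `[0, t]` by its largest value `G t`. -/
lemma le_of_le_mono_add_integral {T K : ℝ} (hK : 0 ≤ K) {u G : ℝ → ℝ}
    (hu : ContinuousOn u (Icc 0 T)) (hG : MonotoneOn G (Icc 0 T)) (hG0 : ∀ t ∈ Icc 0 T, 0 ≤ G t)
    (h : ∀ t ∈ Icc 0 T, u t ≤ G t + K * ∫ s in (0 : ℝ)..t, u s) :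
    ∀ t ∈ Icc 0 T, u t ≤ (1 + K * Real.exp (K * T) * T) * G t := by
  intro t ht
  have hT : 0 ≤ T := ht.1.trans ht.2
  have hsub : ∀ s ∈ Icc 0 t, s ∈ Icc 0 T := fun s hs => ⟨hs.1, hs.2.trans ht.2⟩
  refine (le_of_le_const_add_integral (T := t) hK (hG0 t ht) (hu.mono hsub) (fun s hs => ?_) t
    ⟨ht.1, le_rfl⟩).trans ?_
  · exact (h s (hsub s hs)).trans (by gcongr; exact hG (hsub s hs) ht hs.2)
  · have := hG0 t ht
    have := ht.1
    have h2 : t ≤ T := ht.2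
    gcongr

/-- The constant in the stability estimate for followers. -/
noncomputable def followerConst (T : ℝ) (κ : ℝ≥0) : ℝ :=
  (1 + 2 * κ * Real.exp (2 * κ * T) * T) * (2 * κ)

lemma followerConst_nonneg {T : ℝ} (hT : 0 ≤ T) (κ : ℝ≥0) : 0 ≤ followerConst T κ := by
  unfold followerConst; positivity

/-- The common noise cancels in the difference. The remaining forcing `∫ flowDist` is monotone in
time, so Grönwall's inequality costs only a constant factor. -/
lemma Data.Regular.norm_follower_sub_le (hD : D.Regular κ Cu) {μ μ' : ℝ → WassersteinOne d}
    {Y Y' : Fin m → ℝ → Vec d} {x x' : ℝ → Vec d} {x₀ : Vec d} {w : ℝ → Vec d}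
    (hμ : ContinuousOn μ (Icc 0 D.T)) (hμ' : ContinuousOn μ' (Icc 0 D.T))
    (hY : ∀ i, ContinuousOn (Y i) (Icc 0 D.T)) (hY' : ∀ i, ContinuousOn (Y' i) (Icc 0 D.T))
    (hxc : ContinuousOn x (Icc 0 D.T)) (hxc' : ContinuousOn x' (Icc 0 D.T))
    (hx : SolvesIntegralEq D.T x x₀ (fun s => D.driftX (μ s) (fun j => Y j s) (x s)) w)
    (hx' : SolvesIntegralEq D.T x' x₀ (fun s => D.driftX (μ' s) (fun j => Y' j s) (x' s)) w) :
    ∀ t ∈ Icc 0 D.T, ‖x t - x' t‖ ≤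
      followerConst D.T κ * ∫ s in (0 : ℝ)..t, flowDist μ μ' Y Y' s := by
  have hρ := continuousOn_flowDist hμ hμ' hY hY'
  have hdiff : ContinuousOn (fun t => ‖x t - x' t‖) (Icc 0 D.T) := (hxc.sub hxc').norm
  have hρ0 := flowDist_nonneg μ μ' Y Y'
  have key := le_of_le_mono_add_integral (T := D.T) (K := 2 * κ) (by positivity)
    (u := fun t => ‖x t - x' t‖) (G := fun t => 2 * κ * ∫ s in (0 : ℝ)..t, flowDist μ μ' Y Y' s)
    hdiff ?_ ?_ ?_
  · intro t ht
    refine (key t ht).trans_eq ?_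
    rw [followerConst, mul_assoc (1 + _)]
  · intro s hs t ht hst
    have := integral_mono_upper hρ hρ0 hs.1 hst ht.2
    simp only
    gcongr
  · intro t ht
    have := intervalIntegral.integral_nonneg (μ := volume) ht.1 fun s _ => hρ0 s
    positivity
  · intro t ht
    have h1 : x t - x' t = (∫ s in (0 : ℝ)..t, D.driftX (μ s) (fun j => Y j s) (x s)) -
        ∫ s in (0 : ℝ)..t, D.driftX (μ' s) (fun j => Y' j s) (x' s) := by
      rw [hx.2 t ht, hx'.2 t ht]; abel
    rw [h1, ← mul_add, ← intervalIntegral.integral_add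
      (intervalIntegrable_of_continuousOn_Icc hρ ht)
      (intervalIntegrable_of_continuousOn_Icc hdiff ht)]
    refine norm_integral_sub_integral_le_of_lipschitz ht hx.1 hx'.1 (hρ.add hdiff)
      (ae_of_all _ fun s => ?_)
    exact hD.norm_driftX_sub_le _ _ _ _ _ _

/-- The growth rate in the stability estimate for flows. -/
noncomputable def flowRate (D : Data d ℓ m) (κ : ℝ≥0) (Cu : ℝ) : ℝ :=
  followerConst D.T κ + (3 * κ + Cu * D.L)

/-- The constant in the stability estimate for flows. -/
noncomputable def flowConst (D : Data d ℓ m) (κ : ℝ≥0) (Cu : ℝ) : ℝ :=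
  1 + flowRate D κ Cu * Real.exp (flowRate D κ Cu * D.T) * (1 + D.T)

lemma Data.Regular.flowRate_nonneg (hD : D.Regular κ Cu) : 0 ≤ flowRate D κ Cu := by
  have := followerConst_nonneg hD.T_nonneg κ
  have := hD.Cu_nonneg
  have := hD.L_nonneg
  unfold flowRate; positivity

lemma Data.Regular.one_le_flowConst (hD : D.Regular κ Cu) : 1 ≤ flowConst D κ Cu := by
  have := hD.flowRate_nonneg
  have := hD.T_nonneg
  have : 0 ≤ flowRate D κ Cu * Real.exp (flowRate D κ Cu * D.T) * (1 + D.T) := by positivity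
  unfold flowConst; linarith

/-- The central estimate. The control terms are compared in two steps: `a` along `μ` with `a` along
`μ'`, where the Lipschitz bound feeds Grönwall's inequality, and then `a` with `a'` along the same
flow `μ'`. The second step involves the norm of an integral, not the integral of a norm, so weak
convergence of the open-loop controls makes `δ` small. The error `r` is left free: it is zero for
two flows of the same kind and a sampling error when a particle system is compared with the
mean-field system. -/
lemma Data.Regular.flowDist_le (hD : D.Regular κ Cu) (ha : a ∈ D.admissible)
    {μ μ' : ℝ → WassersteinOne d} {Y Y' : Fin m → ℝ → Vec d}
    (hf : D.LeaderFlow a μ Y) (hf' : D.LeaderFlow a' μ' Y') {δ : ℝ} (hδ : 0 ≤ δ)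
    (hgap : ∀ i, ∀ t ∈ Icc 0 D.T,
      ‖(∫ s in (0 : ℝ)..t, a.u i s (μ' s)) - ∫ s in (0 : ℝ)..t, a'.u i s (μ' s)‖ ≤ δ)
    {r : ℝ → ℝ} (hr : ContinuousOn r (Icc 0 D.T)) (hr0 : ∀ t, 0 ≤ r t)
    (hW : ∀ t ∈ Icc 0 D.T, wDist (μ t) (μ' t) ≤
      r t + followerConst D.T κ * ∫ s in (0 : ℝ)..t, flowDist μ μ' Y Y' s) :
    ∀ t ∈ Icc 0 D.T, flowDist μ μ' Y Y' t ≤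
      r t + flowConst D κ Cu * (δ + ∫ s in (0 : ℝ)..t, r s) := by
  have hρ := continuousOn_flowDist hf.continuous_μ hf'.continuous_μ hf.continuous_Y
    hf'.continuous_Y
  have hρ0 := flowDist_nonneg μ μ' Y Y'
  have hCL : 0 ≤ Cu * D.L := mul_nonneg hD.Cu_nonneg hD.L_nonneg
  have hlead : ∀ t ∈ Icc 0 D.T, ‖(fun j => Y j t) - fun j => Y' j t‖ ≤
      δ + (3 * κ + Cu * D.L) * ∫ s in (0 : ℝ)..t, flowDist μ μ' Y Y' s := by
    intro t ht
    have hI := intervalIntegral.integral_nonneg (μ := volume) ht.1 fun s _ => hρ0 s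
    rw [pi_norm_le_iff_of_nonneg (by positivity)]
    intro i
    have hsub : Ioc 0 t ⊆ Icc 0 D.T := fun s hs => ⟨hs.1.le, hs.2.trans ht.2⟩
    have hII : ∀ {f : ℝ → Vec d}, IntegrableOn f (Icc 0 D.T) → IntervalIntegrable f volume 0 t :=
      fun hf => by
        rw [intervalIntegrable_iff_integrableOn_Ioc_of_le ht.1]; exact hf.mono_set hsub
    have hdr : ContinuousOn (fun s => D.driftY (μ' s) (fun j => Y' j s) i) (Icc 0 D.T) :=
      (hD.continuous_driftY i).comp_continuousOn (hf'.continuous_μ.prodMk hf'.continuousOn_Y)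
    have hua := hD.integrableOn_u ha i hf'.continuous_μ
    have hc : IntegrableOn (fun s => D.driftY (μ' s) (fun j => Y' j s) i + a.u i s (μ' s))
        (Icc 0 D.T) := hdr.integrableOn_Icc.add hua
    -- Only `a` is assumed admissible; integrability of the control term of `a'` is read off from
    -- its equation.
    have hua' : IntegrableOn (fun s => a'.u i s (μ' s)) (Icc 0 D.T) := by
      have := (hf'.eq_Y i).1.sub hdr.integrableOn_Icc
      refine this.congr (ae_of_all _ fun s => ?_)
      simp
    have e1 : Y i t - Y' i t =
        ((∫ s in (0 : ℝ)..t, (D.driftY (μ s) (fun j => Y j s) i + a.u i s (μ s))) -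
          ∫ s in (0 : ℝ)..t, (D.driftY (μ' s) (fun j => Y' j s) i + a.u i s (μ' s))) +
        ((∫ s in (0 : ℝ)..t, a.u i s (μ' s)) - ∫ s in (0 : ℝ)..t, a'.u i s (μ' s)) := by
      rw [(hf.eq_Y i).2 t ht, (hf'.eq_Y i).2 t ht,
        intervalIntegral.integral_add (hII hdr.integrableOn_Icc) (hII hua),
        intervalIntegral.integral_add (hII hdr.integrableOn_Icc) (hII hua')]
      abel
    rw [Pi.sub_apply, e1]
    refine (norm_add_le _ _).trans ?_
    rw [add_comm δ]
    refine add_le_add ?_ (hgap i t ht)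
    refine norm_integral_sub_integral_le_of_lipschitz ht (hf.eq_Y i).1 hc hρ ?_
    filter_upwards [hD.ae_norm_u_sub_le ha i] with s hs
    rw [add_sub_add_comm, add_mul]
    refine (norm_add_le _ _).trans (add_le_add (hD.norm_driftY_sub_le _ _ _ _ _) ?_)
    exact (hs _ _).trans (mul_le_mul_of_nonneg_left (wDist_le_flowDist μ μ' Y Y' s) hCL)
  have hKr := hD.flowRate_nonneg
  have hT := hD.T_nonneg
  intro t ht
  refine (le_of_le_add_integral (K := flowRate D κ Cu) (G := fun t => r t + δ) hKr hρ
    (hr.add continuousOn_const) (fun t _ => add_nonneg (hr0 t) hδ) (fun t ht => ?_) t ht).trans ?_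
  · have h1 := hW t ht
    have h2 := hlead t ht
    have h3 : flowDist μ μ' Y Y' t =
      wDist (μ t) (μ' t) + ‖(fun j => Y j t) - fun j => Y' j t‖ := rfl
    rw [flowRate, add_mul]
    linarith
  · rw [intervalIntegral.integral_add (intervalIntegrable_of_continuousOn_Icc hr ht)
      intervalIntegrable_const, intervalIntegral.integral_const, smul_eq_mul, sub_zero]
    have hI := intervalIntegral.integral_nonneg (μ := volume) ht.1 fun s _ => hr0 s
    set I := ∫ s in (0 : ℝ)..t, r s
    set E := flowRate D κ Cu * Real.exp (flowRate D κ Cu * D.T) with hE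
    have hE0 : 0 ≤ E := by positivity
    have e : flowConst D κ Cu = 1 + E * (1 + D.T) := rfl
    rw [e]
    have h1 : E * (t * δ) ≤ E * (D.T * δ) := by gcongr; exact ht.2
    have h2 : 0 ≤ E * D.T * I := by positivity
    have h3 : 0 ≤ E * δ := by positivity
    nlinarith

end Drift

end MeanField

namespace MeanField

/-! ### Expectations of time integrals. -/

section Fubini

variable {Ω : Type*} [MeasurableSpace Ω] {P : Measure Ω}

/-- Continuity in time and measurability in `ω` give the joint measurability that Fubini's theorem
requires. -/
lemma integrable_prod_of_continuous [IsFiniteMeasure P] {f : ℝ → Ω → ℝ} {T C : ℝ}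
    (hc : ∀ ω, Continuous fun s => f s ω) (hm : ∀ s, Measurable (f s))
    (hi : ∀ s, Integrable (f s) P) (hb : ∀ s, ∫ ω, ‖f s ω‖ ∂P ≤ C) :
    Integrable (Function.uncurry f) ((volume.restrict (Ioc 0 T)).prod P) := by
  have hmeas : Measurable (Function.uncurry f) :=
    measurable_uncurry_of_continuous_of_measurable hc hm
  refine (integrable_prod_iff hmeas.aestronglyMeasurable).2 ⟨ae_of_all _ hi, ?_⟩
  refine Integrable.of_bound (C := C)
    hmeas.stronglyMeasurable.norm.integral_prod_right.aestronglyMeasurable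
    (ae_of_all _ fun s => ?_)
  rw [Real.norm_of_nonneg (integral_nonneg fun _ => norm_nonneg _)]
  exact hb s

lemma integrable_timeIntegral [IsFiniteMeasure P] {f : ℝ → Ω → ℝ} {T C : ℝ} (hT : 0 ≤ T)
    (hc : ∀ ω, Continuous fun s => f s ω) (hm : ∀ s, Measurable (f s))
    (hi : ∀ s, Integrable (f s) P) (hb : ∀ s, ∫ ω, ‖f s ω‖ ∂P ≤ C) :
    Integrable (fun ω => ∫ s in (0 : ℝ)..T, f s ω) P := by
  simp only [intervalIntegral.integral_of_le hT]
  exact (integrable_prod_of_continuous hc hm hi hb).integral_prod_right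

lemma integral_timeIntegral [IsFiniteMeasure P] {f : ℝ → Ω → ℝ} {T C : ℝ} (hT : 0 ≤ T)
    (hc : ∀ ω, Continuous fun s => f s ω) (hm : ∀ s, Measurable (f s))
    (hi : ∀ s, Integrable (f s) P) (hb : ∀ s, ∫ ω, ‖f s ω‖ ∂P ≤ C) :
    ∫ ω, (∫ s in (0 : ℝ)..T, f s ω) ∂P ≤ T * C := by
  simp only [intervalIntegral.integral_of_le hT]
  rw [← integral_integral_swap (integrable_prod_of_continuous hc hm hi hb)]
  refine (Real.le_norm_self _).trans ?_
  refine (norm_integral_le_of_norm_le_const (C := C) (ae_of_all _ fun s => ?_)).trans_eq ?_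
  · exact (norm_integral_le_integral_norm _).trans (hb s)
  · simp [Measure.real, hT, mul_comm]

end Fubini

/-! ### The driving noise. -/

section Noise

variable {Ω : Type*} [MeasurableSpace Ω] {d : ℕ}

/-- A random continuous path in `ℝᵈ` that is integrable and continuous in mean. -/
structure IsNoise (T : ℝ) (P : Measure Ω) (z : Ω → C(Icc 0 T, Vec d)) : Prop where
  measurable : ∀ t, Measurable fun ω => z ω t
  integrable : ∀ t, Integrable (fun ω => z ω t) P
  tendsto : ∀ t, Tendsto (fun s => ∫ ω, ‖z ω s - z ω t‖ ∂P) (𝓝 t) (𝓝 0)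

lemma IsBrownianVec.ae_continuous {P : Measure Ω} {W : ℝ≥0 → Ω → Vec d}
    (hW : IsBrownianVec W P) : ∀ᵐ ω ∂P, Continuous fun t => W t ω := by
  filter_upwards [ae_all_iff.2 fun i => (hW.brownian i).cont] with ω hω
  exact (PiLp.continuous_toLp 2 _).comp (continuous_pi hω)

/-- Brownian paths are continuous only almost surely, whereas the pathwise solution map acts on a
continuous path for every `ω`. On a null set the path is replaced by zero. -/
lemma exists_continuous_modification {P : Measure Ω} {W : ℝ≥0 → Ω → Vec d}
    (hW : IsBrownianVec W P) {X₀ : Ω → Vec d} (hX₀ : Measurable X₀) (T c : ℝ) :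
    ∃ z : Ω → C(Icc 0 T, Vec d), (∀ t, Measurable fun ω => z ω t) ∧
      ∀ᵐ ω ∂P, ∀ t : Icc 0 T, z ω t = X₀ ω + c • W (t : ℝ).toNNReal ω := by
  classical
  -- The set of discontinuous paths need not be measurable; its measurable hull is still null.
  set A : Set Ω := (toMeasurable P {ω | ¬ Continuous fun t => W t ω})ᶜ with hA
  have hAm : MeasurableSet A := (measurableSet_toMeasurable _ _).compl
  have hAc : ∀ ω ∈ A, Continuous fun t => W t ω := fun ω hω => by
    by_contra h
    exact hω (subset_toMeasurable P _ h)
  have hAae : ∀ᵐ ω ∂P, ω ∈ A := by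
    rw [hA, ae_iff]
    simp only [mem_compl_iff, not_not, ofPred_mem_eq]
    rw [measure_toMeasurable]
    exact hW.ae_continuous
  refine ⟨fun ω => if h : ω ∈ A then ⟨fun t => X₀ ω + c • W (t : ℝ).toNNReal ω, by
    have := hAc ω h
    exact continuous_const.add ((this.comp
      (continuous_real_toNNReal.comp continuous_subtype_val)).const_smul c)⟩ else 0, ?_, ?_⟩
  · intro t
    have : (fun ω => (if h : ω ∈ A then (⟨fun t => X₀ ω + c • W (t : ℝ).toNNReal ω, by
        have := hAc ω h
        exact continuous_const.add ((this.comp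
          (continuous_real_toNNReal.comp continuous_subtype_val)).const_smul c)⟩ :
          C(Icc 0 T, Vec d)) else 0) t) =
        fun ω => if ω ∈ A then X₀ ω + c • W (t : ℝ).toNNReal ω else 0 := by
      funext ω
      split_ifs <;> rfl
    rw [this]
    exact Measurable.ite hAm (hX₀.add ((hW.measurable _).const_smul c)) measurable_const
  · filter_upwards [hAae] with ω hω t
    simp [hω]

/-- Integrate `|x| ≤ √v + x² / √v`; the sharp constant plays no role. -/
lemma integral_abs_gaussianReal_le (v : ℝ≥0) : ∫ x, |x| ∂(gaussianReal 0 v) ≤ 2 * √v := by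
  rcases eq_or_ne v 0 with rfl | hv
  · simp
  have hs : 0 < √(v : ℝ) := Real.sqrt_pos.2 (by positivity)
  have hsq : √(v : ℝ) * √v = v := Real.mul_self_sqrt v.2
  have h2 : Integrable (fun x : ℝ => x ^ 2) (gaussianReal 0 v) :=
    (memLp_id_gaussianReal 2).integrable_sq
  have hvar : ∫ x, x ^ 2 ∂(gaussianReal 0 v) = v := by
    have h3 := variance_id_gaussianReal (μ := 0) (v := v)
    rw [variance_eq_integral aemeasurable_id] at h3
    simpa using h3
  calc ∫ x, |x| ∂(gaussianReal 0 v) ≤ ∫ x, (√v + (√v)⁻¹ * x ^ 2) ∂(gaussianReal 0 v) := by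
        refine integral_mono_of_nonneg (ae_of_all _ fun _ => abs_nonneg _)
          ((integrable_const _).add (h2.const_mul _)) (ae_of_all _ fun x => ?_)
        simp only
        rw [← sub_le_iff_le_add', ← div_eq_inv_mul, le_div_iff₀ hs]
        nlinarith [sq_nonneg (|x| - √v), sq_abs x]
    _ = √v + (√v)⁻¹ * v := by
        rw [integral_add (integrable_const _) (h2.const_mul _), integral_const_mul, hvar]
        simp
    _ = 2 * √v := by
        have : (√(v : ℝ))⁻¹ * v = √v := by
          rw [inv_mul_eq_iff_eq_mul₀ hs.ne', hsq]
        rw [this]; ring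

lemma norm_le_sum_abs (x : Vec d) : ‖x‖ ≤ ∑ i, |x i| := by
  have h : x = ∑ i, EuclideanSpace.single i (x i) := by
    ext j
    simp
  calc ‖x‖ = ‖∑ i, EuclideanSpace.single i (x i)‖ := by rw [← h]
    _ ≤ ∑ i, ‖EuclideanSpace.single i (x i)‖ := norm_sum_le _ _
    _ = _ := by simp

lemma IsBrownianVec.integrable {P : Measure Ω} {W : ℝ≥0 → Ω → Vec d}
    (hW : IsBrownianVec W P) (t : ℝ≥0) : Integrable (W t) P := by
  have h : Integrable (fun ω => ∑ i, |W t ω i|) P :=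
    integrable_finsetSum _ fun i _ => ((hW.brownian i).integrable_eval t).abs
  exact h.mono' (hW.measurable t).aestronglyMeasurable (ae_of_all _ fun ω => norm_le_sum_abs _)

lemma IsBrownianVec.integral_norm_sub_le {P : Measure Ω} {W : ℝ≥0 → Ω → Vec d}
    (hW : IsBrownianVec W P) (s t : ℝ≥0) :
    ∫ ω, ‖W s ω - W t ω‖ ∂P ≤ d * (2 * √(nndist (s : ℝ) (t : ℝ))) := by
  have hi : ∀ i, Integrable (fun ω => |W s ω i - W t ω i|) P := fun i =>
    (((hW.brownian i).integrable_eval s).sub ((hW.brownian i).integrable_eval t)).abs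
  calc ∫ ω, ‖W s ω - W t ω‖ ∂P ≤ ∫ ω, ∑ i, |W s ω i - W t ω i| ∂P := by
        refine integral_mono_of_nonneg (ae_of_all _ fun _ => norm_nonneg _)
          (integrable_finsetSum _ fun i _ => hi i) (ae_of_all _ fun ω => ?_)
        simpa using norm_le_sum_abs (W s ω - W t ω)
    _ = ∑ i, ∫ ω, |W s ω i - W t ω i| ∂P := integral_finsetSum _ fun i _ => hi i
    _ ≤ ∑ _i : Fin d, 2 * √(nndist (s : ℝ) (t : ℝ)) := by
        refine Finset.sum_le_sum fun i _ => ?_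
        refine le_trans (le_of_eq ?_) (integral_abs_gaussianReal_le _)
        have h : HasLaw _ (gaussianReal 0 (nndist (s : ℝ) (t : ℝ))) P :=
          (hW.brownian i).hasLaw_sub s t
        rw [← h.map_eq, integral_map h.aemeasurable (by fun_prop)]
        rfl
    _ = _ := by simp

/-- The initial value cancels in increments, and the mean norm of a Brownian increment is of order
`√|s - t|`. -/
lemma isNoise_of_ae_eq {P : Measure Ω} [IsProbabilityMeasure P] {W : ℝ≥0 → Ω → Vec d}
    (hW : IsBrownianVec W P) {X₀ : Ω → Vec d} (hX₀ : Integrable X₀ P) {T c : ℝ}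
    {z : Ω → C(Icc 0 T, Vec d)} (hzm : ∀ t, Measurable fun ω => z ω t)
    (hz : ∀ᵐ ω ∂P, ∀ t : Icc 0 T, z ω t = X₀ ω + c • W (t : ℝ).toNNReal ω) :
    IsNoise T P z := by
  refine ⟨hzm, fun t => ?_, fun t => ?_⟩
  · refine (hX₀.add ((hW.integrable (t : ℝ).toNNReal).smul c)).congr ?_
    filter_upwards [hz] with ω hω
    rw [hω t]; rfl
  · let v : Icc 0 T → ℝ≥0 := fun s =>
      nndist ((s : ℝ).toNNReal : ℝ) ((t : ℝ).toNNReal : ℝ)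
    have hv : Continuous fun s => |c| * (d * (2 * √(v s : ℝ))) := by
      have : Continuous v := by
        have h1 : Continuous fun s : Icc 0 T => (s : ℝ).toNNReal :=
          continuous_real_toNNReal.comp continuous_subtype_val
        exact (NNReal.continuous_coe.comp h1).nndist continuous_const
      fun_prop
    have hv0 : |c| * (d * (2 * √(v t : ℝ))) = 0 := by simp [v]
    refine squeeze_zero (fun s => integral_nonneg fun _ => norm_nonneg _) (fun s => ?_)
      (hv0 ▸ hv.tendsto t)
    have h1 : ∫ ω, ‖z ω s - z ω t‖ ∂P =
        ∫ ω, |c| * ‖W (s : ℝ).toNNReal ω - W (t : ℝ).toNNReal ω‖ ∂P := by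
      refine integral_congr_ae ?_
      filter_upwards [hz] with ω hω
      rw [hω s, hω t, add_sub_add_left_eq_sub, ← smul_sub, norm_smul, Real.norm_eq_abs]
    rw [h1, integral_const_mul]
    exact mul_le_mul_of_nonneg_left (hW.integral_norm_sub_le _ _) (abs_nonneg c)

end Noise

end MeanField

namespace MeanField

variable {d ℓ m : ℕ}

/-! ### The particle system. -/

section Particles

variable {D : Data d ℓ m} {κ : ℝ≥0} {Cu : ℝ} {a : Control d ℓ m} {N : ℕ} [NeZero N]

/-- The right-hand side of the system of `N` followers and `m` leaders. -/
noncomputable def Data.particleDrift (D : Data d ℓ m) (a : Control d ℓ m) (s : ℝ)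
    (v : (Fin N → Vec d) × (Fin m → Vec d)) : (Fin N → Vec d) × (Fin m → Vec d) :=
  (fun n => D.driftX (empirical v.1) v.2 (v.1 n),
    fun i => D.driftY (empirical v.1) v.2 i + a.u i s (empirical v.1))

lemma Data.Regular.integrableOn_particleDrift (hD : D.Regular κ Cu) (ha : a ∈ D.admissible)
    {x : ℝ → (Fin N → Vec d) × (Fin m → Vec d)} (hx : ContinuousOn x (Icc 0 D.T)) :
    IntegrableOn (fun s => D.particleDrift a s (x s)) (Icc 0 D.T) := by
  have hx1 : ContinuousOn (fun s => (x s).1) (Icc 0 D.T) := continuous_fst.comp_continuousOn hx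
  have hx2 : ContinuousOn (fun s => (x s).2) (Icc 0 D.T) := continuous_snd.comp_continuousOn hx
  have he : ContinuousOn (fun s => empirical (x s).1) (Icc 0 D.T) :=
    lipschitzWith_empirical.continuous.comp_continuousOn hx1
  refine Integrable.prodMk (Integrable.of_eval fun n => ?_) (Integrable.of_eval fun i => ?_)
  · exact (hD.continuous_driftX.comp_continuousOn
      (he.prodMk (hx2.prodMk ((continuous_apply n).comp_continuousOn hx1)))).integrableOn_Icc
  · exact ((hD.continuous_driftY i).comp_continuousOn (he.prodMk hx2)).integrableOn_Icc.add
      (hD.integrableOn_u ha i he)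

lemma Data.Regular.ae_norm_particleDrift_sub_le (hD : D.Regular κ Cu) (ha : a ∈ D.admissible) :
    ∀ᵐ s ∂(volume.restrict (Icc 0 D.T)), ∀ v w : (Fin N → Vec d) × (Fin m → Vec d),
      ‖D.particleDrift a s v - D.particleDrift a s w‖ ≤ (6 * κ + Cu * D.L) * ‖v - w‖ := by
  have hCL : 0 ≤ Cu * D.L := mul_nonneg hD.Cu_nonneg hD.L_nonneg
  filter_upwards [ae_all_iff.2 fun i => hD.ae_norm_u_sub_le ha i] with s hs v w
  have h1 : ‖v.1 - w.1‖ ≤ ‖v - w‖ := norm_fst_le (v - w)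
  have h2 : ‖v.2 - w.2‖ ≤ ‖v - w‖ := norm_snd_le (v - w)
  have h3 : wDist (empirical v.1) (empirical w.1) ≤ ‖v - w‖ :=
    (wDist_empirical_le_of_forall fun n => norm_le_pi_norm (v.1 - w.1) n).trans h1
  have hCLv : 0 ≤ Cu * D.L * ‖v - w‖ := by positivity
  refine max_le ?_ ?_
  · rw [pi_norm_le_iff_of_nonneg (by positivity)]
    intro n
    refine (hD.norm_driftX_sub_le _ _ _ _ _ _).trans ?_
    have h4 : ‖v.1 n - w.1 n‖ ≤ ‖v - w‖ := (norm_le_pi_norm (v.1 - w.1) n).trans h1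
    calc 2 * κ * (wDist (empirical v.1) (empirical w.1) + ‖v.2 - w.2‖ + ‖v.1 n - w.1 n‖)
        ≤ 2 * κ * (‖v - w‖ + ‖v - w‖ + ‖v - w‖) := by gcongr
      _ ≤ _ := by linarith
  · rw [pi_norm_le_iff_of_nonneg (by positivity)]
    intro i
    simp only [particleDrift, Prod.snd_sub, Pi.sub_apply]
    rw [add_sub_add_comm]
    refine (norm_add_le _ _).trans ?_
    refine (add_le_add (hD.norm_driftY_sub_le _ _ _ _ _) (hs i _ _)).trans ?_
    calc 3 * κ * (wDist (empirical v.1) (empirical w.1) + ‖v.2 - w.2‖) +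
          Cu * D.L * wDist (empirical v.1) (empirical w.1)
        ≤ 3 * κ * (‖v - w‖ + ‖v - w‖) + Cu * D.L * ‖v - w‖ := by gcongr
      _ = _ := by ring

/-- The paths of the followers solve their equations, given the flow `μ` and the leaders `Y`. -/
def Data.FollowerPath (D : Data d ℓ m) (μ : ℝ → WassersteinOne d) (Y : Fin m → ℝ → Vec d)
    (x : ℝ → Vec d) (x₀ : Vec d) (w : ℝ → Vec d) : Prop :=
  ContinuousOn x (Icc 0 D.T) ∧
    SolvesIntegralEq D.T x x₀ (fun s => D.driftX (μ s) (fun j => Y j s) (x s)) w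

variable {Ω : Type*} [MeasurableSpace Ω] {P : Measure Ω}

/-- This separates analysis from probability: almost every trajectory is a deterministic flow whose
measure component is the empirical measure. -/
lemma Data.IsDiscreteSolution.ae_paths {X₀ : Fin N → Ω → Vec d} {W : Fin N → ℝ≥0 → Ω → Vec d}
    {X : Fin N → ℝ → Ω → Vec d} {Y : Fin m → ℝ → Ω → Vec d}
    (h : D.IsDiscreteSolution P X₀ W a X Y) :
    ∀ᵐ ω ∂P, D.LeaderFlow a (fun t => empirical fun n => X n t ω) (fun i t => Y i t ω) ∧
      ∀ n, D.FollowerPath (fun t => empirical fun n => X n t ω) (fun i t => Y i t ω)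
        (fun t => X n t ω) (X₀ n ω) (fun t => √(2 * D.σ) • W n t.toNNReal ω) := by
  filter_upwards [ae_all_iff.2 h.eq_X, ae_all_iff.2 h.eq_Y] with ω hX hY
  refine ⟨⟨?_, fun i => h.continuous_Y i ω, fun i => ?_⟩, fun n => ⟨h.continuous_X n ω, ?_⟩⟩
  · exact lipschitzWith_empirical.continuous.comp_continuousOn
      (continuousOn_pi.2 fun n => h.continuous_X n ω)
  · simpa only [driftY, conv_empirical] using hY i
  · simpa only [driftX, conv_empirical] using hX n

/-- Only the sum `x₀ + w` matters, so the initial value may be counted as part of the noise. -/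
lemma SolvesIntegralEq.congr_offset {T : ℝ} {x : ℝ → Vec d} {x₀ x₀' : Vec d} {b w w' : ℝ → Vec d}
    (h : SolvesIntegralEq T x x₀ b w) (hw : ∀ t ∈ Icc 0 T, x₀ + w t = x₀' + w' t) :
    SolvesIntegralEq T x x₀' b w' := by
  refine ⟨h.1, fun t ht => ?_⟩
  rw [h.2 t ht, add_right_comm, hw t ht, add_right_comm]

/-- With additive noise the system is an integral equation for each `ω`, solved by a continuous map
`S` of the driving path; continuity of `S` gives measurability in `ω`. -/
lemma Data.Regular.exists_discreteSolution (hD : D.Regular κ Cu) (ha : a ∈ D.admissible)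
    {X₀ : Fin N → Ω → Vec d} {W : Fin N → ℝ≥0 → Ω → Vec d} (hX₀ : ∀ n, Measurable (X₀ n))
    (hW : ∀ n, IsBrownianVec (W n) P) : ∃ X Y, D.IsDiscreteSolution P X₀ W a X Y := by
  have hT := hD.T_nonneg
  have : Nonempty (Icc 0 D.T) := ⟨⟨0, left_mem_Icc.2 hT⟩⟩
  choose z hzm hz using fun n => exists_continuous_modification (hW n) (hX₀ n) D.T √(2 * D.σ)
  have hCL : 0 ≤ Cu * D.L := mul_nonneg hD.Cu_nonneg hD.L_nonneg
  obtain ⟨S, hSc, hS⟩ := exists_continuous_solution (V := (Fin N → Vec d) × (Fin m → Vec d))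
    hT (K := 6 * κ + Cu * D.L) (by positivity)
    (fun x hx => hD.integrableOn_particleDrift ha hx.continuousOn)
    (hD.ae_norm_particleDrift_sub_le ha)
  let Z : Ω → C(Icc 0 D.T, (Fin N → Vec d) × (Fin m → Vec d)) := fun ω =>
    ⟨fun t => (fun n => z n ω t, D.Y₀), by fun_prop⟩
  have hZm : Measurable fun ω => evalDense D.T (Z ω) :=
    measurable_pi_lambda _ fun k => (measurable_pi_lambda _ fun n => hzm n _).prodMk
      measurable_const
  have hSm : ∀ t, Measurable fun ω => S (Z ω) t := fun t => by
    obtain ⟨G, hG, hGS⟩ := exists_measurable_evalDense D.T (F := fun c => S c t)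
      (by fun_prop)
    have : (fun ω => S (Z ω) t) = G ∘ fun ω => evalDense D.T (Z ω) := by
      funext ω; exact (hGS _).symm
    rw [this]
    exact hG.comp hZm
  let R : Ω → ℝ → (Fin N → Vec d) × (Fin m → Vec d) := fun ω => IccExtend hT (S (Z ω))
  have hRc : ∀ ω, Continuous (R ω) := fun ω => (S (Z ω)).continuous.Icc_extend'
  have hRe : ∀ ω, Continuous fun s => empirical (R ω s).1 := fun ω =>
    lipschitzWith_empirical.continuous.comp (continuous_fst.comp (hRc ω))
  have hint : ∀ ω, IntegrableOn (fun s => D.particleDrift a s (R ω s)) (Icc 0 D.T) := fun ω =>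
    hD.integrableOn_particleDrift ha (hRc ω).continuousOn
  have hii : ∀ ω, ∀ t ∈ Icc 0 D.T,
      IntervalIntegrable (fun s => D.particleDrift a s (R ω s)) volume 0 t := fun ω t ht => by
    rw [intervalIntegrable_iff_integrableOn_Ioc_of_le ht.1]
    exact (hint ω).mono_set fun s hs => ⟨hs.1.le, hs.2.trans ht.2⟩
  have hReq : ∀ ω, ∀ t (ht : t ∈ Icc 0 D.T), R ω t = Z ω ⟨t, ht⟩ +
      ∫ s in (0 : ℝ)..t, D.particleDrift a s (R ω s) := fun ω t ht => by
    have h1 : R ω t = S (Z ω) ⟨t, ht⟩ := IccExtend_of_mem _ _ ht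
    rw [h1]
    exact hS (Z ω) ⟨t, ht⟩
  refine ⟨fun n t ω => (R ω t).1 n, fun i t ω => (R ω t).2 i, ?_, ?_, ?_, ?_, ?_, ?_⟩
  · exact fun n t _ => (measurable_pi_apply n).comp (measurable_fst.comp (hSm _))
  · exact fun i t _ => (measurable_pi_apply i).comp (measurable_snd.comp (hSm _))
  · exact fun n ω => ((continuous_apply n).comp (continuous_fst.comp (hRc ω))).continuousOn
  · exact fun i ω => ((continuous_apply i).comp (continuous_snd.comp (hRc ω))).continuousOn
  · intro n
    filter_upwards [hz n] with ω hω
    let p : (Fin N → Vec d) × (Fin m → Vec d) →L[ℝ] Vec d :=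
      (ContinuousLinearMap.proj n).comp (ContinuousLinearMap.fst ℝ _ _)
    simp only [← conv_empirical]
    refine ⟨p.integrable_comp (hint ω), fun t ht => ?_⟩
    have h1 := p.intervalIntegral_comp_comm (hii ω t ht)
    have h2 := congrArg p (hReq ω t ht)
    rw [map_add, ← h1] at h2
    refine h2.trans ?_
    have h3 : p (Z ω ⟨t, ht⟩) = X₀ n ω + √(2 * D.σ) • W n t.toNNReal ω := hω ⟨t, ht⟩
    rw [h3, add_right_comm]
    rfl
  · intro i
    refine ae_of_all _ fun ω => ?_
    let p : (Fin N → Vec d) × (Fin m → Vec d) →L[ℝ] Vec d :=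
      (ContinuousLinearMap.proj i).comp (ContinuousLinearMap.snd ℝ _ _)
    simp only [← conv_empirical]
    refine ⟨p.integrable_comp (hint ω), fun t ht => ?_⟩
    have h1 := p.intervalIntegral_comp_comm (hii ω t ht)
    have h2 := congrArg p (hReq ω t ht)
    rw [map_add, ← h1] at h2
    rw [add_zero]
    exact h2

end Particles

end MeanField

namespace MeanField

variable {d ℓ m : ℕ} {Ω : Type*} [MeasurableSpace Ω] {P : Measure Ω}

/-! ### Continuity in mean of solutions. -/

section ContinuityInMean

lemma IsNoise.exists_bound {T : ℝ} {z : Ω → C(Icc 0 T, Vec d)} (hz : IsNoise T P z) :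
    ∃ C, ∀ t, ∫ ω, ‖z ω t‖ ∂P ≤ C := by
  have hc : Continuous fun t => ∫ ω, ‖z ω t‖ ∂P := by
    refine continuous_iff_continuousAt.2 fun t => ?_
    rw [ContinuousAt, tendsto_iff_dist_tendsto_zero]
    refine squeeze_zero (fun _ => dist_nonneg) (fun s => ?_) (hz.tendsto t)
    rw [Real.dist_eq, ← integral_sub (hz.integrable s).norm (hz.integrable t).norm]
    refine (abs_integral_le_integral_abs).trans ?_
    exact integral_mono ((hz.integrable s).norm.sub (hz.integrable t).norm).abs
      ((hz.integrable s).sub (hz.integrable t)).norm fun ω => abs_norm_sub_norm_le _ _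
  obtain ⟨C, hC⟩ := (isCompact_range hc).bddAbove
  exact ⟨C, fun t => hC ⟨t, rfl⟩⟩

variable [IsProbabilityMeasure P]

/-- The difference `X - z` is continuous in time and dominated, uniformly in time, by an integrable
variable; dominated convergence applies. -/
lemma IsNoise.continuous_mean {T : ℝ} {z : Ω → C(Icc 0 T, Vec d)} (hz : IsNoise T P z)
    {X : Ω → C(Icc 0 T, Vec d)} (hXm : ∀ t, Measurable fun ω => X ω t) {A : ℝ} {Q : Ω → ℝ}
    (hQ : Integrable Q P) (hXQ : ∀ᵐ ω ∂P, ∀ t, ‖X ω t - z ω t‖ ≤ A + Q ω) :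
    IsNoise T P X := by
  have hAQ : Integrable (fun ω => A + Q ω) P := (integrable_const _).add hQ
  have hd : ∀ t, Integrable (fun ω => X ω t - z ω t) P := fun t =>
    hAQ.mono' ((hXm t).sub (hz.measurable t)).aestronglyMeasurable
      (hXQ.mono fun ω hω => hω t)
  refine ⟨hXm, fun t => ?_, fun t => ?_⟩
  · exact ((hd t).add (hz.integrable t)).congr (ae_of_all _ fun ω => by simp)
  · have h1 : Tendsto (fun s => ∫ ω, ‖(X ω s - z ω s) - (X ω t - z ω t)‖ ∂P) (𝓝 t) (𝓝 0) := by
      have h := tendsto_integral_filter_of_dominated_convergence (μ := P) (l := 𝓝 t)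
        (F := fun s ω => ‖(X ω s - z ω s) - (X ω t - z ω t)‖) (f := fun _ => (0 : ℝ))
        (fun ω => 2 * (A + Q ω))
        (Eventually.of_forall fun s => ((hd s).sub (hd t)).norm.aestronglyMeasurable)
        (Eventually.of_forall fun s => ?_) (hAQ.const_mul 2) (ae_of_all _ fun ω => ?_)
      · simpa using h
      · filter_upwards [hXQ] with ω hω
        rw [norm_norm]
        exact (norm_sub_le _ _).trans (by linarith [hω s, hω t])
      · have hc : Continuous fun s => ‖(X ω s - z ω s) - (X ω t - z ω t)‖ := by fun_prop
        simpa using hc.tendsto t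
    refine squeeze_zero (fun s => integral_nonneg fun _ => norm_nonneg _) (fun s => ?_)
      (by simpa using h1.add (hz.tendsto t))
    have i1 : Integrable (fun ω => ‖(X ω s - z ω s) - (X ω t - z ω t)‖) P :=
      ((hd s).sub (hd t)).norm
    have i2 : Integrable (fun ω => ‖z ω s - z ω t‖) P :=
      ((hz.integrable s).sub (hz.integrable t)).norm
    rw [← integral_add i1 i2]
    refine integral_mono_of_nonneg (ae_of_all _ fun _ => norm_nonneg _) (i1.add i2)
      (ae_of_all _ fun ω => ?_)
    simp only
    refine le_trans (le_of_eq ?_) (norm_add_le _ _)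
    congr 1
    abel

/-- Solutions of a Lipschitz integral equation driven by a noise are continuous in mean. -/
lemma IsNoise.of_solution {T : ℝ} (hT : 0 ≤ T) {z : Ω → C(Icc 0 T, Vec d)} (hz : IsNoise T P z)
    {K : ℝ} (hK : 0 ≤ K) {b : ℝ → Vec d → Vec d}
    (hb : ∀ s x y, ‖b s x - b s y‖ ≤ K * ‖x - y‖)
    {X : Ω → C(Icc 0 T, Vec d)} (hXm : ∀ t, Measurable fun ω => X ω t)
    (hX : ∀ᵐ ω ∂P, SolvesIntegralEq T (IccExtend hT (X ω)) 0
      (fun s => b s (IccExtend hT (X ω) s)) (IccExtend hT (z ω))) :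
    IsNoise T P X := by
  -- The path of one fixed `ω₀` serves as reference. Differences of drifts are then controlled by
  -- the Lipschitz bound alone and nothing is asked of `b s 0`, which matters because no regularity
  -- in time of the mean-field law is known yet.
  obtain ⟨ω₀, hω₀⟩ := hX.exists
  obtain ⟨C, hC⟩ := hz.exists_bound
  have hXc : ∀ ω, Continuous (IccExtend hT (X ω)) := fun ω => (X ω).continuous.Icc_extend'
  have hzc : ∀ ω, Continuous (IccExtend hT (z ω)) := fun ω => (z ω).continuous.Icc_extend'
  let q : ℝ → Ω → ℝ := fun s ω => ‖IccExtend hT (z ω) s - IccExtend hT (z ω₀) s‖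
  have hqc : ∀ ω, Continuous fun s => q s ω := fun ω => ((hzc ω).sub (hzc ω₀)).norm
  have hqi : ∀ s, Integrable (q s) P := fun s =>
    ((hz.integrable _).sub (integrable_const _)).norm
  have hQ : Integrable (fun ω => ∫ s in (0 : ℝ)..T, q s ω) P := by
    refine integrable_timeIntegral (C := C + ‖z ω₀‖) hT hqc
      (fun s => continuous_norm.measurable.comp ((hz.measurable _).sub_const _)) hqi fun s => ?_
    have h1 : ∫ ω, (‖z ω (projIcc 0 T hT s)‖ + ‖z ω₀‖) ∂P = (∫ ω, ‖z ω (projIcc 0 T hT s)‖ ∂P) +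
        ‖z ω₀‖ := by
      rw [integral_add (hz.integrable _).norm (integrable_const _)]; simp
    refine le_trans (integral_mono (hqi s).norm ((hz.integrable (projIcc 0 T hT s)).norm.add
      (integrable_const ‖z ω₀‖)) fun ω => ?_) (h1.trans_le (by gcongr; exact hC _))
    simp only [q, norm_norm, Pi.add_apply]
    exact (norm_sub_le _ _).trans (add_le_add le_rfl ((z ω₀).norm_coe_le_norm _))
  let y : C(Icc 0 T, Vec d) := X ω₀ - z ω₀
  refine hz.continuous_mean hXm (A := ‖y‖) (hQ.const_mul (K * Real.exp (K * T))) ?_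
  filter_upwards [hX] with ω hω t
  have hdiff : ∀ t (ht : t ∈ Icc 0 T),
      ‖(X ω ⟨t, ht⟩ - z ω ⟨t, ht⟩) - (X ω₀ ⟨t, ht⟩ - z ω₀ ⟨t, ht⟩)‖ ≤
      K * ∫ s in (0 : ℝ)..t, ‖IccExtend hT (X ω) s - IccExtend hT (X ω₀) s‖ := by
    intro t ht
    have e : ∀ ω, SolvesIntegralEq T (IccExtend hT (X ω)) 0
        (fun s => b s (IccExtend hT (X ω) s)) (IccExtend hT (z ω)) →
        X ω ⟨t, ht⟩ - z ω ⟨t, ht⟩ = ∫ s in (0 : ℝ)..t, b s (IccExtend hT (X ω) s) := by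
      intro ω hω
      have h1 := hω.2 t ht
      rw [IccExtend_of_mem _ _ ht, IccExtend_of_mem _ _ ht] at h1
      rw [h1]; abel
    rw [e ω hω, e ω₀ hω₀]
    exact norm_integral_sub_integral_le_of_lipschitz ht hω.1 hω₀.1
      ((hXc ω).sub (hXc ω₀)).norm.continuousOn (ae_of_all _ fun s => hb s _ _)
  have hgr := integral_le_exp_mul_of_le (T := T) hK
    (u := fun s => ‖IccExtend hT (X ω) s - IccExtend hT (X ω₀) s‖) (G := fun s => q s ω)
    ((hXc ω).sub (hXc ω₀)).norm.continuousOn (hqc ω).continuousOn (fun s _ => norm_nonneg _)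
    (fun s hs => by
      have h2 := hdiff s hs
      simp only [q]
      rw [IccExtend_of_mem _ _ hs, IccExtend_of_mem _ _ hs, IccExtend_of_mem _ _ hs,
        IccExtend_of_mem _ _ hs]
      have h3 : X ω ⟨s, hs⟩ - X ω₀ ⟨s, hs⟩ = (z ω ⟨s, hs⟩ - z ω₀ ⟨s, hs⟩) +
        ((X ω ⟨s, hs⟩ - z ω ⟨s, hs⟩) - (X ω₀ ⟨s, hs⟩ - z ω₀ ⟨s, hs⟩)) := by abel
      rw [h3]
      exact (norm_add_le _ _).trans (by gcongr))
  have ht := t.2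
  have h4 := hdiff t ht
  have h5 := hgr t ht
  have h6 : ∫ s in (0 : ℝ)..t, q s ω ≤ ∫ s in (0 : ℝ)..T, q s ω :=
    integral_mono_upper (hqc ω).continuousOn (fun s => norm_nonneg _) ht.1 ht.2 le_rfl
  have h7 : ‖X ω₀ t - z ω₀ t‖ ≤ ‖y‖ := y.norm_coe_le_norm t
  calc ‖X ω t - z ω t‖ = ‖(X ω₀ t - z ω₀ t) + ((X ω t - z ω t) - (X ω₀ t - z ω₀ t))‖ := by
        congr 1; abel
    _ ≤ ‖y‖ + K * (Real.exp (K * T) * ∫ s in (0 : ℝ)..T, q s ω) := by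
        refine (norm_add_le _ _).trans (add_le_add h7 (h4.trans ?_))
        gcongr
        exact h5.trans (by gcongr)
    _ = _ := by ring

end ContinuityInMean

/-! ### Regularity and stability of mean-field solutions. -/

section MeanFieldSystem

variable {D : Data d ℓ m} {κ : ℝ≥0} {Cu : ℝ} {a a' : Control d ℓ m} {X₀ : Ω → Vec d}
  {W : ℝ≥0 → Ω → Vec d}

lemma Data.Regular.norm_driftX_sub_le_space (hD : D.Regular κ Cu) (μ : WassersteinOne d)
    (y : Fin m → Vec d) (x w : Vec d) :
    ‖D.driftX μ y x - D.driftX μ y w‖ ≤ 2 * κ * ‖x - w‖ := by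
  simpa [wDist_self] using hD.norm_driftX_sub_le μ μ y y x w

variable [IsProbabilityMeasure P]

/-- Continuity of `μ` is not part of the definition of a solution. It follows from continuity in
mean of the follower, and the estimates for flows rely on it. -/
lemma Data.IsMeanFieldSolution.integrable_and_continuous (hD : D.Regular κ Cu)
    {X : ℝ → Ω → Vec d} {μ : ℝ → WassersteinOne d} {Y : Fin m → ℝ → Vec d}
    (h : D.IsMeanFieldSolution P X₀ W a X μ Y) (hX₀ : Measurable X₀) (hX₀i : Integrable X₀ P)
    (hW : IsBrownianVec W P) :
    (∀ t ∈ Icc 0 D.T, Integrable (X t) P) ∧ ContinuousOn μ (Icc 0 D.T) := by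
  have hT := hD.T_nonneg
  obtain ⟨z, hzm, hz⟩ := exists_continuous_modification hW hX₀ D.T √(2 * D.σ)
  have hzN := isNoise_of_ae_eq hW hX₀i hzm hz
  let X' : Ω → C(Icc 0 D.T, Vec d) := fun ω =>
    ⟨fun t => X t ω, continuousOn_iff_continuous_domRestrict.1 (h.continuous_X ω)⟩
  have hX' : ∀ ω, ∀ t ∈ Icc 0 D.T, IccExtend hT (X' ω) t = X t ω := fun ω t ht =>
    IccExtend_of_mem _ _ ht
  have hN : IsNoise D.T P X' := by
    refine hzN.of_solution hT (K := 2 * κ) (by positivity)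
      (b := fun s x => D.driftX (μ s) (fun j => Y j s) x)
      (fun s x y => hD.norm_driftX_sub_le_space _ _ _ _) (fun t => h.measurable_X t t.2) ?_
    filter_upwards [h.eq_X, hz] with ω hω hzω
    refine ⟨hω.1.congr_fun (fun s hs => ?_) measurableSet_Icc, fun t ht => ?_⟩
    · simp only [hX' ω s hs]; rfl
    · have h1 : X t ω = _ := hω.2 t ht
      rw [hX' ω t ht, h1, IccExtend_of_mem _ _ ht, hzω ⟨t, ht⟩, zero_add,
        add_right_comm, add_comm]
      congr 1
      refine intervalIntegral.integral_congr fun s hs => ?_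
      rw [uIcc_of_le ht.1] at hs
      simp only [hX' ω s ⟨hs.1, hs.2.trans ht.2⟩]
      rfl
  refine ⟨fun t ht => hN.integrable ⟨t, ht⟩, ?_⟩
  rw [continuousOn_iff_continuous_domRestrict]
  refine continuous_iff_continuousAt.2 fun t => ?_
  rw [ContinuousAt, tendsto_iff_dist_tendsto_zero]
  refine squeeze_zero (fun _ => dist_nonneg) (fun s => ?_) (hN.tendsto t)
  exact wDist_le_integral (h.measurable_X s s.2).aemeasurable (h.measurable_X t t.2).aemeasurable
    (h.law_X s s.2) (h.law_X t t.2)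

lemma Data.IsMeanFieldSolution.leaderFlow (hD : D.Regular κ Cu)
    {X : ℝ → Ω → Vec d} {μ : ℝ → WassersteinOne d} {Y : Fin m → ℝ → Vec d}
    (h : D.IsMeanFieldSolution P X₀ W a X μ Y) (hX₀ : Measurable X₀) (hX₀i : Integrable X₀ P)
    (hW : IsBrownianVec W P) : D.LeaderFlow a μ Y :=
  ⟨(h.integrable_and_continuous hD hX₀ hX₀i hW).2, h.continuous_Y, h.eq_Y⟩

/-- Stability of the mean-field system with respect to the control. -/
lemma Data.IsMeanFieldSolution.flowDist_le (hD : D.Regular κ Cu) (ha : a ∈ D.admissible)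
    {X X' : ℝ → Ω → Vec d} {μ μ' : ℝ → WassersteinOne d} {Y Y' : Fin m → ℝ → Vec d}
    (h : D.IsMeanFieldSolution P X₀ W a X μ Y) (h' : D.IsMeanFieldSolution P X₀ W a' X' μ' Y')
    (hX₀ : Measurable X₀) (hX₀i : Integrable X₀ P) (hW : IsBrownianVec W P) {δ : ℝ} (hδ : 0 ≤ δ)
    (hgap : ∀ i, ∀ t ∈ Icc 0 D.T,
      ‖(∫ s in (0 : ℝ)..t, a.u i s (μ' s)) - ∫ s in (0 : ℝ)..t, a'.u i s (μ' s)‖ ≤ δ) :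
    ∀ t ∈ Icc 0 D.T, flowDist μ μ' Y Y' t ≤ flowConst D κ Cu * δ := by
  have hf := h.leaderFlow hD hX₀ hX₀i hW
  have hf' := h'.leaderFlow hD hX₀ hX₀i hW
  intro t ht
  have key := hD.flowDist_le ha hf hf' hδ hgap (r := fun _ => 0) continuousOn_const
    (fun _ => le_rfl) (fun t ht => ?_) t ht
  · simpa using key
  · rw [zero_add]
    refine (wDist_le_integral (h.measurable_X t ht).aemeasurable
      (h'.measurable_X t ht).aemeasurable (h.law_X t ht) (h'.law_X t ht)).trans ?_
    have hae : ∀ᵐ ω ∂P, ‖X t ω - X' t ω‖ ≤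
        followerConst D.T κ * ∫ s in (0 : ℝ)..t, flowDist μ μ' Y Y' s := by
      filter_upwards [h.eq_X, h'.eq_X] with ω hω hω'
      exact hD.norm_follower_sub_le hf.continuous_μ hf'.continuous_μ hf.continuous_Y
        hf'.continuous_Y (h.continuous_X ω) (h'.continuous_X ω) hω hω' t ht
    calc ∫ ω, ‖X t ω - X' t ω‖ ∂P
        ≤ ∫ _ω, (followerConst D.T κ * ∫ s in (0 : ℝ)..t, flowDist μ μ' Y Y' s) ∂P :=
          integral_mono_of_nonneg (ae_of_all _ fun _ => norm_nonneg _) (integrable_const _) hae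
      _ = _ := by simp

/-- For a given flow and given leaders, the followers are continuous functions of their noise. -/
lemma Data.Regular.exists_followerMap (hD : D.Regular κ Cu) {μ : ℝ → WassersteinOne d}
    {Y : Fin m → ℝ → Vec d} (hμ : ContinuousOn μ (Icc 0 D.T))
    (hY : ∀ i, ContinuousOn (Y i) (Icc 0 D.T)) :
    ∃ S : C(Icc 0 D.T, Vec d) → C(Icc 0 D.T, Vec d), Continuous S ∧
      ∀ z, SolvesIntegralEq D.T (IccExtend hD.T_nonneg (S z)) 0
        (fun s => D.driftX (μ s) (fun j => Y j s) (IccExtend hD.T_nonneg (S z) s))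
        (IccExtend hD.T_nonneg z) := by
  have hint : ∀ x : ℝ → Vec d, Continuous x →
      IntegrableOn (fun s => D.driftX (μ s) (fun j => Y j s) (x s)) (Icc 0 D.T) := fun x hx =>
    (hD.continuous_driftX.comp_continuousOn
      (hμ.prodMk ((continuousOn_pi.2 hY).prodMk hx.continuousOn))).integrableOn_Icc
  obtain ⟨S, hSc, hS⟩ := exists_continuous_solution (V := Vec d) hD.T_nonneg (K := 2 * κ)
    (by positivity) (B := fun s x => D.driftX (μ s) (fun j => Y j s) x) hint
    (ae_of_all _ fun s x y => hD.norm_driftX_sub_le_space _ _ _ _)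
  refine ⟨S, hSc, fun z => ⟨hint _ (S z).continuous.Icc_extend', fun t ht => ?_⟩⟩
  rw [IccExtend_of_mem _ _ ht, IccExtend_of_mem _ _ ht, hS z ⟨t, ht⟩, zero_add, add_comm]

end MeanFieldSystem

end MeanField

namespace MeanField

/-! ### Existence for the mean-field system by a fixed point in `L¹`. -/

variable {d ℓ m : ℕ} {Ω : Type*} [MeasurableSpace Ω] {P : Measure Ω}

lemma dist_toL1 {f g : Ω → Vec d} (hf : Integrable f P) (hg : Integrable g P) :
    dist (hf.toL1 f) (hg.toL1 g) = ∫ ω, ‖f ω - g ω‖ ∂P := by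
  rw [dist_eq_norm, ← Integrable.toL1_sub, L1.norm_of_fun_eq_integral_norm]
  rfl

lemma measurable_comp_of_continuous {T : ℝ} [Nonempty (Icc 0 T)] {z : Ω → C(Icc 0 T, Vec d)}
    (hzm : ∀ t, Measurable fun ω => z ω t) {E : Type*} [TopologicalSpace E] [MeasurableSpace E]
    [BorelSpace E] [Nonempty E] {F : C(Icc 0 T, Vec d) → E} (hF : Continuous F) :
    Measurable fun ω => F (z ω) := by
  obtain ⟨G, hG, hGF⟩ := exists_measurable_evalDense T hF
  have : (fun ω => F (z ω)) = G ∘ fun ω => evalDense T (z ω) := by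
    funext ω; exact (hGF _).symm
  rw [this]
  exact hG.comp (measurable_pi_lambda _ fun k => hzm _)

variable [IsProbabilityMeasure P]

/-- The law of an element of `L¹`. -/
noncomputable def lpLaw (f : Ω →₁[P] Vec d) : WassersteinOne d :=
  lawOf P f (L1.integrable_coeFn f)

lemma wDist_lpLaw_le (f g : Ω →₁[P] Vec d) : wDist (lpLaw f) (lpLaw g) ≤ dist f g := by
  refine (wDist_le_integral (L1.integrable_coeFn f).aemeasurable
    (L1.integrable_coeFn g).aemeasurable rfl rfl).trans_eq ?_
  rw [dist_eq_norm, L1.norm_eq_integral_norm]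
  refine integral_congr_ae ?_
  filter_upwards [Lp.coeFn_sub f g] with ω hω
  rw [hω, Pi.sub_apply]

lemma continuous_lpLaw : Continuous (lpLaw : (Ω →₁[P] Vec d) → WassersteinOne d) :=
  LipschitzWith.continuous (K := 1)
    (LipschitzWith.of_dist_le_mul fun f g => by
      simpa [dist_eq_wDist] using wDist_lpLaw_le f g)

lemma lpLaw_toL1 {f : Ω → Vec d} (hf : Integrable f P) : (lpLaw (hf.toL1 f)).1 = P.map f :=
  Measure.map_congr hf.coeFn_toL1

variable {D : Data d ℓ m} {κ : ℝ≥0} {Cu : ℝ} {a a' : Control d ℓ m} {X₀ : Ω → Vec d}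
  {W : ℝ≥0 → Ω → Vec d}

/-- Existence of solutions of the mean-field system. -/
lemma Data.Regular.exists_meanFieldSolution (hD : D.Regular κ Cu) (ha : a ∈ D.admissible)
    (hX₀ : Measurable X₀) (hX₀i : Integrable X₀ P) (hW : IsBrownianVec W P) :
    ∃ X μ Y, D.IsMeanFieldSolution P X₀ W a X μ Y := by
  have hT := hD.T_nonneg
  have : Nonempty (Icc 0 D.T) := ⟨⟨0, left_mem_Icc.2 hT⟩⟩
  have hCL : 0 ≤ Cu * D.L := mul_nonneg hD.Cu_nonneg hD.L_nonneg
  have hCf := followerConst_nonneg hT κ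
  obtain ⟨z, hzm, hz⟩ := exists_continuous_modification hW hX₀ D.T √(2 * D.σ)
  have hzN := isNoise_of_ae_eq hW hX₀i hzm hz
  -- The unknown is a continuous curve `c` in `L¹ × (ℝᵈ)ᵐ`. The fixed-point map solves the
  -- follower's equation with the flow `lpLaw` of the first component and the leaders frozen, and
  -- updates the leaders by their integral equation. Random vectors in place of laws provide a
  -- complete space.
  let μf : C(Icc 0 D.T, (Ω →₁[P] Vec d) × (Fin m → Vec d)) → ℝ → WassersteinOne d :=
    fun c s => lpLaw (IccExtend hT c s).1
  let Yf : C(Icc 0 D.T, (Ω →₁[P] Vec d) × (Fin m → Vec d)) → Fin m → ℝ → Vec d :=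
    fun c i s => (IccExtend hT c s).2 i
  have hcc : ∀ c : C(Icc 0 D.T, (Ω →₁[P] Vec d) × (Fin m → Vec d)),
      Continuous (IccExtend hT c) := fun c => c.continuous.Icc_extend'
  have hμf : ∀ c, Continuous (μf c) := fun c => continuous_lpLaw.comp (continuous_fst.comp (hcc c))
  have hYf : ∀ c i, Continuous (Yf c i) := fun c i =>
    (continuous_apply i).comp (continuous_snd.comp (hcc c))
  -- The factor `2` appears because `flowDist` is a sum and the product distance a maximum.
  have hρ : ∀ c c' s, flowDist (μf c) (μf c') (Yf c) (Yf c') s ≤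
      2 * dist (IccExtend hT c s) (IccExtend hT c' s) := by
    intro c c' s
    have h1 : wDist (μf c s) (μf c' s) ≤ dist (IccExtend hT c s) (IccExtend hT c' s) :=
      (wDist_lpLaw_le _ _).trans (le_max_left _ _)
    have h2 : ‖(fun j => Yf c j s) - fun j => Yf c' j s‖ ≤
        dist (IccExtend hT c s) (IccExtend hT c' s) := by
      rw [← dist_eq_norm]
      exact le_max_right _ _
    unfold flowDist
    linarith
  have hρI : ∀ c c', ∀ t ∈ Icc 0 D.T,
      ∫ s in (0 : ℝ)..t, flowDist (μf c) (μf c') (Yf c) (Yf c') s ≤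
      2 * ∫ s in (0 : ℝ)..t, dist (IccExtend hT c s) (IccExtend hT c' s) := by
    intro c c' t ht
    rw [← intervalIntegral.integral_const_mul]
    refine intervalIntegral.integral_mono_on ht.1 ?_ ?_ fun s _ => hρ c c' s
    · exact intervalIntegrable_of_continuousOn_Icc (continuousOn_flowDist (hμf c).continuousOn
        (hμf c').continuousOn (fun i => (hYf c i).continuousOn)
        (fun i => (hYf c' i).continuousOn)) ht
    · exact (((hcc c).dist (hcc c')).const_mul 2).intervalIntegrable _ _
  choose S hSc hS using fun c => hD.exists_followerMap (hμf c).continuousOn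
    (fun i => (hYf c i).continuousOn)
  have hXm : ∀ c t, Measurable fun ω => S c (z ω) t := fun c t =>
    measurable_comp_of_continuous hzm (F := fun x => S c x t) (by have := hSc c; fun_prop)
  have hXN : ∀ c, IsNoise D.T P fun ω => S c (z ω) := fun c =>
    hzN.of_solution hT (K := 2 * κ) (by positivity)
      (b := fun s x => D.driftX (μf c s) (fun j => Yf c j s) x)
      (fun s x y => hD.norm_driftX_sub_le_space _ _ _ _) (hXm c) (ae_of_all _ fun ω => hS c (z ω))
  let bY : C(Icc 0 D.T, (Ω →₁[P] Vec d) × (Fin m → Vec d)) → Fin m → ℝ → Vec d :=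
    fun c i s => D.driftY (μf c s) (fun j => Yf c j s) i + a.u i s (μf c s)
  have hbY : ∀ c i, IntegrableOn (bY c i) (Icc 0 D.T) := fun c i =>
    (((hD.continuous_driftY i).comp ((hμf c).prodMk
      (continuous_pi (hYf c)))).continuousOn.integrableOn_Icc).add
      (hD.integrableOn_u ha i (hμf c).continuousOn)
  have hprim : ∀ c i, Continuous fun t : Icc 0 D.T => D.Y₀ i + ∫ s in (0 : ℝ)..t, bY c i s := by
    intro c i
    have := intervalIntegral.continuousOn_primitive_interval (μ := volume) (a := 0) (b := D.T)
      (f := bY c i) (by rw [uIcc_of_le hT]; exact hbY c i)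
    rw [uIcc_of_le hT, continuousOn_iff_continuous_domRestrict] at this
    exact continuous_const.add this
  have hXc : ∀ c, Continuous fun t : Icc 0 D.T =>
      ((hXN c).integrable t).toL1 (fun ω => S c (z ω) t) := by
    intro c
    refine continuous_iff_continuousAt.2 fun t => ?_
    rw [ContinuousAt, tendsto_iff_dist_tendsto_zero]
    simp only [dist_toL1]
    exact (hXN c).tendsto t
  let Φ : C(Icc 0 D.T, (Ω →₁[P] Vec d) × (Fin m → Vec d)) →
      C(Icc 0 D.T, (Ω →₁[P] Vec d) × (Fin m → Vec d)) := fun c =>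
    ⟨fun t => (((hXN c).integrable t).toL1 (fun ω => S c (z ω) t),
      fun i => D.Y₀ i + ∫ s in (0 : ℝ)..t, bY c i s),
      (hXc c).prodMk (continuous_pi (hprim c))⟩
  obtain ⟨c, hc⟩ := exists_fixedPoint_of_volterra hT
    (K := 2 * followerConst D.T κ + 2 * (3 * κ + Cu * D.L)) (by positivity) Φ (by
    intro c c' t
    have hI0 : 0 ≤ ∫ s in (0 : ℝ)..t, dist (IccExtend hT c s) (IccExtend hT c' s) :=
      intervalIntegral.integral_nonneg t.2.1 fun _ _ => dist_nonneg
    have hI := hρI c c' t t.2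
    refine max_le ?_ ?_
    · change dist (((hXN c).integrable t).toL1 (fun ω => S c (z ω) t))
        (((hXN c').integrable t).toL1 (fun ω => S c' (z ω) t)) ≤ _
      rw [dist_toL1]
      calc ∫ ω, ‖S c (z ω) t - S c' (z ω) t‖ ∂P
          ≤ ∫ _ω, followerConst D.T κ *
            (2 * ∫ s in (0 : ℝ)..t, dist (IccExtend hT c s) (IccExtend hT c' s)) ∂P := by
            refine integral_mono_of_nonneg (ae_of_all _ fun _ => norm_nonneg _)
              (integrable_const _) (ae_of_all _ fun ω => ?_)
            have h1 := hD.norm_follower_sub_le (hμf c).continuousOn (hμf c').continuousOn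
              (fun i => (hYf c i).continuousOn) (fun i => (hYf c' i).continuousOn)
              (S c (z ω)).continuous.Icc_extend'.continuousOn
              (S c' (z ω)).continuous.Icc_extend'.continuousOn (hS c (z ω)) (hS c' (z ω)) t t.2
            rw [IccExtend_of_mem _ _ t.2, IccExtend_of_mem _ _ t.2] at h1
            exact h1.trans (mul_le_mul_of_nonneg_left hI hCf)
        _ = 2 * followerConst D.T κ *
            ∫ s in (0 : ℝ)..t, dist (IccExtend hT c s) (IccExtend hT c' s) := by
            rw [integral_const]; simp; ring
        _ ≤ _ := by
            have : (0 : ℝ) ≤ 2 * (3 * κ + Cu * D.L) := by positivity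
            gcongr
            linarith
    · change dist (fun i => D.Y₀ i + ∫ s in (0 : ℝ)..t, bY c i s)
        (fun i => D.Y₀ i + ∫ s in (0 : ℝ)..t, bY c' i s) ≤ _
      rw [dist_pi_le_iff (by positivity)]
      intro i
      rw [dist_add_left, dist_eq_norm]
      have h2 := norm_integral_sub_integral_le_of_lipschitz (T := D.T) (K := 3 * κ + Cu * D.L)
        (w := flowDist (μf c) (μf c') (Yf c) (Yf c')) t.2 (hbY c i) (hbY c' i)
        (continuousOn_flowDist (hμf c).continuousOn
        (hμf c').continuousOn (fun i => (hYf c i).continuousOn)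
        (fun i => (hYf c' i).continuousOn)) (by
          filter_upwards [hD.ae_norm_u_sub_le ha i] with s hs
          rw [add_sub_add_comm, add_mul]
          refine (norm_add_le _ _).trans (add_le_add (hD.norm_driftY_sub_le _ _ _ _ _) ?_)
          exact (hs _ _).trans (mul_le_mul_of_nonneg_left (wDist_le_flowDist _ _ _ _ s) hCL))
      refine h2.trans ?_
      calc (3 * κ + Cu * D.L) * ∫ s in (0 : ℝ)..t, flowDist (μf c) (μf c') (Yf c) (Yf c') s
          ≤ (3 * κ + Cu * D.L) *
            (2 * ∫ s in (0 : ℝ)..t, dist (IccExtend hT c s) (IccExtend hT c' s)) := by gcongr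
        _ = 2 * (3 * κ + Cu * D.L) *
            ∫ s in (0 : ℝ)..t, dist (IccExtend hT c s) (IccExtend hT c' s) := by ring
        _ ≤ _ := by gcongr; linarith)
  have hc1 : ∀ t (ht : t ∈ Icc 0 D.T),
      (IccExtend hT c t).1 = ((hXN c).integrable ⟨t, ht⟩).toL1 (fun ω => S c (z ω) ⟨t, ht⟩) := by
    intro t ht
    rw [IccExtend_of_mem _ _ ht]
    exact congrArg Prod.fst (DFunLike.congr_fun hc ⟨t, ht⟩).symm
  have hc2 : ∀ t, t ∈ Icc 0 D.T → ∀ i, Yf c i t = D.Y₀ i + ∫ s in (0 : ℝ)..t, bY c i s := by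
    intro t ht i
    simp only [Yf]
    rw [IccExtend_of_mem _ _ ht]
    exact congrFun (congrArg Prod.snd (DFunLike.congr_fun hc ⟨t, ht⟩).symm) i
  refine ⟨fun t ω => IccExtend hT (S c (z ω)) t, μf c, Yf c, ?_, ?_, ?_, ?_, ?_, ?_⟩
  · exact fun t _ => hXm c _
  · exact fun ω => (S c (z ω)).continuous.Icc_extend'.continuousOn
  · intro t ht
    simp only [μf]
    rw [hc1 t ht, lpLaw_toL1]
    congr 1
    funext ω
    exact IccExtend_of_mem _ _ ht
  · exact fun i => (hYf c i).continuousOn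
  · filter_upwards [hz] with ω hω
    refine (hS c (z ω)).congr_offset fun t ht => ?_
    rw [IccExtend_of_mem _ _ ht, hω ⟨t, ht⟩, zero_add]
  · intro i
    refine ⟨hbY c i, fun t ht => ?_⟩
    rw [add_zero]
    exact hc2 t ht i

end MeanField

namespace MeanField

/-! ### Independent copies of the mean-field follower. -/

section Independence

variable {Ω : Type*} [MeasurableSpace Ω] {P : Measure Ω}

lemma map_prodProdProdComm_prod {α β γ δ : Type*} [MeasurableSpace α] [MeasurableSpace β]
    [MeasurableSpace γ] [MeasurableSpace δ] (μ : Measure α) (ν : Measure β) (ρ : Measure γ)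
    (τ : Measure δ) [IsProbabilityMeasure μ] [IsProbabilityMeasure ν] [IsProbabilityMeasure ρ]
    [IsProbabilityMeasure τ] :
    ((μ.prod ν).prod (ρ.prod τ)).map (fun q => ((q.1.1, q.2.1), (q.1.2, q.2.2))) =
      (μ.prod ρ).prod (ν.prod τ) := by
  refine Measure.ext_of_lintegral _ fun f hf => ?_
  have hq : Measurable fun q : (α × β) × γ × δ => ((q.1.1, q.2.1), (q.1.2, q.2.2)) := by fun_prop
  have hfq : Measurable fun q : (α × β) × γ × δ => f ((q.1.1, q.2.1), (q.1.2, q.2.2)) :=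
    hf.comp hq
  rw [lintegral_map hf hq, lintegral_prod _ hfq.aemeasurable, lintegral_prod _ hf.aemeasurable,
    lintegral_prod, lintegral_prod]
  · refine lintegral_congr fun x => ?_
    have e1 : ∀ y, ∫⁻ r, f ((x, r.1), (y, r.2)) ∂(ρ.prod τ) =
        ∫⁻ z, ∫⁻ w, f ((x, z), (y, w)) ∂τ ∂ρ := fun y =>
      lintegral_prod _ (hf.comp (by fun_prop)).aemeasurable
    have e2 : ∀ z, ∫⁻ r, f ((x, z), r) ∂(ν.prod τ) =
        ∫⁻ y, ∫⁻ w, f ((x, z), (y, w)) ∂τ ∂ν := fun z =>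
      lintegral_prod _ (hf.comp (by fun_prop)).aemeasurable
    simp only [e1, e2]
    refine lintegral_lintegral_swap (Measurable.aemeasurable ?_)
    exact Measurable.lintegral_prod_right' (f := fun r : (β × γ) × δ =>
      f ((x, r.1.2), (r.1.1, r.2))) (hf.comp (by fun_prop))
  · exact (hf.lintegral_prod_right').aemeasurable
  · exact (hfq.lintegral_prod_right').aemeasurable

/-- Used with `A`, `B` the initial values and `C`, `E` the Brownian motions of two followers: their
complete noises are then independent. -/
lemma indepFun_prodMk_prodMk {α β γ δ : Type*} [MeasurableSpace α] [MeasurableSpace β]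
    [MeasurableSpace γ] [MeasurableSpace δ] [IsProbabilityMeasure P] {A : Ω → α} {B : Ω → β}
    {C : Ω → γ} {E : Ω → δ} (hA : Measurable A) (hB : Measurable B) (hC : Measurable C)
    (hE : Measurable E) (hAB : IndepFun A B P) (hCE : IndepFun C E P)
    (h : IndepFun (fun ω => (A ω, B ω)) (fun ω => (C ω, E ω)) P) :
    IndepFun (fun ω => (A ω, C ω)) (fun ω => (B ω, E ω)) P := by
  have := Measure.isProbabilityMeasure_map (μ := P) hA.aemeasurable
  have := Measure.isProbabilityMeasure_map (μ := P) hB.aemeasurable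
  have := Measure.isProbabilityMeasure_map (μ := P) hC.aemeasurable
  have := Measure.isProbabilityMeasure_map (μ := P) hE.aemeasurable
  have hAC : IndepFun A C P := h.comp measurable_fst measurable_fst
  have hBE : IndepFun B E P := h.comp measurable_snd measurable_snd
  rw [indepFun_iff_map_prod_eq_prod_map_map (by fun_prop) (by fun_prop)] at hAB hCE hAC hBE h ⊢
  rw [hAC, hBE, ← map_prodProdProdComm_prod, ← hAB, ← hCE, ← h,
    Measure.map_map (by fun_prop) (by fun_prop)]
  rfl

end Independence

variable {d ℓ m : ℕ} {Ω : Type*} [MeasurableSpace Ω] {P : Measure Ω}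

lemma IsBrownianVec.measurable_process {W : ℝ≥0 → Ω → Vec d} (hW : IsBrownianVec W P) :
    Measurable fun (ω : Ω) (t : ℝ≥0) => W t ω :=
  measurable_pi_lambda _ hW.measurable

/-- The values at a dense sequence of times of the path `x + c w`. -/
noncomputable def noiseValues (T c : ℝ) [Nonempty (Icc 0 T)] (q : Vec d × (ℝ≥0 → Vec d)) :
    ℕ → Vec d :=
  fun k => q.1 + c • q.2 (TopologicalSpace.denseSeq (Icc 0 T) k : ℝ).toNNReal

lemma measurable_noiseValues (T c : ℝ) [Nonempty (Icc 0 T)] :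
    Measurable (noiseValues (d := d) T c) := by
  refine measurable_pi_lambda _ fun k => ?_
  unfold noiseValues
  fun_prop

lemma evalDense_ae_eq_noiseValues {T c : ℝ} [Nonempty (Icc 0 T)] {X₀ : Ω → Vec d}
    {W : ℝ≥0 → Ω → Vec d} {z : Ω → C(Icc 0 T, Vec d)}
    (hz : ∀ᵐ ω ∂P, ∀ t : Icc 0 T, z ω t = X₀ ω + c • W (t : ℝ).toNNReal ω) :
    (fun ω => evalDense T (z ω)) =ᵐ[P] fun ω => noiseValues T c (X₀ ω, fun t => W t ω) := by
  filter_upwards [hz] with ω hω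
  funext k
  exact hω _

variable [IsProbabilityMeasure P]

/-- All Brownian motions have the same law. -/
lemma IsBrownianVec.map_eq {W W' : ℝ≥0 → Ω → Vec d} (hW : IsBrownianVec W P)
    (hW' : IsBrownianVec W' P) :
    P.map (fun (ω : Ω) (t : ℝ≥0) => W t ω) = P.map (fun (ω : Ω) (t : ℝ≥0) => W' t ω) := by
  have hm : ∀ {V : ℝ≥0 → Ω → Vec d}, IsBrownianVec V P → ∀ i,
      Measurable fun (ω : Ω) (t : ℝ≥0) => V t ω i := fun hV i =>
    measurable_pi_lambda _ fun t => by have := hV.measurable t; fun_prop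
  have h1 : ∀ i, P.map (fun (ω : Ω) (t : ℝ≥0) => W t ω i) =
      P.map (fun (ω : Ω) (t : ℝ≥0) => W' t ω i) := fun i => by
    rw [map_eq_iff_forall_finset_map_restrict_eq (hm hW i).aemeasurable (hm hW' i).aemeasurable]
    intro I
    exact ((hW.brownian i).hasLaw I).map_eq.trans ((hW'.brownian i).hasLaw I).map_eq.symm
  have h2 : ∀ {V : ℝ≥0 → Ω → Vec d}, IsBrownianVec V P →
      P.map (fun (ω : Ω) (i : Fin d) (t : ℝ≥0) => V t ω i) =
        Measure.pi fun i => P.map fun (ω : Ω) (t : ℝ≥0) => V t ω i := fun hV =>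
    (iIndepFun_iff_map_fun_eq_pi_map fun i => (hm hV i).aemeasurable).1 hV.indep
  have hΘ : Measurable fun (f : Fin d → ℝ≥0 → ℝ) (t : ℝ≥0) =>
      (WithLp.toLp 2 fun i => f i t : Vec d) := by
    refine measurable_pi_lambda _ fun t => ?_
    fun_prop
  have h3 : ∀ {V : ℝ≥0 → Ω → Vec d}, IsBrownianVec V P →
      P.map (fun (ω : Ω) (t : ℝ≥0) => V t ω) =
        (Measure.pi fun i => P.map fun (ω : Ω) (t : ℝ≥0) => V t ω i).map
          fun (f : Fin d → ℝ≥0 → ℝ) (t : ℝ≥0) => (WithLp.toLp 2 fun i => f i t : Vec d) :=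
    fun hV => by
      rw [← h2 hV, Measure.map_map hΘ (measurable_pi_lambda _ fun i => hm hV i)]
      rfl
  rw [h3 hW, h3 hW']
  simp only [h1]

/-- The sampled noise is a fixed measurable function of the initial value and the Brownian motion,
whose joint law is the product of the marginal laws. -/
lemma map_evalDense_eq {T c : ℝ} [Nonempty (Icc 0 T)] {X₀ X₀' : Ω → Vec d}
    {W W' : ℝ≥0 → Ω → Vec d} {z z' : Ω → C(Icc 0 T, Vec d)}
    (hz : ∀ᵐ ω ∂P, ∀ t : Icc 0 T, z ω t = X₀ ω + c • W (t : ℝ).toNNReal ω)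
    (hz' : ∀ᵐ ω ∂P, ∀ t : Icc 0 T, z' ω t = X₀' ω + c • W' (t : ℝ).toNNReal ω)
    (hX₀ : Measurable X₀) (hX₀' : Measurable X₀') (hlaw : P.map X₀ = P.map X₀')
    (hW : IsBrownianVec W P) (hW' : IsBrownianVec W' P)
    (hi : IndepFun X₀ (fun ω t => W t ω) P) (hi' : IndepFun X₀' (fun ω t => W' t ω) P) :
    P.map (fun ω => evalDense T (z ω)) = P.map (fun ω => evalDense T (z' ω)) := by
  have e : ∀ {X : Ω → Vec d} {V : ℝ≥0 → Ω → Vec d} {y : Ω → C(Icc 0 T, Vec d)},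
      (∀ᵐ ω ∂P, ∀ t : Icc 0 T, y ω t = X ω + c • V (t : ℝ).toNNReal ω) → Measurable X →
      IsBrownianVec V P → IndepFun X (fun ω t => V t ω) P →
      P.map (fun ω => evalDense T (y ω)) =
        ((P.map X).prod (P.map fun ω t => V t ω)).map (noiseValues T c) := by
    intro X V y hy hX hV hXV
    rw [Measure.map_congr (evalDense_ae_eq_noiseValues hy),
      ← (indepFun_iff_map_prod_eq_prod_map_map hX.aemeasurable
        hV.measurable_process.aemeasurable).1 hXV,
      Measure.map_map (measurable_noiseValues T c) (hX.prodMk hV.measurable_process)]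
    rfl
  rw [e hz hX₀ hW hi, e hz' hX₀' hW' hi', hlaw, hW.map_eq hW']

lemma indepFun_evalDense {T c : ℝ} [Nonempty (Icc 0 T)] {X₀ : ℕ → Ω → Vec d}
    {W : ℕ → ℝ≥0 → Ω → Vec d} {z : ℕ → Ω → C(Icc 0 T, Vec d)}
    (hz : ∀ n, ∀ᵐ ω ∂P, ∀ t : Icc 0 T, z n ω t = X₀ n ω + c • W n (t : ℝ).toNNReal ω)
    (hX₀ : ∀ n, Measurable (X₀ n)) (hX₀i : iIndepFun X₀ P) (hW : ∀ n, IsBrownianVec (W n) P)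
    (hWi : iIndepFun (fun (n : ℕ) (ω : Ω) (t : ℝ≥0) => W n t ω) P)
    (hX₀W : IndepFun (fun (ω : Ω) (n : ℕ) => X₀ n ω)
      (fun (ω : Ω) (n : ℕ) (t : ℝ≥0) => W n t ω) P) {i j : ℕ} (hij : i ≠ j) :
    IndepFun (fun ω => evalDense T (z i ω)) (fun ω => evalDense T (z j ω)) P := by
  have h1 : IndepFun (fun ω => (X₀ i ω, X₀ j ω))
      (fun ω => ((fun t => W i t ω : ℝ≥0 → Vec d), (fun t => W j t ω : ℝ≥0 → Vec d))) P :=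
    hX₀W.comp (φ := fun x : ℕ → Vec d => (x i, x j))
      (ψ := fun w : ℕ → ℝ≥0 → Vec d => (w i, w j)) (by fun_prop) (by fun_prop)
  have h2 := indepFun_prodMk_prodMk (hX₀ i) (hX₀ j) (hW i).measurable_process
    (hW j).measurable_process (hX₀i.indepFun hij) (hWi.indepFun hij) h1
  exact (h2.comp (measurable_noiseValues T c) (measurable_noiseValues T c)).congr
    (evalDense_ae_eq_noiseValues (hz i)).symm (evalDense_ae_eq_noiseValues (hz j)).symm

variable {D : Data d ℓ m} {κ : ℝ≥0} {Cu : ℝ} {a : Control d ℓ m}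

/-- Independent copies of the mean-field follower, driven by the noises of the particle system. -/
lemma Data.IsMeanFieldSolution.exists_copies (hD : D.Regular κ Cu) {X₀' : Ω → Vec d}
    {W' : ℝ≥0 → Ω → Vec d} {X' : ℝ → Ω → Vec d} {μ : ℝ → WassersteinOne d}
    {Y : Fin m → ℝ → Vec d} (h : D.IsMeanFieldSolution P X₀' W' a X' μ Y)
    (hf : D.LeaderFlow a μ Y) (hX₀m' : Measurable X₀') (hW' : IsBrownianVec W' P)
    (hX₀W' : IndepFun X₀' (fun (ω : Ω) (t : ℝ≥0) => W' t ω) P)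
    {X₀ : ℕ → Ω → Vec d} {W : ℕ → ℝ≥0 → Ω → Vec d} (hX₀m : ∀ n, Measurable (X₀ n))
    (hlaw : ∀ n, P.map (X₀ n) = P.map X₀') (hX₀i : iIndepFun X₀ P)
    (hW : ∀ n, IsBrownianVec (W n) P)
    (hWi : iIndepFun (fun (n : ℕ) (ω : Ω) (t : ℝ≥0) => W n t ω) P)
    (hX₀W : IndepFun (fun (ω : Ω) (n : ℕ) => X₀ n ω)
      (fun (ω : Ω) (n : ℕ) (t : ℝ≥0) => W n t ω) P) :
    ∃ ξ : ℕ → ℝ → Ω → Vec d, (∀ n t, Measurable (ξ n t)) ∧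
      (∀ n ω, Continuous fun t => ξ n t ω) ∧
      (∀ n, ∀ t ∈ Icc 0 D.T, P.map (ξ n t) = (μ t).1) ∧
      (∀ t, Pairwise fun i j => IndepFun (ξ i t) (ξ j t) P) ∧
      ∀ n, ∀ᵐ ω ∂P, D.FollowerPath μ Y (fun t => ξ n t ω) (X₀ n ω)
        (fun t => √(2 * D.σ) • W n t.toNNReal ω) := by
  have hT := hD.T_nonneg
  have : Nonempty (Icc 0 D.T) := ⟨⟨0, left_mem_Icc.2 hT⟩⟩
  choose z hzm hz using fun n => exists_continuous_modification (hW n) (hX₀m n) D.T √(2 * D.σ)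
  obtain ⟨z', hzm', hz'⟩ := exists_continuous_modification hW' hX₀m' D.T √(2 * D.σ)
  obtain ⟨S, hSc, hS⟩ := hD.exists_followerMap hf.continuous_μ hf.continuous_Y
  have hSt : ∀ t, Continuous fun x => S x t := fun t => by fun_prop
  choose G hG hGS using fun t => exists_measurable_evalDense D.T (hSt t)
  have hed : ∀ {y : Ω → C(Icc 0 D.T, Vec d)}, (∀ t, Measurable fun ω => y ω t) →
      Measurable fun ω => evalDense D.T (y ω) := fun hy => measurable_pi_lambda _ fun k => hy _
  refine ⟨fun n t ω => IccExtend hT (S (z n ω)) t, ?_, ?_, ?_, ?_, ?_⟩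
  · exact fun n t => measurable_comp_of_continuous (hzm n) (hSt _)
  · exact fun n ω => (S (z n ω)).continuous.Icc_extend'
  · intro n t ht
    have h1 : (fun ω => IccExtend hT (S (z n ω)) t) =
        G ⟨t, ht⟩ ∘ fun ω => evalDense D.T (z n ω) := by
      funext ω
      rw [IccExtend_of_mem _ _ ht]
      exact (hGS _ _).symm
    -- Pathwise uniqueness: with the flow `μ` frozen, `X'` is the same functional of its own noise
    -- as `ξ n` is of the noise of the `n`-th particle. Since the noises have equal laws, `ξ n t`
    -- has law `μ t`.
    have h2 : X' t =ᵐ[P] G ⟨t, ht⟩ ∘ fun ω => evalDense D.T (z' ω) := by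
      filter_upwards [h.eq_X, hz'] with ω hω hzω
      have h3 : SolvesIntegralEq D.T (IccExtend hT (S (z' ω))) (X₀' ω) _
          (fun t => √(2 * D.σ) • W' t.toNNReal ω) := (hS (z' ω)).congr_offset fun t ht => by
        rw [IccExtend_of_mem _ _ ht, hzω ⟨t, ht⟩, zero_add]
      have h4 := hD.norm_follower_sub_le hf.continuous_μ hf.continuous_μ hf.continuous_Y
        hf.continuous_Y (h.continuous_X ω) (S (z' ω)).continuous.Icc_extend'.continuousOn hω h3 t ht
      have h5 : ∀ s, flowDist μ μ Y Y s = 0 := fun s => by simp [flowDist, wDist_self]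
      simp only [h5, intervalIntegral.integral_zero, mul_zero, norm_le_zero_iff, sub_eq_zero] at h4
      rw [h4, IccExtend_of_mem _ _ ht]
      exact (hGS _ _).symm
    refine (congrArg (P.map ·) h1).trans ?_
    rw [← h.law_X t ht, Measure.map_congr h2, ← Measure.map_map (hG _) (hed (hzm n)),
      ← Measure.map_map (hG _) (hed hzm'),
      map_evalDense_eq (hz n) hz' (hX₀m n) hX₀m' (hlaw n) (hW n) hW' (hX₀W.comp
        (φ := fun x : ℕ → Vec d => x n) (ψ := fun w : ℕ → ℝ≥0 → Vec d => w n) (by fun_prop)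
        (by fun_prop)) hX₀W']
  · intro t i j hij
    have h1 : ∀ n, (fun ω => IccExtend hT (S (z n ω)) t) =
        G (projIcc 0 D.T hT t) ∘ fun ω => evalDense D.T (z n ω) := fun n => by
      funext ω
      exact (hGS _ _).symm
    simp only [h1]
    exact (indepFun_evalDense hz hX₀m hX₀i hW hWi hX₀W hij).comp (hG _) (hG _)
  · intro n
    filter_upwards [hz n] with ω hω
    refine ⟨(S (z n ω)).continuous.Icc_extend'.continuousOn, ?_⟩
    exact (hS (z n ω)).congr_offset fun t ht => by
      rw [IccExtend_of_mem _ _ ht, hω ⟨t, ht⟩, zero_add]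

end MeanField

namespace MeanField

variable {d ℓ m : ℕ} {D : Data d ℓ m} {κ : ℝ≥0} {Cu : ℝ}

/-! ### Continuity of the cost along trajectories. -/

section Cost

/-- The control cost is continuous and the set of control values is compact. -/
structure Data.CostRegular (D : Data d ℓ m) : Prop where
  lagrangian : D.LagrangianUniformContinuous
  controlCost : Continuous fun q : (Fin m → Matrix (Fin d) (Fin ℓ) ℝ) × (Fin m → Vec ℓ) =>
    D.controlCost q.1 q.2
  isCompact_U : IsCompact D.U

/-- Where the difference is at least `ε`, compactness bounds it from above and keeps `‖y - y'‖` away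
from zero; `C` is the quotient of these bounds. A modulus linear in the distance passes through time
integrals and expectations. -/
lemma exists_abs_sub_le_of_isCompact {α E : Type*} [TopologicalSpace α] [NormedAddCommGroup E]
    {f : α × E → ℝ} (hf : Continuous f) {K : Set α} (hK : IsCompact K) {B : Set E}
    (hB : IsCompact B) {ε : ℝ} (hε : 0 < ε) :
    ∃ C, 0 ≤ C ∧ ∀ x ∈ K, ∀ y ∈ B, ∀ y' ∈ B, |f (x, y) - f (x, y')| ≤ ε + C * ‖y - y'‖ := by
  let F : α × E × E → ℝ := fun q => |f (q.1, q.2.1) - f (q.1, q.2.2)|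
  have hF : Continuous F := by fun_prop
  let K' : Set (α × E × E) := (K ×ˢ B ×ˢ B) ∩ {q | ε ≤ F q}
  have hK' : IsCompact K' := (hK.prod (hB.prod hB)).inter_right (isClosed_le continuous_const hF)
  rcases K'.eq_empty_or_nonempty with he | hne
  · refine ⟨0, le_rfl, fun x hx y hy y' hy' => ?_⟩
    by_contra hcon
    have : (x, y, y') ∈ K' := ⟨⟨hx, hy, hy'⟩, by
      simp only [mem_ofPred_eq, F]; linarith⟩
    rw [he] at this
    exact this
  · have hdist : Continuous fun q : α × E × E => ‖q.2.1 - q.2.2‖ := by fun_prop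
    obtain ⟨q₀, hq₀, hmin⟩ := hK'.exists_isMinOn hne hdist.continuousOn
    obtain ⟨q₁, hq₁, hmax⟩ := hK'.exists_isMaxOn hne hF.continuousOn
    have hpos : 0 < ‖q₀.2.1 - q₀.2.2‖ := by
      rw [norm_pos_iff, sub_ne_zero]
      intro h
      have h1 : ε ≤ F q₀ := hq₀.2
      simp only [F, h, sub_self, abs_zero] at h1
      linarith
    have hF1 : 0 ≤ F q₁ := abs_nonneg _
    refine ⟨F q₁ / ‖q₀.2.1 - q₀.2.2‖, by positivity, fun x hx y hy y' hy' => ?_⟩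
    by_cases h : ε ≤ F (x, y, y')
    · have hmem : (x, y, y') ∈ K' := ⟨⟨hx, hy, hy'⟩, h⟩
      have h1 : F (x, y, y') ≤ F q₁ := hmax hmem
      have h2 : ‖q₀.2.1 - q₀.2.2‖ ≤ ‖y - y'‖ := hmin hmem
      have h3 : F q₁ ≤ F q₁ / ‖q₀.2.1 - q₀.2.2‖ * ‖y - y'‖ := by
        rw [div_mul_eq_mul_div, le_div_iff₀ hpos]
        gcongr
      change F (x, y, y') ≤ _
      linarith
    · have : 0 ≤ F q₁ / ‖q₀.2.1 - q₀.2.2‖ * ‖y - y'‖ := by positivity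
      change F (x, y, y') ≤ _
      linarith

lemma Data.CostRegular.continuousOn_lagrangian (hc : D.CostRegular) {Y : ℝ → Fin m → Vec d}
    {μ : ℝ → WassersteinOne d} (hY : ContinuousOn Y (Icc 0 D.T)) (hμ : ContinuousOn μ (Icc 0 D.T)) :
    ContinuousOn (fun t => D.lagrangian t (Y t) (μ t)) (Icc 0 D.T) := by
  rw [Metric.continuousOn_iff]
  intro t ht ε hε
  obtain ⟨δ, hδ, h⟩ := hc.lagrangian ε hε
  obtain ⟨δ₁, hδ₁, h₁⟩ := Metric.continuousOn_iff.1 hY t ht δ hδ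
  obtain ⟨δ₂, hδ₂, h₂⟩ := Metric.continuousOn_iff.1 hμ t ht δ hδ
  refine ⟨min δ (min δ₁ δ₂), by positivity, fun s hs hst => ?_⟩
  rw [lt_min_iff, lt_min_iff] at hst
  exact h s hs t ht _ _ _ _ hst.1 (h₁ s hs hst.2.1) (h₂ s hs hst.2.2)

/-- The values of the feedback controls. -/
def feedbackBall (D : Data d ℓ m) : Set (Fin m → Vec ℓ) := Metric.closedBall 0 D.M

lemma isCompact_feedbackBall (D : Data d ℓ m) : IsCompact (feedbackBall D) :=
  isCompact_closedBall _ _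

variable {a : Control d ℓ m}

lemma Data.Regular.g_mem_feedbackBall (hD : D.Regular κ Cu) (ha : a ∈ D.admissible)
    (μ : WassersteinOne d) : (fun j => a.g j μ) ∈ feedbackBall D := by
  rw [feedbackBall, mem_closedBall_zero_iff, pi_norm_le_iff_of_nonneg hD.M_nonneg]
  exact fun j => (ha.2 j).1 μ

lemma ae_h_mem (ha : a ∈ D.admissible) :
    ∀ᵐ t ∂(volume.restrict (Icc 0 D.T)), (fun j => a.h j t) ∈ Set.univ.pi fun _ => D.U := by
  filter_upwards [ae_all_iff.2 fun j => (ha.1 j).2] with t ht j _ using ht j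

lemma Data.CostRegular.exists_controlCost_bound (hc : D.CostRegular) :
    ∃ B, 0 ≤ B ∧ ∀ h ∈ Set.univ.pi fun _ : Fin m => D.U, ∀ g ∈ feedbackBall D,
      |D.controlCost h g| ≤ B := by
  obtain ⟨B, hB⟩ := ((isCompact_univ_pi fun _ : Fin m => hc.isCompact_U).prod
    (isCompact_feedbackBall D)).exists_bound_of_continuousOn hc.controlCost.continuousOn
  refine ⟨max B 0, le_max_right _ _, fun h hh g hg => ?_⟩
  exact (hB (h, g) ⟨hh, hg⟩).trans (le_max_left _ _)

lemma aestronglyMeasurable_pi {α ι E : Type*} [Fintype ι] [TopologicalSpace E]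
    [TopologicalSpace.PseudoMetrizableSpace E] [SecondCountableTopology E] [MeasurableSpace α]
    {ν : Measure α} {f : ι → α → E} (hf : ∀ i, AEStronglyMeasurable (f i) ν) :
    AEStronglyMeasurable (fun x i => f i x) ν := by
  borelize E
  choose g hg hfg using hf
  refine ⟨fun x i => g i x,
    (measurable_pi_iff.2 fun i => (hg i).measurable).stronglyMeasurable, ?_⟩
  filter_upwards [ae_all_iff.2 hfg] with x hx
  funext i
  exact hx i

instance {d ℓ : ℕ} : SecondCountableTopology (Matrix (Fin d) (Fin ℓ) ℝ) :=
  inferInstanceAs (SecondCountableTopology (Fin d → Fin ℓ → ℝ))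

instance {d ℓ : ℕ} : TopologicalSpace.PseudoMetrizableSpace (Matrix (Fin d) (Fin ℓ) ℝ) :=
  inferInstanceAs (TopologicalSpace.PseudoMetrizableSpace (Fin d → Fin ℓ → ℝ))

lemma Data.Regular.integrableOn_comp_control (hD : D.Regular κ Cu) (hc : D.CostRegular)
    {Φ : (Fin m → Matrix (Fin d) (Fin ℓ) ℝ) × (Fin m → Vec ℓ) → ℝ} (hΦ : Continuous Φ)
    (ha : a ∈ D.admissible) {μ : ℝ → WassersteinOne d}
    (hμ : ContinuousOn μ (Icc 0 D.T)) :
    IntegrableOn (fun t => Φ (fun j => a.h j t, fun j => a.g j (μ t))) (Icc 0 D.T) := by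
  obtain ⟨B, hB⟩ := ((isCompact_univ_pi fun _ : Fin m => hc.isCompact_U).prod
    (isCompact_feedbackBall D)).exists_bound_of_continuousOn hΦ.continuousOn
  refine Integrable.of_bound (C := B) (hΦ.comp_aestronglyMeasurable
    ((aestronglyMeasurable_pi fun j => (ha.1 j).1).prodMk ?_)) ?_
  · exact (continuousOn_pi.2 fun j =>
      (hD.continuous_g ha j).comp_continuousOn hμ).aestronglyMeasurable measurableSet_Icc
  · filter_upwards [ae_h_mem ha] with t ht
    exact hB _ ⟨ht, hD.g_mem_feedbackBall ha _⟩

lemma Data.Regular.pathCostIntegrable (hD : D.Regular κ Cu) (hc : D.CostRegular)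
    (ha : a ∈ D.admissible) {Y : ℝ → Fin m → Vec d} {μ : ℝ → WassersteinOne d}
    (hY : ContinuousOn Y (Icc 0 D.T)) (hμ : ContinuousOn μ (Icc 0 D.T)) :
    D.PathCostIntegrable a Y μ :=
  ⟨(hc.continuousOn_lagrangian hY hμ).integrableOn_Icc, hD.integrableOn_comp_control hc hc.controlCost ha hμ⟩

lemma abs_integral_sub_integral_le {T K ε : ℝ} (hT : 0 ≤ T) {f g w : ℝ → ℝ}
    (hf : IntegrableOn f (Icc 0 T)) (hg : IntegrableOn g (Icc 0 T)) (hw : ContinuousOn w (Icc 0 T))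
    (h : ∀ᵐ s ∂(volume.restrict (Icc 0 T)), |f s - g s| ≤ ε + K * w s) :
    |(∫ s in (0 : ℝ)..T, f s) - ∫ s in (0 : ℝ)..T, g s| ≤ T * ε + K * ∫ s in (0 : ℝ)..T, w s := by
  have h1 := norm_integral_sub_integral_le_of_lipschitz (K := 1) (t := T) (w := fun s => ε + K * w s)
    (right_mem_Icc.2 hT) hf hg (by fun_prop) (by simpa [Real.norm_eq_abs] using h)
  rw [one_mul, intervalIntegral.integral_add intervalIntegrable_const
    ((intervalIntegrable_of_continuousOn_Icc hw (right_mem_Icc.2 hT)).const_mul K),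
    intervalIntegral.integral_const_mul] at h1
  simpa using h1

lemma Data.Regular.abs_integral_controlCost_le (hD : D.Regular κ Cu) {B : ℝ}
    (hB : ∀ h ∈ Set.univ.pi fun _ : Fin m => D.U, ∀ g ∈ feedbackBall D, |D.controlCost h g| ≤ B)
    {a : Control d ℓ m} (ha : a ∈ D.admissible) (μ : ℝ → WassersteinOne d) :
    |∫ t in (0 : ℝ)..D.T, D.controlCost (fun j => a.h j t) (fun j => a.g j (μ t))| ≤ D.T * B := by
  rw [← Real.norm_eq_abs]
  refine (intervalIntegral.norm_integral_le_of_norm_le (g := fun _ => B) hD.T_nonneg ?_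
    intervalIntegrable_const).trans_eq (by simp)
  filter_upwards [(ae_restrict_iff' measurableSet_Icc).1 (ae_h_mem ha)] with t ht htT
  exact hB _ (ht (Ioc_subset_Icc_self htT)) _ (hD.g_mem_feedbackBall ha _)

/-- The cost depends uniformly continuously on the trajectory, uniformly in the control. -/
lemma Data.Regular.exists_abs_pathCost_sub_le (hD : D.Regular κ Cu) (hc : D.CostRegular)
    {ε : ℝ} (hε : 0 < ε) :
    ∃ C, 0 ≤ C ∧ ∀ a ∈ D.admissible, ∀ (Y Y' : Fin m → ℝ → Vec d) (μ μ' : ℝ → WassersteinOne d),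
      (∀ i, ContinuousOn (Y i) (Icc 0 D.T)) → (∀ i, ContinuousOn (Y' i) (Icc 0 D.T)) →
      ContinuousOn μ (Icc 0 D.T) → ContinuousOn μ' (Icc 0 D.T) →
      |D.pathCost a (fun t i => Y i t) μ - D.pathCost a (fun t i => Y' i t) μ'| ≤
        ε + C * ∫ t in (0 : ℝ)..D.T, flowDist μ μ' Y Y' t := by
  have hT := hD.T_nonneg
  have hL := hD.L_nonneg
  obtain ⟨ε', hε', hεT⟩ : ∃ ε' > 0, D.T * ε' ≤ ε / 2 := by
    refine ⟨ε / (2 * (D.T + 1)), by positivity, ?_⟩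
    rw [mul_div_assoc', div_le_div_iff₀ (by positivity) two_pos]
    nlinarith
  obtain ⟨C₁, hC₁, h₁⟩ := hc.lagrangian.linear_growth hε'
  obtain ⟨C₂, hC₂, h₂⟩ := exists_abs_sub_le_of_isCompact hc.controlCost
    (isCompact_univ_pi fun _ : Fin m => hc.isCompact_U) (isCompact_feedbackBall D) hε'
  refine ⟨C₁ + C₂ * D.L, by positivity, fun a ha Y Y' μ μ' hY hY' hμ hμ' => ?_⟩
  have hρ := continuousOn_flowDist hμ hμ' hY hY'
  have i1 := hD.pathCostIntegrable hc ha (continuousOn_pi.2 hY) hμ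
  have i2 := hD.pathCostIntegrable hc ha (continuousOn_pi.2 hY') hμ'
  have e1 := abs_integral_sub_integral_le hT (K := C₁) (ε := ε') i1.1 i2.1 hρ (by
    filter_upwards [ae_restrict_mem measurableSet_Icc] with t ht
    refine (h₁ t ht t ht _ _ _ _).trans_eq ?_
    rw [sub_self, abs_zero, zero_add, flowDist, dist_eq_norm, add_comm (wDist _ _)])
  have e2 := abs_integral_sub_integral_le hT (K := C₂ * D.L) (ε := ε') i1.2 i2.2 hρ (by
    filter_upwards [ae_h_mem ha] with t ht
    refine (h₂ _ ht _ (hD.g_mem_feedbackBall ha _) _ (hD.g_mem_feedbackBall ha _)).trans ?_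
    rw [mul_assoc]
    have h0 := flowDist_nonneg μ μ' Y Y' t
    gcongr
    rw [pi_norm_le_iff_of_nonneg (by positivity)]
    intro j
    refine ((ha.2 j).2 _ _).trans ?_
    gcongr
    exact wDist_le_flowDist μ μ' Y Y' t)
  unfold pathCost
  rw [add_sub_add_comm]
  refine (abs_add_le _ _).trans ((add_le_add e1 e2).trans ?_)
  linarith

lemma Data.Regular.abs_gap_le (hD : D.Regular κ Cu) {a a' : Control d ℓ m} (ha : a ∈ D.admissible)
    (ha' : a' ∈ D.admissible) {μ : ℝ → WassersteinOne d} (hμ : ContinuousOn μ (Icc 0 D.T)) (i : Fin m)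
    {t : ℝ} (ht : t ∈ Icc 0 D.T) :
    ‖(∫ s in (0 : ℝ)..t, a.u i s (μ s)) - ∫ s in (0 : ℝ)..t, a'.u i s (μ s)‖ ≤
      2 * (Cu * D.M) * D.T := by
  have hCM : 0 ≤ Cu * D.M := mul_nonneg hD.Cu_nonneg hD.M_nonneg
  refine (norm_integral_sub_integral_le_of_lipschitz (K := 2 * (Cu * D.M)) (w := fun _ => 1) ht
    (hD.integrableOn_u ha i hμ) (hD.integrableOn_u ha' i hμ) continuousOn_const ?_).trans ?_
  · filter_upwards [hD.ae_norm_u_le ha i, hD.ae_norm_u_le ha' i] with s hs hs'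
    refine (norm_sub_le _ _).trans ?_
    linarith [hs (μ s), hs' (μ s)]
  · rw [intervalIntegral.integral_const, sub_zero, smul_eq_mul, mul_one]
    gcongr
    exact ht.2

end Cost

/-! ### Well-posedness of the mean-field functional. -/

section MeanFieldFunctional

variable {Ω : Type*} [MeasurableSpace Ω] {P : Measure Ω} [IsProbabilityMeasure P]
  {X₀ : Ω → Vec d} {W : ℝ≥0 → Ω → Vec d} {a : Control d ℓ m}

/-- By stability with zero gap, two solutions have flows at distance zero and hence equal cost. The
value chosen by `Classical.epsilon` is the cost of some solution, therefore of every solution. -/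
lemma Data.Regular.meanFieldWellPosed (hD : D.Regular κ Cu) (hc : D.CostRegular)
    (ha : a ∈ D.admissible) (hX₀ : Measurable X₀) (hX₀i : Integrable X₀ P)
    (hW : IsBrownianVec W P) : D.MeanFieldWellPosed P X₀ W a := by
  obtain ⟨X, μ, Y, h⟩ := hD.exists_meanFieldSolution ha hX₀ hX₀i hW
  have huniq : ∀ {X X' μ μ' Y Y'}, D.IsMeanFieldSolution P X₀ W a X μ Y →
      D.IsMeanFieldSolution P X₀ W a X' μ' Y' →
      D.pathCost a (fun t i => Y i t) μ = D.pathCost a (fun t i => Y' i t) μ' := by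
    intro X X' μ μ' Y Y' h h'
    have hf := h.leaderFlow hD hX₀ hX₀i hW
    have hf' := h'.leaderFlow hD hX₀ hX₀i hW
    have h0 : ∀ t ∈ Icc 0 D.T, flowDist μ μ' Y Y' t = 0 := fun t ht =>
      le_antisymm (by simpa using h.flowDist_le hD ha h' hX₀ hX₀i hW le_rfl (by simp) t ht)
        (flowDist_nonneg _ _ _ _ _)
    refine eq_of_abs_sub_nonpos (le_of_forall_pos_le_add fun ε hε => ?_)
    obtain ⟨C, _, hC⟩ := hD.exists_abs_pathCost_sub_le hc hε
    refine (hC a ha Y Y' μ μ' hf.continuous_Y hf'.continuous_Y hf.continuous_μ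
      hf'.continuous_μ).trans_eq ?_
    have : ∫ t in (0 : ℝ)..D.T, flowDist μ μ' Y Y' t = ∫ t in (0 : ℝ)..D.T, 0 :=
      intervalIntegral.integral_congr fun t ht => h0 t (by rwa [uIcc_of_le hD.T_nonneg] at ht)
    rw [this]; simp
  refine ⟨⟨X, μ, Y, h⟩, fun X' μ' Y' h' => ⟨?_, ?_⟩⟩
  · have hf := h'.leaderFlow hD hX₀ hX₀i hW
    exact hD.pathCostIntegrable hc ha (continuousOn_pi.2 hf.continuous_Y) hf.continuous_μ
  · obtain ⟨X'', μ'', Y'', h'', he⟩ := Classical.epsilon_spec (p := fun c : ℝ => ∃ X μ Y,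
      D.IsMeanFieldSolution P X₀ W a X μ Y ∧ c = D.pathCost a (fun t i => Y i t) μ)
      ⟨_, X, μ, Y, h, rfl⟩
    exact he.trans (huniq h'' h')

end MeanFieldFunctional

end MeanField

namespace MeanField

variable {d ℓ m : ℕ} {D : Data d ℓ m} {κ : ℝ≥0} {Cu : ℝ} {N : ℕ} [NeZero N]

/-! ### Comparison of particles with independent followers. -/

section Comparison

variable {a a' : Control d ℓ m}

/-- Comparison of a system of followers with independent followers of another flow that have the
same noise. -/
lemma Data.Regular.flowDist_empirical_le (hD : D.Regular κ Cu) (ha : a ∈ D.admissible)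
    {x ξ : Fin N → ℝ → Vec d} {μ : ℝ → WassersteinOne d} {Y Y' : Fin m → ℝ → Vec d}
    {x₀ : Fin N → Vec d} {w : Fin N → ℝ → Vec d}
    (hf : D.LeaderFlow a (fun t => empirical fun n => x n t) Y) (hf' : D.LeaderFlow a' μ Y')
    (hx : ∀ n, D.FollowerPath (fun t => empirical fun n => x n t) Y (x n) (x₀ n) (w n))
    (hξ : ∀ n, D.FollowerPath μ Y' (ξ n) (x₀ n) (w n)) {δ : ℝ} (hδ : 0 ≤ δ)
    (hgap : ∀ i, ∀ t ∈ Icc 0 D.T,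
      ‖(∫ s in (0 : ℝ)..t, a.u i s (μ s)) - ∫ s in (0 : ℝ)..t, a'.u i s (μ s)‖ ≤ δ) :
    ∀ t ∈ Icc 0 D.T, flowDist (fun t => empirical fun n => x n t) μ Y Y' t ≤
      wDist (empirical fun n => ξ n t) (μ t) + flowConst D κ Cu *
        (δ + ∫ s in (0 : ℝ)..t, wDist (empirical fun n => ξ n s) (μ s)) := by
  have hξc : ContinuousOn (fun t => empirical fun n => ξ n t) (Icc 0 D.T) :=
    lipschitzWith_empirical.continuous.comp_continuousOn (continuousOn_pi.2 fun n => (hξ n).1)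
  refine hD.flowDist_le ha hf hf' hδ hgap
    (continuous_dist.comp_continuousOn (hξc.prodMk hf'.continuous_μ)) (fun _ => wDist_nonneg _ _)
    fun t ht => ?_
  refine (wDist_triangle _ (empirical fun n => ξ n t) _).trans ?_
  rw [add_comm]
  gcongr
  exact wDist_empirical_le_of_forall fun n => hD.norm_follower_sub_le hf.continuous_μ
    hf'.continuous_μ hf.continuous_Y hf'.continuous_Y (hx n).1 (hξ n).1 (hx n).2 (hξ n).2 t ht

variable {Ω : Type*} [MeasurableSpace Ω] {P : Measure Ω}
  {X₀ : Fin N → Ω → Vec d} {W : Fin N → ℝ≥0 → Ω → Vec d}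
  {X : Fin N → ℝ → Ω → Vec d} {Y : Fin m → ℝ → Ω → Vec d}

lemma stronglyMeasurable_timeIntegral {E : Type*} [NormedAddCommGroup E] [NormedSpace ℝ E] {T : ℝ}
    (hT : 0 ≤ T) {f : ℝ × Ω → E} (hf : StronglyMeasurable f) :
    StronglyMeasurable fun ω => ∫ t in (0 : ℝ)..T, f (t, ω) := by
  simp only [intervalIntegral.integral_of_le hT]
  exact hf.integral_prod_left'

/-- Trajectories are regular only on `[0, T]`, so time is projected onto this interval; `h` is
measurable only up to null sets, so a strongly measurable representative replaces it. Neither change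
affects the time integrals, and the integrands become jointly measurable in `(t, ω)`. -/
lemma Data.IsDiscreteSolution.stronglyMeasurable_discreteCost (hD : D.Regular κ Cu)
    (hc : D.CostRegular) (ha : a ∈ D.admissible) (h : D.IsDiscreteSolution P X₀ W a X Y) :
    StronglyMeasurable (D.discreteCost a X Y) := by
  have hT := hD.T_nonneg
  let x : ℝ → Ω → Fin N → Vec d := fun t ω n => X n (projIcc 0 D.T hT t) ω
  let y : ℝ → Ω → Fin m → Vec d := fun t ω i => Y i (projIcc 0 D.T hT t) ω
  have hproj : Continuous fun t => (projIcc 0 D.T hT t : ℝ) :=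
    continuous_subtype_val.comp continuous_projIcc
  have hproj_eq : ∀ t ∈ Icc 0 D.T, (projIcc 0 D.T hT t : ℝ) = t := fun t ht => by
    rw [projIcc_of_mem hT ht]
  have hxc : ∀ ω, Continuous fun t => x t ω := fun ω => continuous_pi fun n =>
    (h.continuous_X n ω).comp_continuous hproj fun t => (projIcc 0 D.T hT t).2
  have hxm : ∀ t, Measurable (x t) := fun t =>
    measurable_pi_iff.2 fun n => h.measurable_X n _ (projIcc 0 D.T hT t).2
  have hym : ∀ t, Measurable (y t) := fun t =>
    measurable_pi_iff.2 fun i => h.measurable_Y i _ (projIcc 0 D.T hT t).2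
  have hec : Continuous (empirical : (Fin N → Vec d) → WassersteinOne d) :=
    lipschitzWith_empirical.continuous
  -- the Lagrangian
  have hlag : ∀ {τ : ℝ} (_ : τ ∈ Icc 0 D.T), Continuous fun q : (Fin m → Vec d) ×
      (Fin N → Vec d) => D.lagrangian τ q.1 (empirical q.2) := by
    intro τ hτ
    rw [Metric.continuous_iff]
    intro q ε hε
    obtain ⟨δ, hδ, hδ'⟩ := hc.lagrangian ε hε
    refine ⟨δ, hδ, fun r hr => hδ' τ hτ τ hτ _ _ _ _ (by simpa using hδ) ?_ ?_⟩
    · exact (le_max_left _ _).trans_lt hr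
    · have h1 := lipschitzWith_empirical.dist_le_mul r.2 q.2
      rw [NNReal.coe_one, one_mul, dist_eq_wDist] at h1
      exact h1.trans_lt ((le_max_right _ _).trans_lt hr)
  let f : ℝ → Ω → ℝ := fun t ω => D.lagrangian (projIcc 0 D.T hT t) (y t ω) (empirical (x t ω))
  have hfc : ∀ ω, Continuous fun t => f t ω := fun ω =>
    (hc.continuousOn_lagrangian (Y := fun t i => Y i t ω)
      (μ := fun t => empirical fun n => X n t ω)
      (continuousOn_pi.2 fun i => h.continuous_Y i ω)
      (hec.comp_continuousOn (continuousOn_pi.2 fun n => h.continuous_X n ω))).comp_continuous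
      hproj fun t => (projIcc 0 D.T hT t).2
  have hfm : ∀ t, Measurable (f t) := fun t =>
    (hlag (projIcc 0 D.T hT t).2).measurable.comp ((hym t).prodMk (hxm t))
  have hf : StronglyMeasurable (Function.uncurry f) :=
    (measurable_uncurry_of_continuous_of_measurable hfc hfm).stronglyMeasurable
  -- the control cost
  have hh : AEStronglyMeasurable (fun t j => a.h j t) (volume.restrict (Icc 0 D.T)) :=
    aestronglyMeasurable_pi fun j => (ha.1 j).1
  let h' := hh.mk _
  have hg : Continuous fun q : Fin N → Vec d => fun j => a.g j (empirical q) :=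
    continuous_pi fun j => (hD.continuous_g ha j).comp hec
  have hgm : StronglyMeasurable (Function.uncurry fun t ω => fun j => a.g j (empirical (x t ω))) :=
    (measurable_uncurry_of_continuous_of_measurable (fun ω => hg.comp (hxc ω))
      fun t => hg.measurable.comp (hxm t)).stronglyMeasurable
  have hF : StronglyMeasurable fun q : ℝ × Ω =>
      D.controlCost (h' q.1) (fun j => a.g j (empirical (x q.1 q.2))) :=
    hc.controlCost.comp_stronglyMeasurable
      ((hh.stronglyMeasurable_mk.comp_measurable measurable_fst).prodMk hgm)
  convert (stronglyMeasurable_timeIntegral hT hf).add (stronglyMeasurable_timeIntegral hT hF)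
    using 1
  funext ω
  refine congrArg₂ (· + ·) (intervalIntegral.integral_congr fun t ht => ?_)
    (intervalIntegral.integral_congr_ae ?_)
  · rw [uIcc_of_le hT] at ht
    simp only [Function.uncurry, f, x, y, hproj_eq t ht]
  · have := (ae_restrict_iff' measurableSet_Icc).1 hh.ae_eq_mk
    filter_upwards [this] with t ht htT
    rw [uIoc_of_le hT] at htT
    have htI := Ioc_subset_Icc_self htT
    have e : h' t = fun j => a.h j t := (ht htI).symm
    simp only [e, x, hproj_eq t htI]

/-- The product coupling bounds the distance by first moments; no independence is involved. -/
lemma integrable_wDist_empirical [IsProbabilityMeasure P] {ξ : Fin N → Ω → Vec d}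
    {μ : WassersteinOne d} (hξ : ∀ n, Measurable (ξ n)) (hlaw : ∀ n, P.map (ξ n) = μ.1) :
    Integrable (fun ω => wDist (empirical fun n => ξ n ω) μ) P ∧
      ∫ ω, wDist (empirical fun n => ξ n ω) μ ∂P ≤ 2 * moment μ := by
  have hi : ∀ n, Integrable (fun ω => ‖ξ n ω‖) P := fun n =>
    Integrable.norm ((integrable_map_measure aestronglyMeasurable_id (hξ n).aemeasurable).1
      (by rw [hlaw n]; exact μ.integrable_id))
  have hm : ∀ n, ∫ ω, ‖ξ n ω‖ ∂P = moment μ := fun n => by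
    rw [moment, ← hlaw n, integral_map (hξ n).aemeasurable (by fun_prop)]
  have hb : ∀ ω, wDist (empirical fun n => ξ n ω) μ ≤ (N : ℝ)⁻¹ * ∑ n, ‖ξ n ω‖ + moment μ :=
    fun ω => (wDist_le_moment_add _ _).trans_eq (by rw [moment, integral_empirical, smul_eq_mul])
  have hs : Integrable (fun ω => (N : ℝ)⁻¹ * ∑ n, ‖ξ n ω‖) P :=
    (integrable_finsetSum _ fun n _ => hi n).const_mul _
  have hI : Integrable (fun ω => wDist (empirical fun n => ξ n ω) μ) P :=
    (hs.add (integrable_const (moment μ))).mono'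
      (measurable_wDist_empirical hξ μ).aestronglyMeasurable
      (ae_of_all _ fun ω => by rw [Real.norm_of_nonneg (wDist_nonneg _ _)]; exact hb ω)
  refine ⟨hI, (integral_mono hI (hs.add (integrable_const (moment μ))) hb).trans_eq ?_⟩
  have hN : (N : ℝ) ≠ 0 := by exact_mod_cast NeZero.ne N
  rw [integral_add' hs (integrable_const _), integral_const_mul,
    integral_finsetSum _ fun n _ => hi n]
  simp only [hm, Finset.sum_const, Finset.card_univ, Fintype.card_fin, nsmul_eq_mul,
    integral_const, probReal_univ, one_smul]
  field_simp
  ring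

end Comparison

/-! ### The particle functional against the mean-field functional. -/

section DiscreteFunctional

variable {Ω : Type*} [MeasurableSpace Ω] {P : Measure Ω} [IsProbabilityMeasure P]

/-- The noise of the followers: independent initial positions and Brownian motions, and another
copy for the mean-field system. -/
structure IsFollowerNoise (P : Measure Ω) (X₀ : ℕ → Ω → Vec d) (W : ℕ → ℝ≥0 → Ω → Vec d)
    (X₀' : Ω → Vec d) (W' : ℝ≥0 → Ω → Vec d) : Prop where
  measurable : ∀ n, Measurable (X₀ n)
  map_eq : ∀ n, P.map (X₀ n) = P.map X₀'
  indep_init : iIndepFun X₀ P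
  brownian : ∀ n, IsBrownianVec (W n) P
  indep_brownian : iIndepFun (fun (n : ℕ) (ω : Ω) (t : ℝ≥0) => W n t ω) P
  indep : IndepFun (fun (ω : Ω) (n : ℕ) => X₀ n ω) (fun (ω : Ω) (n : ℕ) (t : ℝ≥0) => W n t ω) P
  measurable' : Measurable X₀'
  integrable' : Integrable X₀' P
  brownian' : IsBrownianVec W' P
  indep' : IndepFun X₀' (fun (ω : Ω) (t : ℝ≥0) => W' t ω) P

/-- `β` bounds the expected distance of empirical measures of `N` samples from `μ`. -/
def SampleBound (P : Measure Ω) (N : ℕ) [NeZero N] (μ : WassersteinOne d) (β : ℝ) : Prop :=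
  ∀ ξ : Fin N → Ω → Vec d, (∀ n, Measurable (ξ n)) → (∀ n, P.map (ξ n) = μ.1) →
    (Pairwise fun i j => IndepFun (ξ i) (ξ j) P) → ∫ ω, wDist (empirical fun n => ξ n ω) μ ∂P ≤ β

variable {X₀ : ℕ → Ω → Vec d} {W : ℕ → ℝ≥0 → Ω → Vec d} {X₀' : Ω → Vec d}
  {W' : ℝ≥0 → Ω → Vec d}

/-- The expected cost of the system of `N` followers is close to the cost of the mean-field system
if empirical measures are close to the law of the samples. -/
lemma Data.Regular.exists_discreteCost_sub_le (hD : D.Regular κ Cu) (hc : D.CostRegular)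
    (hn : IsFollowerNoise P X₀ W X₀' W') {ε : ℝ} (hε : 0 < ε) :
    ∃ C, 0 ≤ C ∧ ∀ (N : ℕ) [NeZero N], ∀ a ∈ D.admissible, ∀ X' μ Y',
      D.IsMeanFieldSolution P X₀' W' a X' μ Y' → ∀ X Y,
      D.IsDiscreteSolution P (fun n : Fin N => X₀ n) (fun n : Fin N => W n) a X Y →
      Integrable (D.discreteCost a X Y) P ∧
        ∀ β, (∀ t ∈ Icc 0 D.T, SampleBound P N (μ t) β) →
          |∫ ω, D.discreteCost a X Y ω ∂P - D.pathCost a (fun t i => Y' i t) μ| ≤ ε + C * β := by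
  have hT := hD.T_nonneg
  have hF := hD.one_le_flowConst
  obtain ⟨C, hC, hcost⟩ := hD.exists_abs_pathCost_sub_le hc hε
  refine ⟨C * ((1 + flowConst D κ Cu * D.T) * D.T), by positivity,
    fun N _ a ha X' μ Y' h' X Y h => ?_⟩
  have hf' := h'.leaderFlow hD hn.measurable' hn.integrable' hn.brownian'
  -- The copies `ξ` have the noises of the particles but interact with `μ`; the distance of their
  -- empirical measure from `μ` is the external error in the stability estimate.
  obtain ⟨ξ, hξm, hξc, hξlaw, hξi, hξ⟩ := h'.exists_copies hD hf' hn.measurable' hn.brownian'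
    hn.indep' hn.measurable hn.map_eq hn.indep_init hn.brownian hn.indep_brownian hn.indep
  have hec : Continuous (empirical : (Fin N → Vec d) → WassersteinOne d) :=
    lipschitzWith_empirical.continuous
  let τ : ℝ → ℝ := fun t => projIcc 0 D.T hT t
  have hτc : Continuous τ := continuous_subtype_val.comp continuous_projIcc
  have hτ : ∀ t, τ t ∈ Icc 0 D.T := fun t => (projIcc 0 D.T hT t).2
  have hτ_eq : ∀ t ∈ Icc 0 D.T, τ t = t := fun t ht => by
    simp only [τ, projIcc_of_mem hT ht]
  let r : ℝ → Ω → ℝ := fun t ω => wDist (empirical fun n : Fin N => ξ n (τ t) ω) (μ (τ t))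
  have hrc : ∀ ω, Continuous fun t => r t ω := fun ω => by
    have h1 : Continuous fun t => empirical fun n : Fin N => ξ n (τ t) ω :=
      hec.comp (continuous_pi fun n => (hξc n ω).comp hτc)
    have h2 : Continuous fun t => μ (τ t) := hf'.continuous_μ.comp_continuous hτc hτ
    exact h1.dist h2
  have hrm : ∀ t, Measurable (r t) := fun t => measurable_wDist_empirical (fun n => hξm n _) _
  have hlaw : ∀ t (n : Fin N), P.map (ξ n (τ t)) = (μ (τ t)).1 := fun t n => hξlaw n _ (hτ t)
  have hri : ∀ t, Integrable (r t) P := fun t =>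
    (integrable_wDist_empirical (fun n => hξm n _) (hlaw t)).1
  have hr0 : ∀ t ω, 0 ≤ r t ω := fun t ω => wDist_nonneg _ _
  have hrb : ∀ β, (∀ t ∈ Icc 0 D.T, SampleBound P N (μ t) β) → ∀ t, ∫ ω, ‖r t ω‖ ∂P ≤ β := by
    intro β hβ t
    simp only [Real.norm_of_nonneg (hr0 t _)]
    exact hβ _ (hτ t) _ (fun n => hξm n _) (hlaw t)
      fun i j hij => hξi _ (by simpa [Fin.val_inj] using hij)
  -- Integrability of the cost has to hold before any `β` is given, so a crude sample bound is taken
  -- from the moments of `μ`.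
  obtain ⟨B, hB⟩ : ∃ B, ∀ t ∈ Icc 0 D.T, moment (μ t) ≤ B := by
    obtain ⟨B, hB⟩ := isCompact_Icc.bddAbove_image
      (continuous_moment.comp_continuousOn hf'.continuous_μ)
    exact ⟨B, fun t ht => hB ⟨t, ht, rfl⟩⟩
  have hB' : ∀ t ∈ Icc 0 D.T, SampleBound P N (μ t) (2 * B) := fun t ht ζ hζ hζ' _ =>
    (integrable_wDist_empirical hζ hζ').2.trans (by linarith [hB t ht])
  let R : Ω → ℝ := fun ω => ∫ t in (0 : ℝ)..D.T, r t ω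
  have hRi : Integrable R P := integrable_timeIntegral hT hrc hrm hri (hrb _ hB')
  have hae : ∀ᵐ ω ∂P, |D.discreteCost a X Y ω - D.pathCost a (fun t i => Y' i t) μ| ≤
      ε + C * (1 + flowConst D κ Cu * D.T) * R ω := by
    filter_upwards [h.ae_paths, ae_all_iff.2 hξ] with ω hω hξω
    have hρ := hD.flowDist_empirical_le ha hω.1 hf' hω.2 (fun n => hξω n) le_rfl (by simp)
    refine (hcost a ha _ _ _ _ hω.1.continuous_Y hf'.continuous_Y hω.1.continuous_μ
      hf'.continuous_μ).trans ?_
    rw [mul_assoc]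
    gcongr
    have hrI : ContinuousOn (fun t => r t ω) (Icc 0 D.T) := (hrc ω).continuousOn
    have hRω : ∀ t ∈ Icc 0 D.T, (∫ s in (0 : ℝ)..t,
        wDist (empirical fun n : Fin N => ξ n s ω) (μ s)) = ∫ s in (0 : ℝ)..t, r s ω := by
      intro t ht
      refine intervalIntegral.integral_congr fun s hs => ?_
      rw [uIcc_of_le ht.1] at hs
      simp only [r, hτ_eq s ⟨hs.1, hs.2.trans ht.2⟩]
    calc ∫ t in (0 : ℝ)..D.T, flowDist (fun t => empirical fun n => X n t ω) μ
          (fun i t => Y i t ω) Y' t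
        ≤ ∫ t in (0 : ℝ)..D.T, (r t ω + flowConst D κ Cu * R ω) := by
          refine intervalIntegral.integral_mono_on hT
            (intervalIntegrable_of_continuousOn_Icc (continuousOn_flowDist hω.1.continuous_μ
              hf'.continuous_μ hω.1.continuous_Y hf'.continuous_Y) (right_mem_Icc.2 hT))
            (((hrc ω).add continuous_const).intervalIntegrable _ _) fun t ht => ?_
          refine (hρ t ht).trans ?_
          rw [zero_add, hRω t ht]
          have h1 : wDist (empirical fun n : Fin N => ξ n t ω) (μ t) = r t ω := by
            simp only [r, hτ_eq t ht]
          rw [h1]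
          gcongr
          exact integral_mono_upper hrI (fun s => hr0 s ω) ht.1 ht.2 le_rfl
      _ = (1 + flowConst D κ Cu * D.T) * R ω := by
          rw [intervalIntegral.integral_add ((hrc ω).intervalIntegrable _ _)
            intervalIntegrable_const, intervalIntegral.integral_const, sub_zero, smul_eq_mul]
          ring
  have hbound : Integrable (fun ω => ε + C * (1 + flowConst D κ Cu * D.T) * R ω) P :=
    (integrable_const _).add (hRi.const_mul _)
  have hcm := (h.stronglyMeasurable_discreteCost hD hc ha).aestronglyMeasurable (μ := P)
  have hdiff : Integrable (fun ω => D.discreteCost a X Y ω - D.pathCost a (fun t i => Y' i t) μ) P :=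
    hbound.mono' (hcm.sub aestronglyMeasurable_const) hae
  have hI : Integrable (D.discreteCost a X Y) P := by
    refine (hdiff.add (integrable_const (D.pathCost a (fun t i => Y' i t) μ))).congr
      (ae_of_all _ fun ω => ?_)
    simp only [Pi.add_apply, sub_add_cancel]
  refine ⟨hI, fun β hβ => ?_⟩
  have e1 : ∫ ω, D.discreteCost a X Y ω ∂P - D.pathCost a (fun t i => Y' i t) μ =
      ∫ ω, (D.discreteCost a X Y ω - D.pathCost a (fun t i => Y' i t) μ) ∂P := by
    rw [integral_sub hI (integrable_const _)]; simp
  rw [e1]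
  rw [← Real.norm_eq_abs]
  refine (norm_integral_le_of_norm_le (f := fun ω => D.discreteCost a X Y ω -
    D.pathCost a (fun t i => Y' i t) μ) hbound hae).trans ?_
  have h2 := integral_timeIntegral hT hrc hrm hri (hrb β hβ)
  rw [integral_add (integrable_const _) (hRi.const_mul _), integral_const_mul]
  simp only [integral_const, probReal_univ, one_smul]
  calc ε + C * (1 + flowConst D κ Cu * D.T) * ∫ ω, R ω ∂P
      ≤ ε + C * (1 + flowConst D κ Cu * D.T) * (D.T * β) := by gcongr
    _ = _ := by ring

/-- For uniqueness, a second particle system takes the role of the independent followers: its flow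
is its own empirical measure, so there is no sampling error. The mean-field solution serves only to
bound the cost for integrability. -/
lemma Data.Regular.discreteWellPosed (hD : D.Regular κ Cu) (hc : D.CostRegular)
    (hn : IsFollowerNoise P X₀ W X₀' W') {a : Control d ℓ m} (ha : a ∈ D.admissible) :
    D.DiscreteWellPosed P (fun n : Fin N => X₀ n) (fun n : Fin N => W n) a := by
  have hT := hD.T_nonneg
  obtain ⟨X, Y, h⟩ := hD.exists_discreteSolution (P := P) ha
    (X₀ := fun n : Fin N => X₀ n) (W := fun n : Fin N => W n)
    (fun n => hn.measurable n) (fun n => hn.brownian n)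
  obtain ⟨X', μ', Y', h'⟩ := hD.exists_meanFieldSolution ha hn.measurable' hn.integrable'
    hn.brownian'
  have huniq : ∀ {X X' Y Y'},
      D.IsDiscreteSolution P (fun n : Fin N => X₀ n) (fun n : Fin N => W n) a X Y →
      D.IsDiscreteSolution P (fun n : Fin N => X₀ n) (fun n : Fin N => W n) a X' Y' →
      ∫ ω, D.discreteCost a X Y ω ∂P = ∫ ω, D.discreteCost a X' Y' ω ∂P := by
    intro X X' Y Y' h h'
    refine integral_congr_ae ?_
    filter_upwards [h.ae_paths, h'.ae_paths] with ω hω hω'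
    have h0 := hD.flowDist_empirical_le ha hω.1 hω'.1 hω.2 hω'.2 le_rfl (by simp)
    refine eq_of_abs_sub_nonpos (le_of_forall_pos_le_add fun ε hε => ?_)
    obtain ⟨C, _, hC⟩ := hD.exists_abs_pathCost_sub_le hc hε
    refine (hC a ha _ _ _ _ hω.1.continuous_Y hω'.1.continuous_Y hω.1.continuous_μ
      hω'.1.continuous_μ).trans_eq ?_
    have : ∫ t in (0 : ℝ)..D.T, flowDist (fun t => empirical fun n => X n t ω)
        (fun t => empirical fun n => X' n t ω) (fun i t => Y i t ω) (fun i t => Y' i t ω) t =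
        ∫ t in (0 : ℝ)..D.T, 0 := by
      refine intervalIntegral.integral_congr fun t ht => ?_
      rw [uIcc_of_le hD.T_nonneg] at ht
      exact le_antisymm (by simpa [wDist_self] using h0 t ht) (flowDist_nonneg _ _ _ _ _)
    rw [this]; simp
  refine ⟨⟨X, Y, h⟩, fun X₁ Y₁ h₁ => ⟨?_, ?_, ?_⟩⟩
  · filter_upwards [h₁.ae_paths] with ω hω
    exact hD.pathCostIntegrable hc ha (continuousOn_pi.2 hω.1.continuous_Y) hω.1.continuous_μ
  · obtain ⟨C, _, hC⟩ := hD.exists_discreteCost_sub_le hc hn one_pos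
    exact (hC N a ha X' μ' Y' h' X₁ Y₁ h₁).1
  · obtain ⟨X'', Y'', h'', he⟩ := Classical.epsilon_spec (p := fun c : ℝ => ∃ X Y,
      D.IsDiscreteSolution P (fun n : Fin N => X₀ n) (fun n : Fin N => W n) a X Y ∧
        c = ∫ ω, D.discreteCost a X Y ω ∂P) ⟨_, X, Y, h, rfl⟩
    exact he.trans (huniq h'' h₁)

end DiscreteFunctional

end MeanField

namespace MeanField

/-! ### Tails of first moments. -/

section UniformIntegrability

variable {d : ℕ}

/-- The mass of the tail of a measure. -/
noncomputable def excess (μ : WassersteinOne d) (R : ℝ) : ℝ := ∫ x, max (‖x‖ - R) 0 ∂μ.1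

lemma abs_excess_sub_le (μ ν : WassersteinOne d) (R : ℝ) :
    |excess μ R - excess ν R| ≤ wDist μ ν := by
  have h : LipschitzWith 1 fun x : Vec d => max (‖x‖ - R) 0 := by
    refine LipschitzWith.of_dist_le_mul fun x y => ?_
    rw [NNReal.coe_one, one_mul, Real.dist_eq, dist_eq_norm]
    refine (abs_max_sub_max_le_abs _ _ _).trans ?_
    rw [sub_sub_sub_cancel_right]
    exact abs_norm_sub_norm_le x y
  simpa [excess] using norm_integral_sub_integral_le h μ ν

lemma excess_antitone (μ : WassersteinOne d) : Antitone (excess μ) := fun R R' hR =>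
  integral_mono (μ.integrable_excess R') (μ.integrable_excess R) fun x => by
    simp only; gcongr

lemma tendsto_excess (μ : WassersteinOne d) :
    Tendsto (fun n : ℕ => excess μ n) atTop (𝓝 0) := by
  have h := tendsto_integral_of_dominated_convergence (μ := μ.1) (fun x : Vec d => ‖x‖)
    (F := fun (n : ℕ) (x : Vec d) => max (‖x‖ - n) 0) (f := fun _ => 0)
    (fun n => by fun_prop) μ.integrable_id.norm (fun n => ae_of_all _ fun x => ?_)
    (ae_of_all _ fun x => ?_)
  · simpa [excess] using h
  · rw [Real.norm_of_nonneg (le_max_right _ _)]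
    exact max_le (by simp) (norm_nonneg _)
  · obtain ⟨k, hk⟩ := exists_nat_ge ‖x‖
    refine tendsto_const_nhds.congr' ?_
    filter_upwards [eventually_ge_atTop k] with n hn
    have : (k : ℝ) ≤ n := by exact_mod_cast hn
    exact (max_eq_right (by linarith)).symm

/-- A compact set in `𝒲₁` is uniformly integrable. -/
lemma exists_excess_le {K : Set (WassersteinOne d)} (hK : IsCompact K) {ε : ℝ} (hε : 0 < ε) :
    ∃ R, ∀ μ ∈ K, excess μ R ≤ ε := by
  refine hK.induction_on (p := fun s => ∃ R, ∀ μ ∈ s, excess μ R ≤ ε) ⟨0, by simp⟩ ?_ ?_ ?_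
  · rintro s t hst ⟨R, hR⟩
    exact ⟨R, fun μ hμ => hR μ (hst hμ)⟩
  · rintro s t ⟨R, hR⟩ ⟨R', hR'⟩
    refine ⟨max R R', fun μ hμ => ?_⟩
    rcases hμ with hμ | hμ
    · exact (excess_antitone μ (le_max_left _ _)).trans (hR μ hμ)
    · exact (excess_antitone μ (le_max_right _ _)).trans (hR' μ hμ)
  · intro μ _
    obtain ⟨n, hn⟩ := ((tendsto_excess μ).eventually (gt_mem_nhds (half_pos hε))).exists
    refine ⟨Metric.ball μ (ε / 2), mem_nhdsWithin_of_mem_nhds (Metric.ball_mem_nhds _ (half_pos hε)),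
      n, fun ν hν => ?_⟩
    have h1 : wDist ν μ < ε / 2 := hν
    have h2 := (abs_le.1 (abs_excess_sub_le ν μ n)).2
    linarith

end UniformIntegrability

/-! ### Bounds uniform in the controls. -/

section Uniformity

variable {d ℓ m : ℕ} {D : Data d ℓ m} {κ : ℝ≥0} {Cu : ℝ}
  {Ω : Type*} [MeasurableSpace Ω] {P : Measure Ω} [IsProbabilityMeasure P]

/-- The distance of two mean-field flows, uniformly in the controls. -/
noncomputable def flowDiam (D : Data d ℓ m) (κ : ℝ≥0) (Cu : ℝ) : ℝ :=
  flowConst D κ Cu * (2 * (Cu * D.M) * D.T)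

lemma Data.Regular.flowDiam_nonneg (hD : D.Regular κ Cu) : 0 ≤ flowDiam D κ Cu := by
  have := hD.one_le_flowConst
  have := hD.Cu_nonneg
  have := hD.M_nonneg
  have := hD.T_nonneg
  unfold flowDiam; positivity

variable {X₀ : Ω → Vec d} {W : ℝ≥0 → Ω → Vec d} {a a' : Control d ℓ m}
  {X X' : ℝ → Ω → Vec d} {μ μ' : ℝ → WassersteinOne d} {Y Y' : Fin m → ℝ → Vec d}

lemma Data.IsMeanFieldSolution.flowDist_le_flowDiam (hD : D.Regular κ Cu)
    (h : D.IsMeanFieldSolution P X₀ W a X μ Y) (h' : D.IsMeanFieldSolution P X₀ W a' X' μ' Y')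
    (ha : a ∈ D.admissible) (ha' : a' ∈ D.admissible)
    (hX₀ : Measurable X₀) (hX₀i : Integrable X₀ P) (hW : IsBrownianVec W P) :
    ∀ t ∈ Icc 0 D.T, flowDist μ μ' Y Y' t ≤ flowDiam D κ Cu := by
  have hf' := h'.leaderFlow hD hX₀ hX₀i hW
  have := hD.Cu_nonneg
  have := hD.M_nonneg
  have := hD.T_nonneg
  exact h.flowDist_le hD ha h' hX₀ hX₀i hW (δ := 2 * (Cu * D.M) * D.T) (by positivity)
    fun i t ht => hD.abs_gap_le ha ha' hf'.continuous_μ i ht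

/-- Followers with the same noise differ by at most a deterministic constant, whatever the controls.
Shifting the threshold by this constant transfers a tail bound from one control to all. -/
lemma Data.IsMeanFieldSolution.excess_le (hD : D.Regular κ Cu)
    (h : D.IsMeanFieldSolution P X₀ W a X μ Y) (h' : D.IsMeanFieldSolution P X₀ W a' X' μ' Y')
    (ha : a ∈ D.admissible) (ha' : a' ∈ D.admissible)
    (hX₀ : Measurable X₀) (hX₀i : Integrable X₀ P) (hW : IsBrownianVec W P) {t : ℝ}
    (ht : t ∈ Icc 0 D.T) (R : ℝ) :
    excess (μ t) (R + followerConst D.T κ * (D.T * flowDiam D κ Cu)) ≤ excess (μ' t) R := by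
  have hf := h.leaderFlow hD hX₀ hX₀i hW
  have hf' := h'.leaderFlow hD hX₀ hX₀i hW
  have hT := hD.T_nonneg
  have hC := followerConst_nonneg hT κ
  set c := followerConst D.T κ * (D.T * flowDiam D κ Cu)
  have hae : ∀ᵐ ω ∂P, ‖X t ω‖ ≤ ‖X' t ω‖ + c := by
    filter_upwards [h.eq_X, h'.eq_X] with ω hω hω'
    have h1 := hD.norm_follower_sub_le hf.continuous_μ hf'.continuous_μ hf.continuous_Y
        hf'.continuous_Y (h.continuous_X ω) (h'.continuous_X ω) hω hω' t ht
    have h2 : ∫ s in (0 : ℝ)..t, flowDist μ μ' Y Y' s ≤ D.T * flowDiam D κ Cu := by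
      have hρ := continuousOn_flowDist hf.continuous_μ hf'.continuous_μ hf.continuous_Y
        hf'.continuous_Y
      refine (integral_mono_upper hρ (flowDist_nonneg _ _ _ _) ht.1 ht.2 le_rfl).trans ?_
      refine (intervalIntegral.integral_mono_on hT
        (intervalIntegrable_of_continuousOn_Icc hρ (right_mem_Icc.2 hT))
        intervalIntegrable_const
        (h.flowDist_le_flowDiam hD h' ha ha' hX₀ hX₀i hW)).trans_eq ?_
      simp
    have h3 : ‖X t ω‖ ≤ ‖X' t ω‖ + ‖X t ω - X' t ω‖ := by
      have := norm_add_le (X' t ω) (X t ω - X' t ω)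
      simpa using this
    exact h3.trans (add_le_add_right (h1.trans (mul_le_mul_of_nonneg_left h2 hC)) _)
  have e : ∀ {X : ℝ → Ω → Vec d} {μ : ℝ → WassersteinOne d}, Measurable (X t) →
      P.map (X t) = (μ t).1 → ∀ R, excess (μ t) R = ∫ ω, max (‖X t ω‖ - R) 0 ∂P ∧
        Integrable (fun ω => max (‖X t ω‖ - R) 0) P := by
    intro X μ hX hμ R
    have hi := (μ t).integrable_excess R
    rw [← hμ, integrable_map_measure (by fun_prop) hX.aemeasurable] at hi
    refine ⟨?_, hi⟩
    rw [excess, ← hμ, integral_map hX.aemeasurable (by fun_prop)]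
  obtain ⟨e1, i1⟩ := e (h.measurable_X t ht) (h.law_X t ht) (R + c)
  obtain ⟨e2, i2⟩ := e (h'.measurable_X t ht) (h'.law_X t ht) R
  rw [e1, e2]
  refine integral_mono_ae i1 i2 ?_
  filter_upwards [hae] with ω hω
  exact max_le_max (by linarith) le_rfl

/-- Empirical measures are close to the laws of the mean-field system, uniformly in the control. -/
lemma Data.Regular.exists_sampleBound (hD : D.Regular κ Cu) (hX₀ : Measurable X₀)
    (hX₀i : Integrable X₀ P) (hW : IsBrownianVec W P) {ε : ℝ} (hε : 0 < ε) :
    ∃ N₀ : ℕ, ∀ (N : ℕ) [NeZero N], N₀ ≤ N → ∀ a ∈ D.admissible, ∀ X μ Y,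
      D.IsMeanFieldSolution P X₀ W a X μ Y → ∀ t ∈ Icc 0 D.T, SampleBound P N (μ t) ε := by
  rcases D.admissible.eq_empty_or_nonempty with he | ⟨a₀, ha₀⟩
  · exact ⟨0, fun N _ _ a ha => by simp [he] at ha⟩
  obtain ⟨X', μ', Y', h'⟩ := hD.exists_meanFieldSolution ha₀ hX₀ hX₀i hW
  have hf' := h'.leaderFlow hD hX₀ hX₀i hW
  obtain ⟨R, hR⟩ := exists_excess_le (isCompact_Icc.image_of_continuousOn hf'.continuous_μ)
    (show 0 < ε / 5 by positivity)
  -- The law of large numbers contributes `3 * (ε / 5)` and the tails `2 * (ε / 5)`.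
  obtain ⟨N₀, hN₀⟩ := integral_wDist_empirical_le (d := d) P
    (R + followerConst D.T κ * (D.T * flowDiam D κ Cu)) (show 0 < ε / 5 by positivity)
  refine ⟨N₀, fun N _ hN a ha X μ Y h t ht ξ hξ hlaw hind => ?_⟩
  refine (hN₀ N hN ξ (μ t) hξ hlaw hind).trans ?_
  have h1 := h.excess_le hD h' ha ha₀ hX₀ hX₀i hW ht R
  have h2 := hR _ (mem_image_of_mem μ' ht)
  unfold excess at h1 h2
  linarith

/-- Valid for every `N`, not only for large ones, this bound makes each discrete functional bounded.
-/
lemma Data.Regular.exists_forall_sampleBound (hD : D.Regular κ Cu) (hX₀ : Measurable X₀)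
    (hX₀i : Integrable X₀ P) (hW : IsBrownianVec W P) :
    ∃ β, ∀ (N : ℕ) [NeZero N], ∀ a ∈ D.admissible, ∀ X μ Y,
      D.IsMeanFieldSolution P X₀ W a X μ Y → ∀ t ∈ Icc 0 D.T, SampleBound P N (μ t) β := by
  rcases D.admissible.eq_empty_or_nonempty with he | ⟨a₀, ha₀⟩
  · exact ⟨0, fun N _ a ha => by simp [he] at ha⟩
  obtain ⟨X', μ', Y', h'⟩ := hD.exists_meanFieldSolution ha₀ hX₀ hX₀i hW
  have hf' := h'.leaderFlow hD hX₀ hX₀i hW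
  obtain ⟨B, hB⟩ := isCompact_Icc.bddAbove_image
    (continuous_moment.comp_continuousOn hf'.continuous_μ)
  refine ⟨2 * (B + flowDiam D κ Cu), fun N _ a ha X μ Y h t ht ξ hξ hlaw _ => ?_⟩
  refine (integrable_wDist_empirical hξ hlaw).2.trans ?_
  have h1 := h.flowDist_le_flowDiam hD h' ha ha₀ hX₀ hX₀i hW t ht
  have h2 := wDist_le_flowDist μ μ' Y Y' t
  have h3 := (abs_le.1 (abs_moment_sub_le (μ t) (μ' t))).2
  have h4 : moment (μ' t) ≤ B := hB ⟨t, ht, rfl⟩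
  linarith

/-- Every trajectory is compared with that of one reference control `a₀`. Along the latter the
Lagrangian part is a fixed number and the control cost is bounded by compactness. -/
lemma Data.Regular.exists_abs_meanFieldFunctional_le (hD : D.Regular κ Cu) (hc : D.CostRegular)
    (hX₀ : Measurable X₀) (hX₀i : Integrable X₀ P) (hW : IsBrownianVec W P) :
    ∃ B, ∀ a ∈ D.admissible, |D.meanFieldFunctional P X₀ W a| ≤ B := by
  have hT := hD.T_nonneg
  rcases D.admissible.eq_empty_or_nonempty with he | ⟨a₀, ha₀⟩
  · exact ⟨0, fun a ha => by simp [he] at ha⟩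
  obtain ⟨X', μ', Y', h'⟩ := hD.exists_meanFieldSolution ha₀ hX₀ hX₀i hW
  have hf' := h'.leaderFlow hD hX₀ hX₀i hW
  obtain ⟨C, hC, hcost⟩ := hD.exists_abs_pathCost_sub_le hc one_pos
  obtain ⟨B, hB, hΨ⟩ := hc.exists_controlCost_bound
  refine ⟨1 + C * (D.T * flowDiam D κ Cu) +
    (|∫ t in (0 : ℝ)..D.T, D.lagrangian t (fun i => Y' i t) (μ' t)| + D.T * B), fun a ha => ?_⟩
  obtain ⟨⟨X, μ, Y, h⟩, hval⟩ := hD.meanFieldWellPosed hc ha hX₀ hX₀i hW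
  have hf := h.leaderFlow hD hX₀ hX₀i hW
  rw [(hval X μ Y h).2]
  have h1 := hcost a ha Y Y' μ μ' hf.continuous_Y hf'.continuous_Y hf.continuous_μ
    hf'.continuous_μ
  have h2 : ∫ s in (0 : ℝ)..D.T, flowDist μ μ' Y Y' s ≤ D.T * flowDiam D κ Cu := by
    refine (intervalIntegral.integral_mono_on hT
      (intervalIntegrable_of_continuousOn_Icc (continuousOn_flowDist hf.continuous_μ
        hf'.continuous_μ hf.continuous_Y hf'.continuous_Y) (right_mem_Icc.2 hT))
      intervalIntegrable_const
      (h.flowDist_le_flowDiam hD h' ha ha₀ hX₀ hX₀i hW)).trans_eq ?_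
    simp
  have h3 := hD.abs_integral_controlCost_le hΨ ha μ'
  have h4 : |D.pathCost a (fun t i => Y' i t) μ'| ≤
      |∫ t in (0 : ℝ)..D.T, D.lagrangian t (fun i => Y' i t) (μ' t)| + D.T * B :=
    (abs_add_le _ _).trans (by gcongr)
  have h5 := abs_sub_abs_le_abs_sub (D.pathCost a (fun t i => Y i t) μ)
    (D.pathCost a (fun t i => Y' i t) μ')
  have h6 : C * ∫ s in (0 : ℝ)..D.T, flowDist μ μ' Y Y' s ≤ C * (D.T * flowDiam D κ Cu) := by
    gcongr
  linarith

end Uniformity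

/-! ### Uniform convergence of the functionals and their infima. -/

section Convergence

variable {d ℓ m : ℕ} {D : Data d ℓ m} {κ : ℝ≥0} {Cu : ℝ}
  {Ω : Type*} [MeasurableSpace Ω] {P : Measure Ω} [IsProbabilityMeasure P]
  {X₀ : ℕ → Ω → Vec d} {W : ℕ → ℝ≥0 → Ω → Vec d} {X₀' : Ω → Vec d} {W' : ℝ≥0 → Ω → Vec d}

lemma Data.Regular.exists_abs_discreteFunctional_sub_le (hD : D.Regular κ Cu)
    (hc : D.CostRegular) (hn : IsFollowerNoise P X₀ W X₀' W') {ε : ℝ} (hε : 0 < ε) :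
    ∃ C, 0 ≤ C ∧ ∀ (N : ℕ) [NeZero N], ∀ a ∈ D.admissible, ∀ β,
      (∀ X μ Y, D.IsMeanFieldSolution P X₀' W' a X μ Y →
        ∀ t ∈ Icc 0 D.T, SampleBound P N (μ t) β) →
      |D.discreteFunctional P (fun n : Fin N => X₀ n) (fun n : Fin N => W n) a -
        D.meanFieldFunctional P X₀' W' a| ≤ ε + C * β := by
  obtain ⟨C, hC, h⟩ := hD.exists_discreteCost_sub_le hc hn hε
  refine ⟨C, hC, fun N _ a ha β hβ => ?_⟩
  obtain ⟨⟨X', μ, Y', h'⟩, hval'⟩ := hD.meanFieldWellPosed hc ha hn.measurable' hn.integrable'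
    hn.brownian'
  obtain ⟨⟨X, Y, hX⟩, hval⟩ := hD.discreteWellPosed (N := N) hc hn ha
  rw [(hval X Y hX).2.2, (hval' X' μ Y' h').2]
  exact (h N a ha X' μ Y' h' X Y hX).2 β (hβ X' μ Y' h')

/-- The functionals converge, uniformly in the control. -/
lemma Data.Regular.exists_forall_abs_sub_le (hD : D.Regular κ Cu) (hc : D.CostRegular)
    (hn : IsFollowerNoise P X₀ W X₀' W') {ε : ℝ} (hε : 0 < ε) :
    ∃ N₀ : ℕ, ∀ (N : ℕ) [NeZero N], N₀ ≤ N → ∀ a ∈ D.admissible,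
      |D.discreteFunctional P (fun n : Fin N => X₀ n) (fun n : Fin N => W n) a -
        D.meanFieldFunctional P X₀' W' a| ≤ ε := by
  obtain ⟨C, hC, h⟩ := hD.exists_abs_discreteFunctional_sub_le hc hn (half_pos hε)
  obtain ⟨N₀, hN₀⟩ := hD.exists_sampleBound hn.measurable' hn.integrable' hn.brownian'
    (show 0 < ε / (2 * (C + 1)) by positivity)
  refine ⟨N₀, fun N _ hN a ha => (h N a ha _ (hN₀ N hN a ha)).trans ?_⟩
  have : C * (ε / (2 * (C + 1))) ≤ ε / 2 := by
    rw [mul_div_assoc', div_le_div_iff₀ (by positivity) two_pos]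
    nlinarith
  linarith

lemma Data.Regular.exists_abs_discreteFunctional_le (hD : D.Regular κ Cu) (hc : D.CostRegular)
    (hn : IsFollowerNoise P X₀ W X₀' W') :
    ∃ B, ∀ (N : ℕ) [NeZero N], ∀ a ∈ D.admissible,
      |D.discreteFunctional P (fun n : Fin N => X₀ n) (fun n : Fin N => W n) a| ≤ B := by
  obtain ⟨C, hC, h⟩ := hD.exists_abs_discreteFunctional_sub_le hc hn one_pos
  obtain ⟨β, hβ⟩ := hD.exists_forall_sampleBound hn.measurable' hn.integrable' hn.brownian'
  obtain ⟨B, hB⟩ := hD.exists_abs_meanFieldFunctional_le hc hn.measurable' hn.integrable' hn.brownian'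
  refine ⟨B + (1 + C * β), fun N _ a ha => ?_⟩
  have h1 := h N a ha β (hβ N a ha)
  have h2 := hB a ha
  have h3 := abs_sub_abs_le_abs_sub
    (D.discreteFunctional P (fun n : Fin N => X₀ n) (fun n : Fin N => W n) a)
    (D.meanFieldFunctional P X₀' W' a)
  linarith

/-- Infima move by at most the uniform distance of the functions; neither compactness nor
semicontinuity is used. -/
lemma tendsto_sInf_image {α : Type*} {s : Set α} (hs : s.Nonempty) {F : ℕ → α → ℝ} {G : α → ℝ}
    (hF : ∀ N, BddBelow (F N '' s)) (hG : BddBelow (G '' s))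
    (h : ∀ ε > 0, ∃ N₀, ∀ N ≥ N₀, ∀ a ∈ s, |F N a - G a| ≤ ε) :
    Tendsto (fun N => sInf (F N '' s)) atTop (𝓝 (sInf (G '' s))) := by
  rw [Metric.tendsto_atTop]
  intro ε hε
  obtain ⟨N₀, hN₀⟩ := h (ε / 2) (half_pos hε)
  refine ⟨N₀, fun N hN => ?_⟩
  have key : ∀ {f g : α → ℝ}, BddBelow (f '' s) → (∀ a ∈ s, |f a - g a| ≤ ε / 2) →
      sInf (f '' s) - ε / 2 ≤ sInf (g '' s) := by
    intro f g hf hfg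
    refine le_csInf (hs.image g) ?_
    rintro _ ⟨a, ha, rfl⟩
    have h1 := csInf_le hf (mem_image_of_mem f ha)
    have h2 := (abs_le.1 (hfg a ha)).2
    linarith
  have h1 := key (hF N) (hN₀ N hN)
  have h2 := key hG fun a ha => by rw [abs_sub_comm]; exact hN₀ N hN a ha
  rw [Real.dist_eq, abs_lt]
  constructor <;> linarith

end Convergence

end MeanField

namespace MeanField

/-! ### Primitives and moving averages. -/

section Primitives

lemma intervalIntegrable_of_integrableOn_Icc {E : Type*} [NormedAddCommGroup E] {T : ℝ} {f : ℝ → E} (hf : IntegrableOn f (Icc 0 T)) {s t : ℝ}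
    (hs : s ∈ Icc 0 T) (ht : t ∈ Icc 0 T) : IntervalIntegrable f volume s t :=
  (hf.mono_set (uIcc_subset_Icc hs ht)).intervalIntegrable

variable {E : Type*} [NormedAddCommGroup E] [NormedSpace ℝ E] {T : ℝ}

lemma integral_eq_primitive_sub {f : ℝ → E} (hf : IntegrableOn f (Icc 0 T)) {s t : ℝ}
    (hs : s ∈ Icc 0 T) (ht : t ∈ Icc 0 T) :
    ∫ r in s..t, f r = (∫ r in (0 : ℝ)..t, f r) - ∫ r in (0 : ℝ)..s, f r := by
  have h0 : (0 : ℝ) ∈ Icc 0 T := ⟨le_rfl, hs.1.trans hs.2⟩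
  exact (intervalIntegral.integral_interval_sub_left (intervalIntegrable_of_integrableOn_Icc hf h0 ht)
    (intervalIntegrable_of_integrableOn_Icc hf h0 hs)).symm

/-- The mean of `f` over `[s, s + η]`. -/
noncomputable def movingAverage (f : ℝ → E) (η s : ℝ) : E :=
  η⁻¹ • ((∫ r in (0 : ℝ)..(s + η), f r) - ∫ r in (0 : ℝ)..s, f r)

lemma movingAverage_eq {f : ℝ → E} (hf : IntegrableOn f (Icc 0 T)) {s η : ℝ} (hη : 0 < η)
    (hs : 0 ≤ s) (hsT : s + η ≤ T) : movingAverage f η s = ⨍ r in Ioc s (s + η), f r := by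
  rw [movingAverage, ← integral_eq_primitive_sub hf ⟨hs, by linarith⟩
    ⟨by linarith, hsT⟩, setAverage_eq, Real.volume_real_Ioc_of_le (by linarith),
    intervalIntegral.integral_of_le (by linarith), add_sub_cancel_left]

lemma continuousOn_primitive {f : ℝ → E} (hf : IntegrableOn f (Icc 0 T)) (hT : 0 ≤ T) :
    ContinuousOn (fun t => ∫ r in (0 : ℝ)..t, f r) (Icc 0 T) := by
  have := intervalIntegral.continuousOn_primitive_interval (f := f) (μ := volume) (a := 0) (b := T)
    (by rwa [uIcc_of_le hT])
  rwa [uIcc_of_le hT] at this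

lemma continuousOn_movingAverage {f : ℝ → E} (hf : IntegrableOn f (Icc 0 T)) {η : ℝ} (hη : 0 < η)
    (hηT : η ≤ T) : ContinuousOn (movingAverage f η) (Icc 0 (T - η)) := by
  have h := continuousOn_primitive hf (hη.le.trans hηT)
  refine ((h.comp (by fun_prop) ?_).sub (h.mono ?_)).const_smul _
  · intro s hs
    exact ⟨by linarith [hs.1], by linarith [hs.2]⟩
  · exact Icc_subset_Icc_right (by linarith)

lemma movingAverage_mem [CompleteSpace E] {f : ℝ → E} (hf : IntegrableOn f (Icc 0 T)) {K : Set E}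
    (hK : Convex ℝ K) (hKc : IsClosed K) (hfK : ∀ᵐ s ∂(volume.restrict (Icc 0 T)), f s ∈ K)
    {s η : ℝ} (hη : 0 < η) (hs : 0 ≤ s) (hsT : s + η ≤ T) : movingAverage f η s ∈ K := by
  have hsub : Ioc s (s + η) ⊆ Icc 0 T := fun r hr => ⟨hs.trans hr.1.le, hr.2.trans hsT⟩
  rw [movingAverage_eq hf hη hs hsT]
  exact hK.set_average_mem hKc (by simp [hη]) (by simp)
    (ae_restrict_of_ae_restrict_of_subset hsub hfK) (hf.mono_set hsub)

/-- Moving averages converge almost everywhere. -/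
lemma ae_tendsto_movingAverage [CompleteSpace E] {f : ℝ → E} (hf : IntegrableOn f (Icc 0 T)) :
    ∀ᵐ s ∂(volume.restrict (Icc 0 T)),
      Tendsto (fun η => movingAverage f η s) (𝓝[>] 0) (𝓝 (f s)) := by
  rw [ae_restrict_iff' measurableSet_Icc]
  rcases lt_or_ge T 0 with hT | hT
  · exact ae_of_all _ fun s hs => absurd (hs.1.trans hs.2) (not_le.2 hT)
  have hf' : IntervalIntegrable f volume 0 T :=
    intervalIntegrable_of_integrableOn_Icc hf (left_mem_Icc.2 hT) (right_mem_Icc.2 hT)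
  filter_upwards [hf'.ae_hasDerivAt_integral] with s hs hsT
  exact (hs (by rwa [uIcc_of_le hT]) 0 left_mem_uIcc).tendsto_slope_zero_right

/-- A limit, in the sense of convergence of primitives, of functions with values in a closed convex
set has values in this set. -/
lemma ae_mem_of_tendsto_primitive [CompleteSpace E] {ι : Type*} {l : Filter ι} [l.NeBot]
    {f : ι → ℝ → E}
    {g : ℝ → E} {K : Set E} (hK : Convex ℝ K) (hKc : IsClosed K)
    (hf : ∀ᶠ k in l, IntegrableOn (f k) (Icc 0 T))
    (hfK : ∀ᶠ k in l, ∀ᵐ s ∂(volume.restrict (Icc 0 T)), f k s ∈ K) (hg : IntegrableOn g (Icc 0 T))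
    (h : ∀ t ∈ Icc 0 T, Tendsto (fun k => ∫ s in (0 : ℝ)..t, f k s) l (𝓝 (∫ s in (0 : ℝ)..t, g s))) :
    ∀ᵐ s ∂(volume.restrict (Icc 0 T)), g s ∈ K := by
  have hne : ∀ᵐ s ∂(volume.restrict (Icc 0 T)), s ≠ T :=
    ae_restrict_of_ae (by simp [ae_iff, measure_singleton])
  filter_upwards [ae_tendsto_movingAverage hg, ae_restrict_mem measurableSet_Icc, hne]
    with s hs hsT hne
  refine hKc.mem_of_tendsto hs ?_
  have hlt : 0 < T - s := sub_pos.2 (lt_of_le_of_ne hsT.2 hne)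
  filter_upwards [Ioo_mem_nhdsGT hlt] with η hη
  have hsη : s + η ≤ T := by linarith [hη.2]
  refine hKc.mem_of_tendsto (b := l) (f := fun k => movingAverage (f k) η s) ?_ ?_
  · exact ((h _ ⟨by linarith [hsT.1, hη.1], hsη⟩).sub (h s hsT)).const_smul _
  · filter_upwards [hf, hfK] with k hk hk'
    exact movingAverage_mem hk hK hKc hk' hη.1 hsT.1 hsη

/-- With `G` the primitive of `φ`, the left side equals `η⁻¹ (∫_{T-η}^T G - ∫_0^η G)`. Since `G` is
`B`-Lipschitz with `G 0 = 0`, the two boundary averages lie within `B * η` of `G T` and of `0`. -/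
lemma integral_movingAverage_le {φ : ℝ → ℝ} (hφ : IntegrableOn φ (Icc 0 T)) {B : ℝ} (hB : 0 ≤ B)
    (hφB : ∀ᵐ s ∂(volume.restrict (Icc 0 T)), |φ s| ≤ B) {η : ℝ} (hη : 0 < η) (hηT : η ≤ T) :
    ∫ s in (0 : ℝ)..(T - η), movingAverage φ η s ≤ (∫ s in (0 : ℝ)..T, φ s) + 2 * B * η := by
  have hT : 0 ≤ T := hη.le.trans hηT
  set G : ℝ → ℝ := fun t => ∫ r in (0 : ℝ)..t, φ r with hG
  have hGc : ContinuousOn G (Icc 0 T) := continuousOn_primitive hφ hT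
  have hGi : ∀ {s t}, s ∈ Icc 0 T → t ∈ Icc 0 T → IntervalIntegrable G volume s t := fun hs ht =>
    (hGc.mono (uIcc_subset_Icc hs ht)).intervalIntegrable
  have hGl : ∀ {s t}, s ∈ Icc 0 T → t ∈ Icc 0 T → s ≤ t → |G t - G s| ≤ B * (t - s) := by
    intro s t hs ht hst
    rw [hG, ← integral_eq_primitive_sub hφ hs ht, ← Real.norm_eq_abs]
    refine (intervalIntegral.norm_integral_le_of_norm_le (g := fun _ => B) hst ?_
      intervalIntegrable_const).trans_eq (by simp [mul_comm])
    filter_upwards [(ae_restrict_iff' measurableSet_Icc).1 hφB] with r hr hrI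
    exact hr ⟨hs.1.trans hrI.1.le, hrI.2.trans ht.2⟩
  have m0 : (0 : ℝ) ∈ Icc 0 T := left_mem_Icc.2 hT
  have mT : T ∈ Icc 0 T := right_mem_Icc.2 hT
  have mη : η ∈ Icc 0 T := ⟨hη.le, hηT⟩
  have mTη : T - η ∈ Icc 0 T := ⟨by linarith, by linarith⟩
  have e1 : ∫ s in (0 : ℝ)..(T - η), movingAverage φ η s =
      η⁻¹ * ((∫ s in (T - η)..T, G s) - ∫ s in (0 : ℝ)..η, G s) := by
    have h1 : ∫ s in (0 : ℝ)..(T - η), G (s + η) = ∫ s in η..T, G s := by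
      rw [intervalIntegral.integral_comp_add_right G η]; simp
    have h2 : IntervalIntegrable (fun s => G (s + η)) volume 0 (T - η) := by
      refine ContinuousOn.intervalIntegrable_of_Icc mTη.1 (hGc.comp (by fun_prop) fun s hs => ?_)
      exact ⟨by linarith [hs.1], by linarith [hs.2]⟩
    have h3 : ∫ s in (0 : ℝ)..(T - η), (G (s + η) - G s) =
        (∫ s in (0 : ℝ)..(T - η), G (s + η)) - ∫ s in (0 : ℝ)..(T - η), G s :=
      intervalIntegral.integral_sub h2 (hGi m0 mTη)
    have h4 : ∫ s in (0 : ℝ)..(T - η), movingAverage φ η s =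
        η⁻¹ * ∫ s in (0 : ℝ)..(T - η), (G (s + η) - G s) := by
      rw [← intervalIntegral.integral_const_mul]; rfl
    rw [h4, h3, h1]
    have h5 := intervalIntegral.integral_add_adjacent_intervals (hGi m0 mη) (hGi mη mT)
    have h6 := intervalIntegral.integral_add_adjacent_intervals (hGi m0 mTη) (hGi mTη mT)
    congr 1; linarith
  have u1 : ∫ s in (T - η)..T, G s ≤ η * (G T + B * η) := by
    refine (intervalIntegral.integral_mono_on (by linarith) (hGi mTη mT)
      (g := fun _ => G T + B * η) intervalIntegrable_const fun s hs => ?_).trans_eq (by simp; ring)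
    have h1 := (abs_le.1 (hGl ⟨mTη.1.trans hs.1, hs.2⟩ mT hs.2)).1
    have h2 : B * (T - s) ≤ B * η := by gcongr; linarith [hs.1]
    linarith
  have u2 : η * -(B * η) ≤ ∫ s in (0 : ℝ)..η, G s := by
    refine Eq.trans_le (by simp; ring) (intervalIntegral.integral_mono_on hη.le
      (f := fun _ => -(B * η)) intervalIntegrable_const (hGi m0 mη) fun s hs => ?_)
    have h1 := (abs_le.1 (hGl m0 ⟨hs.1, hs.2.trans hηT⟩ hs.1)).1
    have h2 : B * (s - 0) ≤ B * η := by gcongr; linarith [hs.2]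
    have h3 : G 0 = 0 := by simp [hG]
    linarith
  rw [e1]
  calc η⁻¹ * ((∫ s in (T - η)..T, G s) - ∫ s in (0 : ℝ)..η, G s)
      ≤ η⁻¹ * (η * (G T + B * η) - η * -(B * η)) := by gcongr
    _ = _ := by field_simp; ring

/-- A Lipschitz function with values in a finite-dimensional space is a primitive. -/
lemma exists_integral_eq_of_lipschitzOnWith [FiniteDimensional ℝ E] (hT : 0 ≤ T) {H : ℝ → E}
    {C : ℝ≥0} (hH : LipschitzOnWith C H (Icc 0 T)) :
    ∃ h : ℝ → E, IntegrableOn h (Icc 0 T) ∧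
      ∀ t ∈ Icc 0 T, ∫ s in (0 : ℝ)..t, h s = H t - H 0 := by
  -- Coordinates reduce the claim to real Lipschitz functions, which are absolutely continuous and
  -- hence integrals of their derivatives.
  let b := Module.finBasis ℝ E
  let e : ∀ i, E →L[ℝ] ℝ := fun i => LinearMap.toContinuousLinearMap (b.coord i)
  have hac : ∀ i, ∀ t ∈ Icc 0 T, AbsolutelyContinuousOnInterval (fun t => e i (H t)) 0 t := by
    intro i t ht
    have h1 : LipschitzOnWith (‖e i‖₊ * C) (fun t => e i (H t)) (Icc 0 T) :=
      (e i).lipschitz.comp_lipschitzOnWith hH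
    refine (h1.mono ?_).absolutelyContinuousOnInterval
    rw [uIcc_of_le ht.1]
    exact Icc_subset_Icc_right ht.2
  refine ⟨fun s => ∑ i, deriv (fun t => e i (H t)) s • b i, ?_, fun t ht => ?_⟩
  · refine integrable_finsetSum _ fun i _ => Integrable.smul_const ?_ _
    have := (hac i T (right_mem_Icc.2 hT)).intervalIntegrable_deriv
    rwa [intervalIntegrable_iff_integrableOn_Icc_of_le hT] at this
  · have h1 : ∀ i, IntervalIntegrable (fun s => deriv (fun t => e i (H t)) s • b i) volume 0 t :=
      fun i => have h := (hac i t ht).intervalIntegrable_deriv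
        ⟨Integrable.smul_const h.1 _, Integrable.smul_const h.2 _⟩
    rw [intervalIntegral.integral_finsetSum fun i _ => h1 i]
    have h2 : ∀ i, ∫ s in (0 : ℝ)..t, deriv (fun t => e i (H t)) s • b i =
        b.repr (H t - H 0) i • b i := fun i => by
      rw [intervalIntegral.integral_smul_const, (hac i t ht).integral_deriv_eq_sub, ← map_sub]
      rfl
    rw [Finset.sum_congr rfl fun i _ => h2 i]
    exact b.sum_repr _

end Primitives

end MeanField

namespace MeanField

/-! ### Lower semicontinuity of convex integral functionals. -/

section LowerSemicontinuity

variable {E : Type*} [NormedAddCommGroup E] [NormedSpace ℝ E] {T : ℝ}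

/-- Jensen's inequality for moving averages. -/
lemma integral_comp_movingAverage_le [CompleteSpace E] {Φ : E × ℝ → ℝ} (hΦ : Continuous Φ)
    (hconv : ∀ s, ConvexOn ℝ univ fun x => Φ (x, s)) {K : Set E} {B C ε : ℝ} (hB : 0 ≤ B) (hΦB : ∀ x ∈ K, ∀ s ∈ Icc 0 T, |Φ (x, s)| ≤ B)
    (hΦC : ∀ x ∈ K, ∀ s ∈ Icc 0 T, ∀ r ∈ Icc 0 T, |Φ (x, s) - Φ (x, r)| ≤ ε + C * ‖s - r‖)
    (hC : 0 ≤ C) (hε : 0 ≤ ε)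
    {f : ℝ → E} (hf : IntegrableOn f (Icc 0 T)) (hfK : ∀ᵐ s ∂(volume.restrict (Icc 0 T)), f s ∈ K)
    {η : ℝ} (hη : 0 < η) (hηT : η ≤ T) :
    ∫ s in (0 : ℝ)..(T - η), Φ (movingAverage f η s, s) ≤
      (∫ s in (0 : ℝ)..T, Φ (f s, s)) + 2 * B * η + T * (ε + C * η) := by
  have hT : 0 ≤ T := hη.le.trans hηT
  set φ : ℝ → ℝ := fun s => Φ (f s, s) with hφdef
  have hφB : ∀ᵐ s ∂(volume.restrict (Icc 0 T)), |φ s| ≤ B := by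
    filter_upwards [hfK, ae_restrict_mem measurableSet_Icc] with s hs hsT using hΦB _ hs _ hsT
  have hφ : IntegrableOn φ (Icc 0 T) :=
    Integrable.of_bound (hΦ.comp_aestronglyMeasurable
      (hf.aestronglyMeasurable.prodMk aestronglyMeasurable_id)) B hφB
  have hmc := continuousOn_movingAverage hf hη hηT
  have hmφ := continuousOn_movingAverage hφ hη hηT
  have hTη : (0 : ℝ) ≤ T - η := sub_nonneg.2 hηT
  have hCη : 0 ≤ ε + C * η := by positivity
  -- Jensen's inequality is applied with the parameter frozen at `s`; replacing it by the running
  -- time `r` of the window costs `ε + C * η`.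
  have hpt : ∀ s ∈ Icc 0 (T - η), Φ (movingAverage f η s, s) ≤
      movingAverage φ η s + (ε + C * η) := by
    intro s hs
    have hsT : s + η ≤ T := by linarith [hs.2]
    have hsI : s ∈ Icc 0 T := ⟨hs.1, by linarith⟩
    have hsub : Ioc s (s + η) ⊆ Icc 0 T := fun r hr => ⟨hs.1.trans hr.1.le, hr.2.trans hsT⟩
    have hfK' : ∀ᵐ r ∂(volume.restrict (Ioc s (s + η))), f r ∈ K :=
      ae_restrict_of_ae_restrict_of_subset hsub hfK
    have hi1 : IntegrableOn (fun r => Φ (f r, s)) (Ioc s (s + η)) := by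
      refine Integrable.of_bound ((hΦ.comp (Continuous.prodMk_left s)).comp_aestronglyMeasurable
        (hf.mono_set hsub).aestronglyMeasurable) B ?_
      filter_upwards [hfK'] with r hr using hΦB _ hr _ hsI
    have hi2 : IntegrableOn (fun r => φ r + (ε + C * η)) (Ioc s (s + η)) :=
      (hφ.mono_set hsub).add (integrable_const _)
    have hv0 : (volume : Measure ℝ) (Ioc s (s + η)) ≠ 0 := by simp [hη]
    have hv1 : (volume : Measure ℝ) (Ioc s (s + η)) ≠ ∞ := by simp
    have hv2 : (volume : Measure ℝ).real (Ioc s (s + η)) = η := by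
      rw [Real.volume_real_Ioc_of_le (by linarith)]; ring
    rw [movingAverage_eq hf hη hs.1 hsT, movingAverage_eq hφ hη hs.1 hsT]
    refine ((hconv s).map_set_average_le (f := f)
      (hΦ.comp (Continuous.prodMk_left s)).continuousOn isClosed_univ hv0 hv1
      (ae_of_all _ fun _ => mem_univ _) (hf.mono_set hsub) hi1).trans ?_
    have e : (⨍ r in Ioc s (s + η), φ r) + (ε + C * η) =
        ⨍ r in Ioc s (s + η), (φ r + (ε + C * η)) := by
      rw [setAverage_eq, setAverage_eq, integral_add (hφ.mono_set hsub) (integrable_const _),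
        setIntegral_const, hv2, smul_add, smul_smul, inv_mul_cancel₀ hη.ne', one_smul]
    rw [e, setAverage_eq, setAverage_eq, hv2, smul_eq_mul, smul_eq_mul]
    refine mul_le_mul_of_nonneg_left (integral_mono_ae hi1 hi2 ?_) (by positivity)
    filter_upwards [hfK', ae_restrict_mem measurableSet_Ioc] with r hr hrI
    have h1 := (abs_le.1 (hΦC _ hr s hsI r (hsub hrI))).2
    have h2 : C * ‖s - r‖ ≤ C * η := by
      gcongr
      rw [Real.norm_eq_abs, abs_le]
      constructor <;> linarith [hrI.1, hrI.2]
    simp only [hφdef]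
    linarith
  have hmi : IntervalIntegrable (movingAverage φ η) volume 0 (T - η) :=
    hmφ.intervalIntegrable_of_Icc hTη
  calc ∫ s in (0 : ℝ)..(T - η), Φ (movingAverage f η s, s)
      ≤ ∫ s in (0 : ℝ)..(T - η), (movingAverage φ η s + (ε + C * η)) :=
        intervalIntegral.integral_mono_on hTη
          ((hΦ.comp_continuousOn (hmc.prodMk continuousOn_id)).intervalIntegrable_of_Icc hTη)
          (hmi.add intervalIntegrable_const) hpt
    _ = (∫ s in (0 : ℝ)..(T - η), movingAverage φ η s) + (T - η) * (ε + C * η) := by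
        rw [intervalIntegral.integral_add hmi intervalIntegrable_const,
          intervalIntegral.integral_const, sub_zero, smul_eq_mul]
    _ ≤ ((∫ s in (0 : ℝ)..T, φ s) + 2 * B * η) + T * (ε + C * η) := by
        gcongr
        · exact integral_movingAverage_le hφ hB hφB hη hηT
        · linarith

/-- Convex integral functionals are lower semicontinuous with respect to convergence of
primitives. -/
lemma eventually_integral_le_of_tendsto_primitive [CompleteSpace E] {Φ : E × ℝ → ℝ}
    (hΦ : Continuous Φ) (hconv : ∀ s, ConvexOn ℝ univ fun x => Φ (x, s)) {K : Set E}
    (hK : IsCompact K) (hKc : Convex ℝ K) (hT : 0 ≤ T) {f : ℕ → ℝ → E} {g : ℝ → E}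
    (hf : ∀ k, IntegrableOn (f k) (Icc 0 T)) (hg : IntegrableOn g (Icc 0 T))
    (hfK : ∀ k, ∀ᵐ s ∂(volume.restrict (Icc 0 T)), f k s ∈ K)
    (hgK : ∀ᵐ s ∂(volume.restrict (Icc 0 T)), g s ∈ K)
    (h : ∀ t ∈ Icc 0 T, Tendsto (fun k => ∫ s in (0 : ℝ)..t, f k s) atTop
      (𝓝 (∫ s in (0 : ℝ)..t, g s))) {ε : ℝ} (hε : 0 < ε) :
    ∀ᶠ k in atTop, ∫ s in (0 : ℝ)..T, Φ (g s, s) ≤ (∫ s in (0 : ℝ)..T, Φ (f k s, s)) + ε := by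
  rcases hT.eq_or_lt with rfl | hT'
  · simp [hε.le]
  obtain ⟨B, hB, hΦB⟩ : ∃ B, 0 ≤ B ∧ ∀ x ∈ K, ∀ s ∈ Icc 0 T, |Φ (x, s)| ≤ B := by
    obtain ⟨B, hB⟩ := (hK.prod isCompact_Icc).exists_bound_of_continuousOn hΦ.continuousOn
    exact ⟨max B 0, le_max_right _ _, fun x hx s hs => (hB (x, s) ⟨hx, hs⟩).trans (le_max_left _ _)⟩
  -- One quarter of `ε` each is spent on shrinking the window for `g`, on the limit in `k` at a
  -- fixed window, on the terms with `η` in Jensen's estimate, and on `T * ε'`.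
  set ε' : ℝ := ε / (4 * (T + 1)) with hε'
  have hε'0 : 0 < ε' := by positivity
  have hTε' : T * ε' ≤ ε / 4 := by
    rw [hε', mul_div_assoc', div_le_div_iff₀ (by positivity) (by norm_num)]
    nlinarith
  obtain ⟨C, hC, hΦC⟩ := exists_abs_sub_le_of_isCompact hΦ hK (isCompact_Icc (a := (0 : ℝ)) (b := T))
    hε'0
  -- the limit of the left-hand sides as the window shrinks
  have hη0 : Tendsto (fun η : ℝ => ∫ s in (0 : ℝ)..(T - η), Φ (movingAverage g η s, s)) (𝓝[>] 0)
      (𝓝 (∫ s in (0 : ℝ)..T, Φ (g s, s))) := by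
    have hd := tendsto_integral_filter_of_dominated_convergence (μ := volume.restrict (Ioc 0 T))
      (l := 𝓝[>] (0 : ℝ)) (F := fun η => (Ioc 0 (T - η)).indicator
        fun s => Φ (movingAverage g η s, s)) (f := fun s => Φ (g s, s)) (fun _ => B) ?_ ?_
      (integrable_const _) ?_
    · rw [intervalIntegral.integral_of_le hT]
      refine hd.congr' ?_
      filter_upwards [Ioo_mem_nhdsGT hT'] with η hη
      rw [integral_indicator measurableSet_Ioc, Measure.restrict_restrict measurableSet_Ioc,
        inter_eq_left.2 (Ioc_subset_Ioc_right (by linarith [hη.1])),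
        intervalIntegral.integral_of_le (by linarith [hη.2])]
    · filter_upwards [Ioo_mem_nhdsGT hT'] with η hη
      rw [aestronglyMeasurable_indicator_iff measurableSet_Ioc]
      have h1 := (hΦ.comp_continuousOn ((continuousOn_movingAverage hg hη.1 hη.2.le).prodMk
        continuousOn_id)).mono Ioc_subset_Icc_self
      exact (h1.aestronglyMeasurable measurableSet_Ioc).mono_measure
        (Measure.restrict_mono_measure Measure.restrict_le_self _)
    · filter_upwards [Ioo_mem_nhdsGT hT'] with η hη
      refine ae_of_all _ fun s => ?_
      rw [Set.indicator_apply]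
      split_ifs with hs
      · refine hΦB _ (movingAverage_mem hg hKc hK.isClosed hgK hη.1 hs.1.le ?_) _ ⟨hs.1.le, ?_⟩
        · linarith [hs.2]
        · linarith [hs.2, hη.1]
      · simpa using hB
    · have hne : ∀ᵐ s ∂(volume.restrict (Ioc 0 T)), s ≠ T :=
        ae_restrict_of_ae (by simp [ae_iff, measure_singleton])
      filter_upwards [ae_restrict_of_ae_restrict_of_subset Ioc_subset_Icc_self
        (ae_tendsto_movingAverage hg), ae_restrict_mem measurableSet_Ioc, hne] with s hs hsT hsne
      have h1 : Tendsto (fun η => Φ (movingAverage g η s, s)) (𝓝[>] 0) (𝓝 (Φ (g s, s))) :=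
        (hΦ.tendsto _).comp (hs.prodMk_nhds tendsto_const_nhds)
      refine h1.congr' ?_
      have hlt : 0 < T - s := sub_pos.2 (lt_of_le_of_ne hsT.2 hsne)
      filter_upwards [Ioo_mem_nhdsGT hlt] with η hη
      rw [Set.indicator_of_mem]
      exact ⟨hsT.1, by linarith [hη.2]⟩
  have hsmall : ∀ᶠ η : ℝ in 𝓝[>] 0, 2 * B * η + T * (C * η) < ε / 4 := by
    have hc : Continuous fun η : ℝ => 2 * B * η + T * (C * η) := by fun_prop
    have h1 := hc.tendsto 0
    simp only [mul_zero, add_zero] at h1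
    exact (h1.mono_left nhdsWithin_le_nhds).eventually (gt_mem_nhds (by positivity))
  obtain ⟨η, ⟨hη1, hη2⟩, hη3⟩ := ((hη0.eventually (lt_mem_nhds (sub_lt_self _
    (show 0 < ε / 4 by positivity)))).and hsmall |>.and (Ioo_mem_nhdsGT hT')).exists
  -- for a fixed window, pass to the limit
  have hk : Tendsto (fun k => ∫ s in (0 : ℝ)..(T - η), Φ (movingAverage (f k) η s, s)) atTop
      (𝓝 (∫ s in (0 : ℝ)..(T - η), Φ (movingAverage g η s, s))) := by
    have hTη : 0 ≤ T - η := sub_nonneg.2 hη3.2.le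
    refine intervalIntegral.tendsto_integral_filter_of_dominated_convergence (fun _ => B)
      (Eventually.of_forall fun k => ?_) (Eventually.of_forall fun k => ae_of_all _ fun s hs => ?_)
      intervalIntegrable_const (ae_of_all _ fun s hs => ?_)
    · rw [uIoc_of_le hTη]
      exact ((hΦ.comp_continuousOn ((continuousOn_movingAverage (hf k) hη3.1 hη3.2.le).prodMk
        continuousOn_id)).mono Ioc_subset_Icc_self).aestronglyMeasurable measurableSet_Ioc
    · rw [uIoc_of_le hTη] at hs
      refine hΦB _ (movingAverage_mem (hf k) hKc hK.isClosed (hfK k) hη3.1 hs.1.le ?_) _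
        ⟨hs.1.le, ?_⟩
      · linarith [hs.2]
      · linarith [hs.2, hη3.1]
    · rw [uIoc_of_le hTη] at hs
      refine (hΦ.tendsto _).comp (Tendsto.prodMk_nhds ?_ tendsto_const_nhds)
      refine ((h _ ⟨?_, ?_⟩).sub (h s ⟨hs.1.le, ?_⟩)).const_smul _
      · linarith [hs.1, hη3.1]
      · linarith [hs.2]
      · linarith [hs.2, hη3.1]
  filter_upwards [hk.eventually (lt_mem_nhds (sub_lt_self _ (show 0 < ε / 4 by positivity)))]
    with k hk
  have := integral_comp_movingAverage_le hΦ hconv hB hΦB hΦC hC hε'0.le (hf k) (hfK k)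
    hη3.1 hη3.2.le
  rw [mul_add] at this
  linarith

end LowerSemicontinuity

end MeanField

namespace MeanField

/-! ### Limits of equi-Lipschitz maps. -/

section Equicontinuity

variable {α E : Type*} [PseudoMetricSpace α] [PseudoMetricSpace E]

lemma tendsto_of_mem_closure {f : ℕ → α → E} {g : α → E} {C : ℝ} (hC : 0 ≤ C) {A c : Set α}
    (hc : c ⊆ A) (hf : ∀ k, ∀ x ∈ A, ∀ y ∈ A, dist (f k x) (f k y) ≤ C * dist x y)
    (hg : ∀ x ∈ A, ∀ y ∈ A, dist (g x) (g y) ≤ C * dist x y)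
    (h : ∀ y ∈ c, Tendsto (fun k => f k y) atTop (𝓝 (g y))) {x : α} (hx : x ∈ A)
    (hxc : x ∈ closure c) : Tendsto (fun k => f k x) atTop (𝓝 (g x)) := by
  rw [Metric.tendsto_atTop]
  intro ε hε
  obtain ⟨y, hy, hxy⟩ := Metric.mem_closure_iff.1 hxc (ε / (3 * (C + 1))) (by positivity)
  obtain ⟨K, hK⟩ := Metric.tendsto_atTop.1 (h y hy) (ε / 3) (by positivity)
  refine ⟨K, fun k hk => ?_⟩
  have h1 : C * dist x y ≤ ε / 3 := by
    calc C * dist x y ≤ (C + 1) * (ε / (3 * (C + 1))) := by gcongr; linarith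
      _ = ε / 3 := by field_simp
  have h2 := hf k x hx y (hc hy)
  have h3 := hg x hx y (hc hy)
  rw [dist_comm] at h3
  have h4 := hK k hk
  have h5 := dist_triangle4 (f k x) (f k y) (g y) (g x)
  linarith

/-- The elementary half of Ascoli's theorem: a finite net and the common Lipschitz constant. -/
lemma eventually_forall_dist_le {f : ℕ → α → E} {g : α → E} {C : ℝ} (hC : 0 ≤ C) {A : Set α}
    (hA : IsCompact A) (hf : ∀ k, ∀ x ∈ A, ∀ y ∈ A, dist (f k x) (f k y) ≤ C * dist x y)
    (hg : ∀ x ∈ A, ∀ y ∈ A, dist (g x) (g y) ≤ C * dist x y)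
    (h : ∀ y ∈ A, Tendsto (fun k => f k y) atTop (𝓝 (g y))) {ε : ℝ} (hε : 0 < ε) :
    ∀ᶠ k in atTop, ∀ x ∈ A, dist (f k x) (g x) ≤ ε := by
  obtain ⟨t, htA, htf, hcov⟩ := hA.finite_cover_balls (e := ε / (3 * (C + 1))) (by positivity)
  have h1 : ∀ᶠ k in atTop, ∀ y ∈ t, dist (f k y) (g y) < ε / 3 :=
    (eventually_all_finite htf).2 fun y hy =>
      (h y (htA hy)).eventually (Metric.ball_mem_nhds _ (by positivity))
  filter_upwards [h1] with k hk x hx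
  obtain ⟨y, hy, hxy⟩ := mem_iUnion₂.1 (hcov hx)
  rw [Metric.mem_ball] at hxy
  have h1 : C * dist x y ≤ ε / 3 := by
    calc C * dist x y ≤ (C + 1) * (ε / (3 * (C + 1))) := by gcongr; linarith
      _ = ε / 3 := by field_simp
  have h2 := hf k x hx y (htA hy)
  have h3 := hg x hx y (htA hy)
  rw [dist_comm] at h3
  have h4 := hk y hy
  have h5 := dist_triangle4 (f k x) (f k y) (g y) (g x)
  linarith

end Equicontinuity

/-! ### Compactness of the set of admissible controls. -/

section Controls

variable {d ℓ m : ℕ} {D : Data d ℓ m} {κ : ℝ≥0} {Cu : ℝ}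

/-- The open-loop controls as a function with values in a normed space. -/
def Control.hVec (a : Control d ℓ m) (s : ℝ) : Fin m → Fin d → Fin ℓ → ℝ :=
  fun j p q => a.h j s p q

/-- The matrices with given entries. -/
def toMatrices (x : Fin m → Fin d → Fin ℓ → ℝ) : Fin m → Matrix (Fin d) (Fin ℓ) ℝ :=
  fun j => Matrix.of (x j)

lemma continuous_toMatrices : Continuous (toMatrices : (Fin m → Fin d → Fin ℓ → ℝ) → _) :=
  continuous_pi fun j => continuous_matrix fun p q => by
    simp only [toMatrices, Matrix.of_apply]; fun_prop

/-- Convergence of controls: the primitives of the open-loop controls and the values of the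
feedback controls on `S` converge. -/
structure Data.ControlTendsto (D : Data d ℓ m) (a : ℕ → Control d ℓ m) (a' : Control d ℓ m)
    (S : Set (WassersteinOne d)) : Prop where
  mem : ∀ k, a k ∈ D.admissible
  mem' : a' ∈ D.admissible
  tendsto_h : ∀ t ∈ Icc 0 D.T, Tendsto (fun k => ∫ s in (0 : ℝ)..t, (a k).hVec s) atTop
    (𝓝 (∫ s in (0 : ℝ)..t, a'.hVec s))
  tendsto_g : ∀ μ ∈ S, ∀ j, Tendsto (fun k => (a k).g j μ) atTop (𝓝 (a'.g j μ))

/-- The values of the open-loop controls. -/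
def Data.controlValues (D : Data d ℓ m) : Set (Fin m → Fin d → Fin ℓ → ℝ) :=
  {x | ∀ j, toMatrices x j ∈ D.U}

lemma Data.CostRegular.isCompact_controlValues (hc : D.CostRegular) :
    IsCompact D.controlValues := by
  have h1 : Continuous fun (y : Fin m → Matrix (Fin d) (Fin ℓ) ℝ) j p q => y j p q := by fun_prop
  refine ((isCompact_univ_pi fun _ : Fin m => hc.isCompact_U).image h1).of_isClosed_subset ?_ ?_
  · have h2 : D.controlValues = ⋂ j, {x | toMatrices x j ∈ D.U} := by
      ext x; simp [Data.controlValues]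
    rw [h2]
    exact isClosed_iInter fun j =>
      hc.isCompact_U.isClosed.preimage ((continuous_apply j).comp continuous_toMatrices)
  · exact fun x hx => ⟨toMatrices x, fun j _ => hx j, rfl⟩

lemma convex_controlValues (hU : Convex ℝ D.U) : Convex ℝ D.controlValues :=
  fun _ hx _ hy _ _ ha hb hab j => hU (hx j) (hy j) ha hb hab

variable {a : Control d ℓ m}

lemma ae_hVec_mem (ha : a ∈ D.admissible) :
    ∀ᵐ t ∂(volume.restrict (Icc 0 D.T)), a.hVec t ∈ D.controlValues := by
  filter_upwards [ae_h_mem ha] with s hs j using hs j (mem_univ j)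

lemma Data.CostRegular.integrableOn_hVec (hc : D.CostRegular) (ha : a ∈ D.admissible) :
    IntegrableOn a.hVec (Icc 0 D.T) := by
  obtain ⟨R, hR⟩ := hc.isCompact_controlValues.isBounded.exists_norm_le
  refine Integrable.of_bound (C := R) ?_ ?_
  · refine aestronglyMeasurable_pi fun j => ?_
    have h1 : Continuous fun (y : Matrix (Fin d) (Fin ℓ) ℝ) p q => y p q := by fun_prop
    exact h1.comp_aestronglyMeasurable (ha.1 j).1
  · filter_upwards [ae_hVec_mem ha] with s hs using hR _ hs

lemma exists_tendsto_ultrafilter {ι X : Type*} [TopologicalSpace X] (l : Ultrafilter ι)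
    {K : Set X} (hK : IsCompact K) {f : ι → X} (hf : ∀ k, f k ∈ K) :
    ∃ x ∈ K, Tendsto f l (𝓝 x) :=
  hK.ultrafilter_le_nhds (l.map f) (le_principal_iff.2 (Ultrafilter.mem_map.2 (Filter.univ_mem' hf)))

lemma norm_integral_sub_le_of_bound {E : Type*} [NormedAddCommGroup E] [NormedSpace ℝ E] {T R : ℝ}
    {f : ℝ → E} (hf : IntegrableOn f (Icc 0 T))
    (hR : ∀ᵐ s ∂(volume.restrict (Icc 0 T)), ‖f s‖ ≤ R) {s t : ℝ} (hs : s ∈ Icc 0 T)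
    (ht : t ∈ Icc 0 T) :
    dist (∫ r in (0 : ℝ)..s, f r) (∫ r in (0 : ℝ)..t, f r) ≤ R * dist s t := by
  rw [dist_eq_norm, ← integral_eq_primitive_sub hf ht hs, Real.dist_eq]
  refine intervalIntegral.norm_integral_le_of_norm_le_const_ae ?_
  filter_upwards [(ae_restrict_iff' measurableSet_Icc).1 hR] with r hr hrI
  exact hr ((uIcc_subset_Icc ht hs) (uIoc_subset_uIcc hrI))

/-- Sequential compactness of the set of admissible controls. -/
lemma Data.Regular.exists_controlTendsto (hD : D.Regular κ Cu) (hc : D.CostRegular)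
    (hU : Convex ℝ D.U) {b : ℕ → Control d ℓ m} (hb : ∀ k, b k ∈ D.admissible) :
    ∃ a' ∈ D.admissible, ∀ S : Set (WassersteinOne d), TopologicalSpace.IsSeparable S →
      ∃ ψ : ℕ → ℕ, StrictMono ψ ∧ D.ControlTendsto (b ∘ ψ) a' S := by
  have hT := hD.T_nonneg
  have hKc := convex_controlValues hU
  have hK := hc.isCompact_controlValues
  obtain ⟨R, hR0, hR⟩ := hK.isBounded.exists_pos_norm_le
  -- An ultrafilter yields limits at all times and all measures at once, before a separable set is
  -- named. The order matters, since `S` may depend on the trajectory of the limit control. It also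
  -- makes the limit feedback bounded and Lipschitz on all of `𝒲₁` without an extension argument.
  let 𝓤 : Ultrafilter ℕ := hyperfilter ℕ
  have hle : (𝓤 : Filter ℕ) ≤ atTop := Nat.hyperfilter_le_atTop
  let H : ℕ → ℝ → Fin m → Fin d → Fin ℓ → ℝ := fun k t => ∫ s in (0 : ℝ)..t, (b k).hVec s
  have hbR : ∀ k, ∀ᵐ s ∂(volume.restrict (Icc 0 D.T)), ‖(b k).hVec s‖ ≤ R := fun k => by
    filter_upwards [ae_hVec_mem (hb k)] with s hs using hR _ hs
  have hHl : ∀ k, ∀ s ∈ Icc 0 D.T, ∀ t ∈ Icc 0 D.T, dist (H k s) (H k t) ≤ R * dist s t :=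
    fun k s hs t ht => norm_integral_sub_le_of_bound (hc.integrableOn_hVec (hb k)) (hbR k) hs ht
  have hex : ∀ t, ∃ x, t ∈ Icc 0 D.T → Tendsto (fun k => H k t) 𝓤 (𝓝 x) := by
    intro t
    by_cases ht : t ∈ Icc 0 D.T
    · obtain ⟨x, _, hx⟩ := exists_tendsto_ultrafilter 𝓤
        (isCompact_closedBall (0 : Fin m → Fin d → Fin ℓ → ℝ) (R * D.T))
        (f := fun k => H k t) fun k => by
          have h1 := hHl k t ht 0 (left_mem_Icc.2 hT)
          have h2 : H k 0 = 0 := by simp [H]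
          rw [h2] at h1
          refine h1.trans ?_
          rw [Real.dist_eq, sub_zero, abs_of_nonneg ht.1]
          exact mul_le_mul_of_nonneg_left ht.2 hR0.le
      exact ⟨x, fun _ => hx⟩
    · exact ⟨0, fun h => absurd h ht⟩
  choose H' hH' using hex
  have hH'l : ∀ s ∈ Icc 0 D.T, ∀ t ∈ Icc 0 D.T, dist (H' s) (H' t) ≤ R * dist s t :=
    fun s hs t ht => le_of_tendsto ((hH' s hs).dist (hH' t ht))
      (Eventually.of_forall fun k => hHl k s hs t ht)
  obtain ⟨h', hh'i, hh'⟩ := exists_integral_eq_of_lipschitzOnWith hT (C := ⟨R, hR0.le⟩)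
    (LipschitzOnWith.of_dist_le_mul hH'l)
  have hH'0 : H' 0 = 0 := by
    refine tendsto_nhds_unique (hH' 0 (left_mem_Icc.2 hT)) ?_
    simp only [H, intervalIntegral.integral_same]
    exact tendsto_const_nhds
  have hh'' : ∀ t ∈ Icc 0 D.T, ∫ s in (0 : ℝ)..t, h' s = H' t := fun t ht => by
    rw [hh' t ht, hH'0, sub_zero]
  have hcompl : CompleteSpace (Fin m → Fin d → Fin ℓ → ℝ) := FiniteDimensional.complete ℝ _
  have hh'K : ∀ᵐ s ∂(volume.restrict (Icc 0 D.T)), h' s ∈ D.controlValues :=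
    ae_mem_of_tendsto_primitive (l := 𝓤) hKc hK.isClosed
      (Eventually.of_forall fun k => hc.integrableOn_hVec (hb k))
      (Eventually.of_forall fun k => ae_hVec_mem (hb k)) hh'i fun t ht => by
        rw [hh'' t ht]; exact hH' t ht
  have hg : ∀ j μ, ∃ x ∈ Metric.closedBall (0 : Vec ℓ) D.M,
      Tendsto (fun k => (b k).g j μ) 𝓤 (𝓝 x) := fun j μ =>
    exists_tendsto_ultrafilter 𝓤 (isCompact_closedBall _ _) fun k =>
      mem_closedBall_zero_iff.2 (((hb k).2 j).1 μ)
  choose g' hg'M hg' using hg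
  have ha' : (⟨fun j s => toMatrices (h' s) j, g'⟩ : Control d ℓ m) ∈ D.admissible := by
    refine ⟨fun j => ⟨((continuous_apply j).comp continuous_toMatrices).comp_aestronglyMeasurable
       hh'i.aestronglyMeasurable, ?_⟩,
      fun j => ⟨fun μ => mem_closedBall_zero_iff.1 (hg'M j μ), fun μ ν => ?_⟩⟩
    · filter_upwards [hh'K] with s hs using hs j
    · exact le_of_tendsto ((hg' j μ).sub (hg' j ν)).norm
        (Eventually.of_forall fun k => ((hb k).2 j).2 μ ν)
  refine ⟨_, ha', fun S hS => ?_⟩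
  obtain ⟨c, hcS, hcc, hScl⟩ := hS.exists_countable_dense_subset
  obtain ⟨q, hqI, hqc, hIcl⟩ :=
    (TopologicalSpace.IsSeparable.of_separableSpace (Icc 0 D.T)).exists_countable_dense_subset
  have : Countable c := hcc
  have : Countable q := hqc
  -- Countably many evaluations take values in a first countable space, so the ultrafilter limit is
  -- reached along a subsequence. The common Lipschitz constants then extend the convergence to all
  -- of `[0, T]` and `S`.
  let Ξ : ℕ → (q → Fin m → Fin d → Fin ℓ → ℝ) × (c → Fin m → Vec ℓ) := fun k =>
    (fun t => H k t, fun μ j => (b k).g j μ)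
  have hΞ : Tendsto Ξ 𝓤 (𝓝 (fun t => H' t, fun μ j => g' j μ)) :=
    Tendsto.prodMk_nhds (tendsto_pi_nhds.2 fun t => hH' t (hqI t.2))
      (tendsto_pi_nhds.2 fun μ => tendsto_pi_nhds.2 fun j => hg' j μ)
  obtain ⟨ψ, hψ, hlim⟩ := (hΞ.mapClusterPt.mono hle).tendsto_subseq
  refine ⟨ψ, hψ, ⟨fun k => hb _, ha', fun t ht => ?_, fun μ hμ j => ?_⟩⟩
  · change Tendsto _ _ (𝓝 (∫ s in (0 : ℝ)..t, h' s))
    rw [hh'' t ht]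
    refine tendsto_of_mem_closure (f := fun k => H (ψ k)) hR0.le hqI (fun k => hHl (ψ k)) hH'l
      (fun y hy => ?_) ht (hIcl ht)
    exact tendsto_pi_nhds.1 ((continuous_fst.tendsto _).comp hlim) ⟨y, hy⟩
  · refine tendsto_of_mem_closure (f := fun k => (b (ψ k)).g j) hD.L_nonneg (subset_univ c)
      (fun k x _ y _ => ?_) (fun x _ y _ => ?_) (fun y hy => ?_) (mem_univ μ) (hScl hμ)
    · rw [dist_eq_norm]; exact ((hb (ψ k)).2 j).2 x y
    · rw [dist_eq_norm]; exact (ha'.2 j).2 x y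
    · exact tendsto_pi_nhds.1 (tendsto_pi_nhds.1 ((continuous_snd.tendsto _).comp hlim) ⟨y, hy⟩) j

end Controls

end MeanField

namespace MeanField

/-! ### Passage to the limit in the controls. -/

section ControlLimits

variable {d ℓ m : ℕ} {D : Data d ℓ m} {κ : ℝ≥0} {Cu : ℝ} {a : ℕ → Control d ℓ m}
  {a' : Control d ℓ m} {S : Set (WassersteinOne d)} {μ : ℝ → WassersteinOne d}

lemma Data.ControlTendsto.tendsto_integral_norm_sub (hD : D.Regular κ Cu)
    (h : D.ControlTendsto a a' S) (hμ : ContinuousOn μ (Icc 0 D.T))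
    (hμS : ∀ t ∈ Icc 0 D.T, μ t ∈ S) {t : ℝ} (ht : t ∈ Icc 0 D.T) :
    Tendsto (fun k => ∫ s in (0 : ℝ)..t,
      ‖(fun j => (a k).g j (μ s)) - fun j => a'.g j (μ s)‖) atTop (𝓝 0) := by
  have hg : ∀ {b : Control d ℓ m}, b ∈ D.admissible →
      ContinuousOn (fun s j => b.g j (μ s)) (Icc 0 D.T) := fun hb =>
    continuousOn_pi.2 fun j => (hD.continuous_g hb j).comp_continuousOn hμ
  have hsub : Ioc 0 t ⊆ Icc 0 D.T := fun s hs => ⟨hs.1.le, hs.2.trans ht.2⟩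
  have key := intervalIntegral.tendsto_integral_filter_of_dominated_convergence (μ := volume)
    (a := 0) (b := t) (l := atTop) (f := fun _ => (0 : ℝ))
    (F := fun k s => ‖(fun j => (a k).g j (μ s)) - fun j => a'.g j (μ s)‖) (fun _ => D.M + D.M)
    (Eventually.of_forall fun k => ?_) (Eventually.of_forall fun k => ae_of_all _ fun s _ => ?_)
    intervalIntegrable_const (ae_of_all _ fun s hs => ?_)
  · simpa using key
  · rw [uIoc_of_le ht.1]
    exact (((hg (h.mem k)).sub (hg h.mem')).norm.mono hsub).aestronglyMeasurable measurableSet_Ioc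
  · rw [norm_norm]
    exact (norm_sub_le _ _).trans (add_le_add
      (mem_closedBall_zero_iff.1 (hD.g_mem_feedbackBall (h.mem k) _))
      (mem_closedBall_zero_iff.1 (hD.g_mem_feedbackBall h.mem' _)))
  · rw [uIoc_of_le ht.1] at hs
    refine tendsto_iff_norm_sub_tendsto_zero.1 (tendsto_pi_nhds.2 fun j => ?_)
    exact h.tendsto_g _ (hμS s (hsub hs)) j

/-- Convex control costs are lower semicontinuous. -/
lemma Data.ControlTendsto.eventually_integral_le (hD : D.Regular κ Cu) (hc : D.CostRegular)
    (hU : Convex ℝ D.U) (h : D.ControlTendsto a a' S) (hμ : ContinuousOn μ (Icc 0 D.T))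
    (hμS : ∀ t ∈ Icc 0 D.T, μ t ∈ S)
    {Φ : (Fin m → Matrix (Fin d) (Fin ℓ) ℝ) × (Fin m → Vec ℓ) → ℝ} (hΦ : Continuous Φ)
    (hconv : ∀ z, ConvexOn ℝ univ fun x => Φ (x, z)) {t : ℝ} (ht : t ∈ Icc 0 D.T) {ε : ℝ}
    (hε : 0 < ε) :
    ∀ᶠ k in atTop, ∫ s in (0 : ℝ)..t, Φ (fun j => a'.h j s, fun j => a'.g j (μ s)) ≤
      (∫ s in (0 : ℝ)..t, Φ (fun j => (a k).h j s, fun j => (a k).g j (μ s))) + ε := by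
  have hT := hD.T_nonneg
  have ht0 := ht.1
  have hsub : Icc 0 t ⊆ Icc 0 D.T := Icc_subset_Icc_right ht.2
  have hsub' : volume.restrict (Icc 0 t) ≤ volume.restrict (Icc 0 D.T) :=
    Measure.restrict_mono hsub le_rfl
  -- The feedback is first frozen at its limit along `μ`, so that the integrand is convex in `h`
  -- with a continuous dependence on time; passing from `a'.g` to `(a k).g` is estimated afterwards.
  -- Time is projected onto `[0, T]` to make `ζ` continuous everywhere.
  let ζ : ℝ → Fin m → Vec ℓ := fun s j => a'.g j (μ (projIcc 0 D.T hT s))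
  have hζ : Continuous ζ := continuous_pi fun j => (hD.continuous_g h.mem' j).comp
    (hμ.comp_continuous (continuous_subtype_val.comp continuous_projIcc)
      fun s => (projIcc 0 D.T hT s).2)
  have hζ_eq : ∀ s ∈ Icc 0 t, ζ s = fun j => a'.g j (μ s) := fun s hs => by
    simp only [ζ, projIcc_of_mem hT (hsub hs)]
  have hΦ' : Continuous fun q : (Fin m → Fin d → Fin ℓ → ℝ) × ℝ => Φ (toMatrices q.1, ζ q.2) :=
    hΦ.comp ((continuous_toMatrices.comp continuous_fst).prodMk (hζ.comp continuous_snd))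
  have hlsc := eventually_integral_le_of_tendsto_primitive (T := t) hΦ'
    (fun s => ⟨convex_univ, fun x _ y _ _ _ hp hq hpq =>
      (hconv (ζ s)).2 (mem_univ (toMatrices x)) (mem_univ (toMatrices y)) hp hq hpq⟩)
    hc.isCompact_controlValues (convex_controlValues hU) ht.1
    (fun k => (hc.integrableOn_hVec (h.mem k)).mono_set hsub)
    ((hc.integrableOn_hVec h.mem').mono_set hsub)
    (fun k => ae_mono hsub' (ae_hVec_mem (h.mem k))) (ae_mono hsub' (ae_hVec_mem h.mem'))
    (fun s hs => h.tendsto_h s (hsub hs)) (half_pos hε)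
  set ε' : ℝ := ε / (4 * (t + 1)) with hε'
  have hε'0 : 0 < ε' := by positivity
  have hTε' : t * ε' ≤ ε / 4 := by
    rw [hε', mul_div_assoc', div_le_div_iff₀ (by positivity) (by norm_num)]
    nlinarith
  obtain ⟨C, hC, hΦC⟩ := exists_abs_sub_le_of_isCompact hΦ
    (isCompact_univ_pi fun _ : Fin m => hc.isCompact_U) (isCompact_feedbackBall D) hε'0
  have hw := (h.tendsto_integral_norm_sub hD hμ hμS ht).const_mul C
  rw [mul_zero] at hw
  filter_upwards [hlsc, hw.eventually (gt_mem_nhds (show 0 < ε / 4 by positivity))] with k hk hk'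
  have hg : ∀ {b : Control d ℓ m}, b ∈ D.admissible →
      ContinuousOn (fun s j => b.g j (μ s)) (Icc 0 D.T) := fun hb =>
    continuousOn_pi.2 fun j => (hD.continuous_g hb j).comp_continuousOn hμ
  have e1 : ∫ s in (0 : ℝ)..t, Φ (toMatrices (a'.hVec s), ζ s) =
      ∫ s in (0 : ℝ)..t, Φ (fun j => a'.h j s, fun j => a'.g j (μ s)) := by
    refine intervalIntegral.integral_congr fun s hs => ?_
    rw [uIcc_of_le ht.1] at hs
    simp only [hζ_eq s hs]
    rfl
  have i2 : IntegrableOn (fun s => Φ (toMatrices ((a k).hVec s), ζ s)) (Icc 0 t) := by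
    have h1 := hD.integrableOn_comp_control hc (a := ⟨(a k).h, a'.g⟩) hΦ
      ⟨(h.mem k).1, h.mem'.2⟩ hμ
    refine (h1.mono_set hsub).congr ?_
    filter_upwards [ae_restrict_mem measurableSet_Icc] with s hs
    simp only [hζ_eq s hs]
    rfl
  have e2 := abs_integral_sub_integral_le ht.1 (K := C) (ε := ε') i2
    ((hD.integrableOn_comp_control hc hΦ (h.mem k) hμ).mono_set hsub)
    (w := fun s => ‖(fun j => (a k).g j (μ s)) - fun j => a'.g j (μ s)‖)
    (((hg (h.mem k)).sub (hg h.mem')).norm.mono hsub) (by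
      filter_upwards [ae_mono hsub' (ae_h_mem (h.mem k)), ae_restrict_mem measurableSet_Icc]
        with s hs hst
      rw [hζ_eq s hst, norm_sub_rev]
      exact hΦC _ hs _ (hD.g_mem_feedbackBall h.mem' _) _ (hD.g_mem_feedbackBall (h.mem k) _))
  rw [e1] at hk
  have e3 := (abs_le.1 e2).2
  linarith

lemma toEuclideanLin_apply_eq_sum (A : Matrix (Fin d) (Fin ℓ) ℝ) (v : Vec ℓ) (p : Fin d) :
    Matrix.toEuclideanLin A v p = ∑ q, A p q * v q := by
  simp [Matrix.toLpLin_apply, Matrix.mulVec, dotProduct]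

/-- Each coordinate of `hⁱ gⁱ` is linear in `h`, so the coordinate and its negative are both convex;
lower semicontinuity of the two integrals amounts to convergence. -/
lemma Data.ControlTendsto.tendsto_integral_u (hD : D.Regular κ Cu) (hc : D.CostRegular)
    (hU : Convex ℝ D.U) (h : D.ControlTendsto a a' S) (hμ : ContinuousOn μ (Icc 0 D.T))
    (hμS : ∀ t ∈ Icc 0 D.T, μ t ∈ S) (i : Fin m) {t : ℝ} (ht : t ∈ Icc 0 D.T) :
    Tendsto (fun k => ∫ s in (0 : ℝ)..t, (a k).u i s (μ s)) atTop
      (𝓝 (∫ s in (0 : ℝ)..t, a'.u i s (μ s))) := by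
  have hcoord : ∀ p, Tendsto (fun k => (∫ s in (0 : ℝ)..t, (a k).u i s (μ s)) p) atTop
      (𝓝 ((∫ s in (0 : ℝ)..t, a'.u i s (μ s)) p)) := by
    intro p
    have e : ∀ {b : Control d ℓ m}, b ∈ D.admissible → (∫ s in (0 : ℝ)..t, b.u i s (μ s)) p =
        ∫ s in (0 : ℝ)..t, b.u i s (μ s) p := fun hb =>
      ((EuclideanSpace.proj (𝕜 := ℝ) p).intervalIntegral_comp_comm
        (intervalIntegrable_of_integrableOn_Icc (hD.integrableOn_u hb i hμ)
          (left_mem_Icc.2 hD.T_nonneg) ht)).symm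
    let Φ : (Fin m → Matrix (Fin d) (Fin ℓ) ℝ) × (Fin m → Vec ℓ) → ℝ := fun q =>
      ∑ r, q.1 i p r * q.2 i r
    have hΦ : Continuous Φ := by fun_prop
    have hlin : ∀ z x y (α β : ℝ), Φ (α • x + β • y, z) = α * Φ (x, z) + β * Φ (y, z) := by
      intro z x y α β
      simp only [Φ, Pi.add_apply, Pi.smul_apply, Matrix.add_apply, Matrix.smul_apply, smul_eq_mul,
        Finset.mul_sum, ← Finset.sum_add_distrib]
      exact Finset.sum_congr rfl fun _ _ => by ring
    have hlsc := fun {ε : ℝ} (hε : 0 < ε) => h.eventually_integral_le hD hc hU hμ hμS hΦ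
      (fun z => ⟨convex_univ, fun x _ y _ α β _ _ _ => (hlin z x y α β).le⟩) ht hε
    have husc := fun {ε : ℝ} (hε : 0 < ε) => h.eventually_integral_le hD hc hU hμ hμS
      (Φ := fun q => -Φ q) hΦ.neg
      (fun z => ⟨convex_univ, fun x _ y _ α β _ _ _ => by
        simp only [hlin, smul_eq_mul]; linarith⟩) ht hε
    rw [Metric.tendsto_nhds]
    intro ε hε
    filter_upwards [hlsc (half_pos hε), husc (half_pos hε)] with k h1 h2
    rw [e (h.mem k), e h.mem', Real.dist_eq, abs_lt]
    rw [intervalIntegral.integral_neg, intervalIntegral.integral_neg] at h2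
    simp only [Control.u, toEuclideanLin_apply_eq_sum]
    constructor <;> linarith
  exact ((PiLp.continuous_toLp 2 _).tendsto _).comp (tendsto_pi_nhds.2 hcoord)

/-- The primitives have the common Lipschitz constant `Cu * M`, so their pointwise convergence is
uniform in time. -/
lemma Data.ControlTendsto.eventually_gap_le (hD : D.Regular κ Cu) (hc : D.CostRegular)
    (hU : Convex ℝ D.U) (h : D.ControlTendsto a a' S) (hμ : ContinuousOn μ (Icc 0 D.T))
    (hμS : ∀ t ∈ Icc 0 D.T, μ t ∈ S) {ε : ℝ} (hε : 0 < ε) :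
    ∀ᶠ k in atTop, ∀ i, ∀ t ∈ Icc 0 D.T,
      ‖(∫ s in (0 : ℝ)..t, (a k).u i s (μ s)) - ∫ s in (0 : ℝ)..t, a'.u i s (μ s)‖ ≤ ε := by
  refine eventually_all.2 fun i => ?_
  have hl : ∀ {b : Control d ℓ m}, b ∈ D.admissible → ∀ s ∈ Icc 0 D.T, ∀ t ∈ Icc 0 D.T,
      dist (∫ r in (0 : ℝ)..s, b.u i r (μ r)) (∫ r in (0 : ℝ)..t, b.u i r (μ r)) ≤
        Cu * D.M * dist s t := fun hb s hs t ht =>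
    norm_integral_sub_le_of_bound (hD.integrableOn_u hb i hμ) (by
      filter_upwards [hD.ae_norm_u_le hb i] with r hr using hr _) hs ht
  have := eventually_forall_dist_le (mul_nonneg hD.Cu_nonneg hD.M_nonneg) isCompact_Icc
    (fun k => hl (h.mem k)) (hl h.mem') (fun t ht => h.tendsto_integral_u hD hc hU hμ hμS i ht) hε
  simpa only [dist_eq_norm] using this

/-- The cost is lower semicontinuous in the control, if the trajectories are stable. -/
lemma Data.ControlTendsto.eventually_pathCost_le (hD : D.Regular κ Cu) (hc : D.CostRegular)
    (hU : Convex ℝ D.U) (hΨ : ∀ z, ConvexOn ℝ univ fun x => D.controlCost x z)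
    (h : D.ControlTendsto a a' S) {Y : Fin m → ℝ → Vec d} (hμ : ContinuousOn μ (Icc 0 D.T))
    (hY : ∀ i, ContinuousOn (Y i) (Icc 0 D.T)) (hμS : ∀ t ∈ Icc 0 D.T, μ t ∈ S)
    {μ' : ℕ → ℝ → WassersteinOne d} {Y' : ℕ → Fin m → ℝ → Vec d}
    (hμ' : ∀ k, ContinuousOn (μ' k) (Icc 0 D.T)) (hY' : ∀ k i, ContinuousOn (Y' k i) (Icc 0 D.T))
    {C : ℝ} (hC : 0 ≤ C)
    (hstab : ∀ k δ, 0 ≤ δ → (∀ i, ∀ t ∈ Icc 0 D.T,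
      ‖(∫ s in (0 : ℝ)..t, (a k).u i s (μ s)) - ∫ s in (0 : ℝ)..t, a'.u i s (μ s)‖ ≤ δ) →
      ∀ t ∈ Icc 0 D.T, flowDist (μ' k) μ (Y' k) Y t ≤ C * δ) {ε : ℝ} (hε : 0 < ε) :
    ∀ᶠ k in atTop, D.pathCost a' (fun t i => Y i t) μ ≤
      D.pathCost (a k) (fun t i => Y' k i t) (μ' k) + ε := by
  have hT := hD.T_nonneg
  obtain ⟨A, hA, hcost⟩ := hD.exists_abs_pathCost_sub_le hc (show 0 < ε / 3 by positivity)
  -- The trajectory is replaced first, under the control `a k`: this costs `ε / 3` from the modulus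
  -- and `ε / 3` from the gap `δ`. The control is replaced afterwards, along the limit trajectory,
  -- for the last `ε / 3`.
  set δ : ℝ := ε / (3 * (A * D.T * C + 1)) with hδ
  have hδ0 : 0 < δ := by positivity
  have hδ' : A * (D.T * (C * δ)) ≤ ε / 3 := by
    have : A * (D.T * (C * δ)) = A * D.T * C * δ := by ring
    rw [this, hδ, mul_div_assoc', div_le_div_iff₀ (by positivity) (by norm_num)]
    nlinarith
  filter_upwards [h.eventually_gap_le hD hc hU hμ hμS hδ0,
    h.eventually_integral_le hD hc hU hμ hμS hc.controlCost hΨ (right_mem_Icc.2 hT)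
      (show 0 < ε / 3 by positivity)] with k hgap hlsc
  have h1 := hcost (a k) (h.mem k) (Y' k) Y (μ' k) μ (hY' k) hY (hμ' k) hμ
  have h2 : ∫ t in (0 : ℝ)..D.T, flowDist (μ' k) μ (Y' k) Y t ≤ D.T * (C * δ) := by
    refine (intervalIntegral.integral_mono_on hT (intervalIntegrable_of_continuousOn_Icc
      (continuousOn_flowDist (hμ' k) hμ (hY' k) hY) (right_mem_Icc.2 hT))
      intervalIntegrable_const (hstab k δ hδ0.le hgap)).trans_eq ?_
    rw [intervalIntegral.integral_const, sub_zero, smul_eq_mul]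
  have h3 : A * ∫ t in (0 : ℝ)..D.T, flowDist (μ' k) μ (Y' k) Y t ≤ A * (D.T * (C * δ)) := by
    gcongr
  have h4 := (abs_le.1 h1).1
  have h5 : D.pathCost a' (fun t i => Y i t) μ ≤ D.pathCost (a k) (fun t i => Y i t) μ + ε / 3 := by
    unfold pathCost
    linarith
  linarith

end ControlLimits

end MeanField

namespace MeanField

/-! ### Existence of minimisers. -/

section Attainment

/-- The direct method, with lower semicontinuity along subsequences in place of a topology on `s`.
-/
lemma exists_isMinOn_of_seq {α : Type*} {s : Set α} (hs : s.Nonempty) {F : α → ℝ}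
    (hF : BddBelow (F '' s))
    (h : ∀ b : ℕ → α, (∀ k, b k ∈ s) → ∃ x ∈ s, ∃ ψ : ℕ → ℕ, StrictMono ψ ∧
      ∀ ε > 0, ∀ᶠ k in atTop, F x ≤ F (b (ψ k)) + ε) : ∃ x ∈ s, IsMinOn F s x := by
  obtain ⟨u, _, hu, hus⟩ := exists_seq_tendsto_sInf (hs.image F) hF
  choose b hb hbu using hus
  obtain ⟨x, hx, ψ, hψ, hlsc⟩ := h b hb
  refine ⟨x, hx, fun y hy => ?_⟩
  have h1 : F x ≤ sInf (F '' s) := by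
    refine le_of_forall_pos_le_add fun ε hε => ?_
    have h2 : Tendsto (fun k => F (b (ψ k)) + ε) atTop (𝓝 (sInf (F '' s) + ε)) := by
      simp only [hbu]
      exact (hu.comp hψ.tendsto_atTop).add_const ε
    exact ge_of_tendsto h2 (hlsc ε hε)
  exact h1.trans (csInf_le hF (mem_image_of_mem F hy))

variable {d ℓ m : ℕ} {D : Data d ℓ m} {κ : ℝ≥0} {Cu : ℝ}
  {Ω : Type*} [MeasurableSpace Ω] {P : Measure Ω} [IsProbabilityMeasure P]

/-- Stability compares the controls along the limit flow only. This flow is a continuous curve with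
compact, hence separable, range, so convergence of the feedbacks on that range suffices. -/
lemma Data.Regular.exists_isMinOn_meanField (hD : D.Regular κ Cu) (hc : D.CostRegular)
    (hU : Convex ℝ D.U) (hΨ : ∀ z, ConvexOn ℝ univ fun x => D.controlCost x z)
    (hne : D.admissible.Nonempty) {X₀ : Ω → Vec d} {W : ℝ≥0 → Ω → Vec d}
    (hX₀ : Measurable X₀) (hX₀i : Integrable X₀ P) (hW : IsBrownianVec W P)
    (hbdd : BddBelow (D.meanFieldFunctional P X₀ W '' D.admissible)) :
    ∃ a ∈ D.admissible, IsMinOn (D.meanFieldFunctional P X₀ W) D.admissible a := by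
  refine exists_isMinOn_of_seq hne hbdd fun b hb => ?_
  obtain ⟨a', ha', hcpt⟩ := hD.exists_controlTendsto hc hU hb
  obtain ⟨⟨X, μ, Y, h⟩, hval⟩ := hD.meanFieldWellPosed hc ha' hX₀ hX₀i hW
  have hf := h.leaderFlow hD hX₀ hX₀i hW
  obtain ⟨ψ, hψ, hlim⟩ := hcpt (μ '' Icc 0 D.T)
    (isCompact_Icc.image_of_continuousOn hf.continuous_μ).isSeparable
  refine ⟨a', ha', ψ, hψ, fun ε hε => ?_⟩
  choose hex hval' using fun k => hD.meanFieldWellPosed hc (hb (ψ k)) hX₀ hX₀i hW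
  choose X' μ' Y' h' using hex
  have hf' := fun k => (h' k).leaderFlow hD hX₀ hX₀i hW
  rw [(hval X μ Y h).2]
  simp only [fun k => (hval' k _ _ _ (h' k)).2]
  exact hlim.eventually_pathCost_le hD hc hU hΨ hf.continuous_μ hf.continuous_Y
    (fun t ht => mem_image_of_mem μ ht) (fun k => (hf' k).continuous_μ)
    (fun k => (hf' k).continuous_Y) (zero_le_one.trans hD.one_le_flowConst)
    (fun k δ hδ hgap => (h' k).flowDist_le hD (hb _) h hX₀ hX₀i hW hδ hgap) hε

variable {X₀ : ℕ → Ω → Vec d} {W : ℕ → ℝ≥0 → Ω → Vec d} {X₀' : Ω → Vec d} {W' : ℝ≥0 → Ω → Vec d}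

/-- The random flows stay in the set of empirical measures of `N` points, a continuous image of a
separable space, so one subsequence serves every `ω`. Semicontinuity holds for almost every `ω` and
passes to expectations through the positive part of the cost difference. -/
lemma Data.Regular.exists_isMinOn_discrete (hD : D.Regular κ Cu) (hc : D.CostRegular)
    (hU : Convex ℝ D.U) (hΨ : ∀ z, ConvexOn ℝ univ fun x => D.controlCost x z)
    (hne : D.admissible.Nonempty) (hn : IsFollowerNoise P X₀ W X₀' W') (N : ℕ) [NeZero N]
    (hbdd : BddBelow (D.discreteFunctional P (fun n : Fin N => X₀ n) (fun n : Fin N => W n) ''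
      D.admissible)) :
    ∃ a ∈ D.admissible,
      IsMinOn (D.discreteFunctional P (fun n : Fin N => X₀ n) (fun n : Fin N => W n))
        D.admissible a := by
  have hT := hD.T_nonneg
  have hCM := mul_nonneg hD.Cu_nonneg hD.M_nonneg
  have hF := hD.one_le_flowConst
  refine exists_isMinOn_of_seq hne hbdd fun b hb => ?_
  obtain ⟨a', ha', hcpt⟩ := hD.exists_controlTendsto hc hU hb
  obtain ⟨⟨X, Y, h⟩, hval⟩ := hD.discreteWellPosed (N := N) hc hn ha'
  have hec : Continuous (empirical : (Fin N → Vec d) → WassersteinOne d) :=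
    lipschitzWith_empirical.continuous
  obtain ⟨ψ, hψ, hlim⟩ := hcpt (range (empirical : (Fin N → Vec d) → WassersteinOne d))
    (TopologicalSpace.isSeparable_range hec)
  refine ⟨a', ha', ψ, hψ, ?_⟩
  choose hex hval' using fun k => hD.discreteWellPosed (N := N) hc hn (hb (ψ k))
  choose X' Y' h' using hex
  have hi := (hval X Y h).2.1
  have hi' := fun k => (hval' k _ _ (h' k)).2.1
  rw [(hval X Y h).2.2]
  simp only [fun k => (hval' k _ _ (h' k)).2.2]
  obtain ⟨A, hA, hcost⟩ := hD.exists_abs_pathCost_sub_le hc one_pos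
  obtain ⟨B, hB, hΨB⟩ := hc.exists_controlCost_bound
  -- Changing the trajectory under the control `b (ψ k)` costs at most `1 + A * (D.T * flowDiam D κ
  -- Cu)`, changing the control along the limit trajectory at most `2 * (D.T * B)`.
  set C₀ : ℝ := 1 + A * (D.T * flowDiam D κ Cu) + 2 * (D.T * B)
  have hpaths : ∀ᵐ ω ∂P, ∀ k, ∀ δ, 0 ≤ δ → (∀ i, ∀ t ∈ Icc 0 D.T,
      ‖(∫ s in (0 : ℝ)..t, (b (ψ k)).u i s (empirical fun n => X n s ω)) -
        ∫ s in (0 : ℝ)..t, a'.u i s (empirical fun n => X n s ω)‖ ≤ δ) →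
      ∀ t ∈ Icc 0 D.T, flowDist (fun t => empirical fun n => X' k n t ω)
        (fun t => empirical fun n => X n t ω) (fun i t => Y' k i t ω) (fun i t => Y i t ω) t ≤
          flowConst D κ Cu * δ := by
    filter_upwards [h.ae_paths, ae_all_iff.2 fun k => (h' k).ae_paths] with ω hω hω' k δ hδ hgap
    intro t ht
    have := hD.flowDist_empirical_le (hb (ψ k)) (hω' k).1 hω.1 (hω' k).2 hω.2 hδ hgap t ht
    simpa [wDist_self] using this
  have hcX : ∀ ω, ContinuousOn (fun t => empirical fun n => X n t ω) (Icc 0 D.T) := fun ω =>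
    hec.comp_continuousOn (continuousOn_pi.2 fun n => h.continuous_X n ω)
  have hcX' : ∀ k ω, ContinuousOn (fun t => empirical fun n => X' k n t ω) (Icc 0 D.T) :=
    fun k ω => hec.comp_continuousOn (continuousOn_pi.2 fun n => (h' k).continuous_X n ω)
  -- the positive part of the difference of the costs is bounded and tends to zero
  let f : ℕ → Ω → ℝ := fun k ω =>
    max (D.discreteCost a' X Y ω - D.discreteCost (b (ψ k)) (X' k) (Y' k) ω) 0
  have hfi : ∀ k, Integrable (f k) P := fun k => (hi.sub (hi' k)).sup (integrable_const 0)
  have hfb : ∀ k, ∀ᵐ ω ∂P, ‖f k ω‖ ≤ C₀ := by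
    intro k
    filter_upwards [hpaths] with ω hω
    have h1 := hω k (2 * (Cu * D.M) * D.T) (by positivity)
      fun i t ht => hD.abs_gap_le (hb _) ha' (hcX ω) i ht
    have h2 := hcost (b (ψ k)) (hb _) (fun i t => Y' k i t ω) (fun i t => Y i t ω) _ _
      (fun i => (h' k).continuous_Y i ω) (fun i => h.continuous_Y i ω) (hcX' k ω) (hcX ω)
    have h3 : ∫ t in (0 : ℝ)..D.T, flowDist (fun t => empirical fun n => X' k n t ω)
        (fun t => empirical fun n => X n t ω) (fun i t => Y' k i t ω) (fun i t => Y i t ω) t ≤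
        D.T * flowDiam D κ Cu := by
      refine (intervalIntegral.integral_mono_on hT (intervalIntegrable_of_continuousOn_Icc
        (continuousOn_flowDist (hcX' k ω) (hcX ω) (fun i => (h' k).continuous_Y i ω)
          fun i => h.continuous_Y i ω) (right_mem_Icc.2 hT)) intervalIntegrable_const h1).trans_eq ?_
      rw [intervalIntegral.integral_const, sub_zero, smul_eq_mul, flowDiam]
    have h4 : A * ∫ t in (0 : ℝ)..D.T, flowDist (fun t => empirical fun n => X' k n t ω)
        (fun t => empirical fun n => X n t ω) (fun i t => Y' k i t ω) (fun i t => Y i t ω) t ≤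
        A * (D.T * flowDiam D κ Cu) := by gcongr
    have h5 := (abs_le.1 h2).1
    have h6 := abs_le.1 (hD.abs_integral_controlCost_le hΨB ha'
      fun t => empirical fun n => X n t ω)
    have h7 := abs_le.1 (hD.abs_integral_controlCost_le hΨB (hb (ψ k))
      fun t => empirical fun n => X n t ω)
    have h8 : D.pathCost a' (fun t i => Y i t ω) (fun t => empirical fun n => X n t ω) ≤
        D.pathCost (b (ψ k)) (fun t i => Y i t ω) (fun t => empirical fun n => X n t ω) +
          2 * (D.T * B) := by
      unfold pathCost
      linarith [h6.2, h7.1]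
    have hd := hD.flowDiam_nonneg
    rw [Real.norm_of_nonneg (le_max_right _ _)]
    refine max_le ?_ (by positivity)
    unfold discreteCost
    linarith
  have hf0 : Tendsto (fun k => ∫ ω, f k ω ∂P) atTop (𝓝 (∫ _ω, (0 : ℝ) ∂P)) := by
    refine tendsto_integral_of_dominated_convergence (fun _ => C₀)
      (fun k => (hfi k).aestronglyMeasurable) (integrable_const _) hfb ?_
    filter_upwards [hpaths] with ω hω
    have key := fun {ε : ℝ} (hε : 0 < ε) => hlim.eventually_pathCost_le hD hc hU hΨ
      (Y := fun i t => Y i t ω) (Y' := fun k i t => Y' k i t ω) (hcX ω)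
      (fun i => h.continuous_Y i ω) (fun t _ => mem_range_self _) (fun k => hcX' k ω)
      (fun k i => (h' k).continuous_Y i ω) (zero_le_one.trans hF) hω hε
    rw [Metric.tendsto_nhds]
    intro ε hε
    filter_upwards [key (half_pos hε)] with k hk
    rw [Real.dist_eq, sub_zero, abs_of_nonneg (le_max_right _ _)]
    refine max_lt ?_ hε
    unfold discreteCost
    simp only [Function.comp_apply] at hk
    linarith
  rw [integral_zero] at hf0
  intro ε hε
  filter_upwards [hf0.eventually (gt_mem_nhds hε)] with k hk
  have h1 : ∫ ω, D.discreteCost a' X Y ω ∂P - ∫ ω, D.discreteCost (b (ψ k)) (X' k) (Y' k) ω ∂P ≤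
      ∫ ω, f k ω ∂P := by
    rw [← integral_sub hi (hi' k)]
    exact integral_mono (hi.sub (hi' k)) (hfi k) fun ω => le_max_left _ _
  linarith

end Attainment

end MeanField

namespace MeanField

/-! ### Constants from the hypotheses. -/

section Hypotheses

variable {d ℓ m : ℕ}

lemma exists_norm_toEuclideanLin_le {U : Set (Matrix (Fin d) (Fin ℓ) ℝ)} (hU : IsCompact U) :
    ∃ C, 0 ≤ C ∧ ∀ A ∈ U, ∀ v, ‖Matrix.toEuclideanLin A v‖ ≤ C * ‖v‖ := by
  obtain ⟨B, hB⟩ := (hU.prod (isCompact_closedBall (0 : Vec ℓ) 1)).exists_bound_of_continuousOn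
    continuous_toEuclideanLin_apply.continuousOn
  refine ⟨max B 0, le_max_right _ _, fun A hA v => ?_⟩
  rcases eq_or_ne v 0 with rfl | hv
  · simp
  have hv' : 0 < ‖v‖ := norm_pos_iff.2 hv
  have h1 := hB (A, ‖v‖⁻¹ • v) ⟨hA, by
    rw [mem_closedBall_zero_iff, norm_smul, norm_inv, norm_norm, inv_mul_cancel₀ hv'.ne']⟩
  simp only [map_smul, norm_smul, norm_inv, norm_norm] at h1
  rw [inv_mul_le_iff₀ hv', mul_comm] at h1
  exact h1.trans (by gcongr; exact le_max_left _ _)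

/-- Since `r ≤ 1 + r ^ p`, the first moment is finite; the proof of the theorem uses the `p`-th
moment in no other way. -/
lemma MemWasserstein.integrable_id {p : ℝ} {μ : Measure (Vec d)} (hμ : MemWasserstein p μ)
    (hp : 1 ≤ p) : Integrable (fun x => x) μ := by
  have := hμ.isProbability
  refine ⟨aestronglyMeasurable_id, ?_⟩
  calc ∫⁻ x, ‖x‖ₑ ∂μ ≤ ∫⁻ x, (1 + ‖x‖ₑ ^ p) ∂μ := by
        refine lintegral_mono fun x => ?_
        rcases le_total ‖x‖ₑ 1 with h | h
        · exact h.trans le_self_add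
        · refine le_trans ?_ le_add_self
          simpa using ENNReal.rpow_le_rpow_of_exponent_le h hp
    _ = 1 + ∫⁻ x, ‖x‖ₑ ^ p ∂μ := by
        rw [lintegral_add_left measurable_const]; simp
    _ < ∞ := ENNReal.add_lt_top.2 ⟨ENNReal.one_lt_top, hμ.moment_lt_top⟩

lemma admissible_nonempty {D : Data d ℓ m} (hU : D.U.Nonempty) (hM : 0 ≤ D.M) (hL : 0 ≤ D.L) :
    D.admissible.Nonempty := by
  obtain ⟨A, hA⟩ := hU
  refine ⟨⟨fun _ _ => A, fun _ _ => 0⟩, fun j => ⟨aestronglyMeasurable_const, ae_of_all _ fun _ => hA⟩,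
    fun j => ⟨fun μ => by simpa using hM, fun μ ν => ?_⟩⟩
  simpa using mul_nonneg hL (wDist_nonneg μ ν)

end Hypotheses

end MeanField

theorem mainTheorem2 {d ℓ m : ℕ} (hd : 1 ≤ d) (hℓ : 1 ≤ ℓ) (hm : 1 ≤ m)
    (D : MeanField.Data d ℓ m) (hT : 0 < D.T) (hσ : 0 < D.σ)
    (hH₁ : ∃ C, LipschitzWith C D.H₁) (hH₂ : ∃ C, LipschitzWith C D.H₂)
    (hK₁ : ∃ C, LipschitzWith C D.K₁) (hK₂ : ∃ C, LipschitzWith C D.K₂)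
    (hU : IsCompact D.U) (hU' : D.U.Nonempty) (hM : 0 < D.M) (hL : 0 < D.L)
    (hLag : D.LagrangianUniformContinuous)
    (hΨ : Continuous fun q : (Fin m → Matrix (Fin d) (Fin ℓ) ℝ) × (Fin m → Vec ℓ) =>
      D.controlCost q.1 q.2)
    (hΨ' : ∀ z, ConvexOn ℝ univ fun h => D.controlCost h z)
    {p : ℝ} (hp : 1 < p) {μ₀ : Measure (Vec d)} (hμ₀ : MemWasserstein p μ₀)
    {Ω : Type*} [MeasurableSpace Ω] {P : Measure Ω} [IsProbabilityMeasure P]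
    -- the initial positions and the Brownian motions of the followers
    {X₀ : ℕ → Ω → Vec d} {W : ℕ → ℝ≥0 → Ω → Vec d}
    (hX₀m : ∀ n, Measurable (X₀ n)) (hX₀ : ∀ n, HasLaw (X₀ n) μ₀ P) (hX₀i : iIndepFun X₀ P)
    (hW : ∀ n, IsBrownianVec (W n) P)
    (hWi : iIndepFun (fun (n : ℕ) (ω : Ω) (t : ℝ≥0) => W n t ω) P)
    (hX₀W : IndepFun (fun (ω : Ω) (n : ℕ) => X₀ n ω)
      (fun (ω : Ω) (n : ℕ) (t : ℝ≥0) => W n t ω) P)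
    -- the initial position and the Brownian motion of the mean-field follower
    {X₀' : Ω → Vec d} {W' : ℝ≥0 → Ω → Vec d}
    (hX₀m' : Measurable X₀') (hX₀' : HasLaw X₀' μ₀ P) (hW' : IsBrownianVec W' P)
    (hX₀W' : IndepFun X₀' (fun (ω : Ω) (t : ℝ≥0) => W' t ω) P) :
    let F : (N : ℕ) → [NeZero N] → Control d ℓ m → ℝ := fun N _ a =>
      D.discreteFunctional P (fun n : Fin N => X₀ n) (fun n : Fin N => W n) a
    let F' : Control d ℓ m → ℝ := D.meanFieldFunctional P X₀' W'
    -- the functionals are well defined on `Eᵐ` and bounded from below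
    (∀ a ∈ D.admissible,
      (∀ (N : ℕ) [NeZero N],
        D.DiscreteWellPosed P (fun n : Fin N => X₀ n) (fun n : Fin N => W n) a) ∧
      D.MeanFieldWellPosed P X₀' W' a) ∧
    D.admissible.Nonempty ∧
    (∀ (N : ℕ) [NeZero N], BddBelow (F N '' D.admissible)) ∧
    BddBelow (F' '' D.admissible) ∧
    -- the infima over `Eᵐ` are attained
    (Convex ℝ D.U →
      (∀ (N : ℕ) [NeZero N], ∃ a ∈ D.admissible, IsMinOn (F N) D.admissible a) ∧
      ∃ a ∈ D.admissible, IsMinOn F' D.admissible a) ∧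
    -- the infimum of `𝓕_N` (here for `N + 1` followers) converges to the infimum of `𝓕`
    Tendsto (fun N : ℕ => sInf (F (N + 1) '' D.admissible)) atTop
      (𝓝 (sInf (F' '' D.admissible))) := by
  intro F F'
  obtain ⟨C₁, h₁⟩ := hH₁
  obtain ⟨C₂, h₂⟩ := hH₂
  obtain ⟨C₃, h₃⟩ := hK₁
  obtain ⟨C₄, h₄⟩ := hK₂
  obtain ⟨Cu, hCu, hnorm⟩ := exists_norm_toEuclideanLin_le hU
  have hD : D.Regular (C₁ ⊔ C₂ ⊔ C₃ ⊔ C₄) Cu :=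
    ⟨hT.le, h₁.weaken (by simp), h₂.weaken (by simp), h₃.weaken (by simp), h₄.weaken (by simp),
      hCu, hnorm, hM.le, hL.le⟩
  have hc : D.CostRegular := ⟨hLag, hΨ, hU⟩
  have hX₀i' : Integrable X₀' P := by
    have h := hμ₀.integrable_id hp.le
    rw [← hX₀'.map_eq] at h
    exact (integrable_map_measure aestronglyMeasurable_id hX₀'.aemeasurable).1 h
  have hn : IsFollowerNoise P X₀ W X₀' W' :=
    ⟨hX₀m, fun n => (hX₀ n).map_eq.trans hX₀'.map_eq.symm, hX₀i, hW, hWi, hX₀W, hX₀m', hX₀i', hW',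
      hX₀W'⟩
  have hne : D.admissible.Nonempty := admissible_nonempty hU' hM.le hL.le
  obtain ⟨B, hB⟩ := hD.exists_abs_discreteFunctional_le hc hn
  obtain ⟨B', hB'⟩ := hD.exists_abs_meanFieldFunctional_le hc hX₀m' hX₀i' hW'
  have hbdd : ∀ (N : ℕ) [NeZero N], BddBelow (F N '' D.admissible) := fun N _ =>
    ⟨-B, by rintro _ ⟨a, ha, rfl⟩; exact (abs_le.1 (hB N a ha)).1⟩
  have hbdd' : BddBelow (F' '' D.admissible) :=
    ⟨-B', by rintro _ ⟨a, ha, rfl⟩; exact (abs_le.1 (hB' a ha)).1⟩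
  refine ⟨fun a ha => ⟨fun N _ => hD.discreteWellPosed hc hn ha,
    hD.meanFieldWellPosed hc ha hX₀m' hX₀i' hW'⟩, hne, hbdd, hbdd', fun hconv => ⟨fun N _ =>
      hD.exists_isMinOn_discrete hc hconv hΨ' hne hn N (hbdd N),
      hD.exists_isMinOn_meanField hc hconv hΨ' hne hX₀m' hX₀i' hW' hbdd'⟩, ?_⟩
  -- The shift to `N + 1` followers supplies `NeZero` and only improves on the threshold `N₀`.
  refine tendsto_sInf_image hne (fun N => hbdd (N + 1)) hbdd' fun ε hε => ?_
  obtain ⟨N₀, hN₀⟩ := hD.exists_forall_abs_sub_le hc hn hε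
  exact ⟨N₀, fun N hN a ha => hN₀ (N + 1) (by omega) a ha⟩
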